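/- Identify $\mathbb{R}^2$ with $\mathbb{C}$. Let $S=[-\tfrac12,\tfrac12]^2$, let $B(R)$ be the open disc of radius $R$ about the origin, and let $$\Gamma_R=\{\lambda\in\mathbb{Z}^2:\ R-\tfrac1{\sqrt2}<|\lambda|<R+\tfrac1{\sqrt2}\},\qquad K(R)=\#\Gamma_R,\qquad A_R(\lambda)=\mathrm{Area}\big((\lambda+S)\cap B(R)\big).$$ List $\Gamma_R=\{\lambda_1,\dots,\lambda_{K(R)}\}$ in nondecreasing order of the argument in $[0,2\pi)$ (points with equal argument may be ordered arbitrarily), and read indices modulo $K(R)$. Let $G=[-\tfrac1{\sqrt2},\tfrac1{\sqrt2}]\times[0,2\pi)$ with the uniform probability measure $\frac{dr\,d\theta}{\sqrt8\,\pi}$, and let $T_\theta$ be the rotation by $\theta$ about the origin. Put $$A_\infty(r,\theta)=\mathrm{Area}\{(x,y)\in (r,0)+T_\theta S:\ x\le 0\}.$$ For $(r,\theta)\in G$ let $Q_{r,\theta}(z)=T_\theta z-r\,e^{i(\theta+\pi/2)}$, and let $\mathcal{R}_{r,\theta}=Q_{r,\theta}\big([0,\infty)\times[-\tfrac1{\sqrt2},\tfrac1{\sqrt2}]\big)$.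 This is the semi-infinite strip tilted by $\theta$ and shifted along its short side so that its point with coordinates $(0,r)$ is at the origin. Let $\kappa_1,\kappa_2,\dots$ be the points of $\mathcal{R}_{r,\theta}\cap\mathbb{Z}^2\setminus\{0\}$, listed in nondecreasing order of $t_\ell$, where $(t_\ell,\rho_\ell)=Q_{r,\theta}^{-1}(\kappa_\ell)$ (ties ordered arbitrarily). Thus $t_\ell$ and $\rho_\ell=\rho_\ell(r,\theta)$ are the projections of $\kappa_\ell$ onto the long and the short side of the strip. **Theorem.** For every fixed $k\ge1$ the limit, over real $R\to\infty$, $$C_k=\lim_{R\to\infty}\frac1{K(R)}\sum_{j=1}^{K(R)}\Big(A_R(\lambda_j)\,A_R(\lambda_{j+k})-\tfrac14\Big)$$ exists and does not depend on how ties are ordered. Moreover, for $(r,\theta)$ uniformly distributed in $G$, the random variables $A_\infty(r,\theta)$ and $A_\infty(\rho_k(r,\theta),\theta)$ are square integrable, and $$C_k=\mathbb{E}\big[A_\infty(r,\theta)\,A_\infty(\rho_k(r,\theta),\theta)\big]-\tfrac14=\mathrm{Cov}\big(A_\infty(r,\theta),\,A_\infty(\rho_k(r,\theta),\theta)\big).$$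 -/

import Mathlib

open MeasureTheory ProbabilityTheory Filter Topology

noncomputable section

namespace CircleLattice

/-! The plane `ℝ²` is identified with `ℂ` throughout; `volume` on `ℂ` is Lebesgue area. -/

/-- The integer lattice `ℤ²`. -/
def lattice : Set ℂ := {z | ∃ m n : ℤ, z = (m : ℂ) + (n : ℂ) * Complex.I}

/-- The unit square `S = [-1/2, 1/2]²`. -/
def unitSquare : Set ℂ := Set.Icc (-(1 / 2) : ℝ) (1 / 2) ×ℂ Set.Icc (-(1 / 2) : ℝ) (1 / 2)

/-- `Γ_R`: the lattice points in the open annulus `R - 1/√2 < |z| < R + 1/√2`. -/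
def Gam (R : ℝ) : Set ℂ := {z ∈ lattice | R - 1 / √2 < ‖z‖ ∧ ‖z‖ < R + 1 / √2}

/-- `K(R) = #Γ_R`. -/
def K (R : ℝ) : ℕ := (Gam R).ncard

/-- `A_R(z)`: the area of the part of the unit square centred at `z` lying in the disc `B(R)`. -/
def areaInDisc (R : ℝ) (z : ℂ) : ℝ :=
  volume.real ((fun w => z + w) '' unitSquare ∩ Metric.ball 0 R)

/-- The argument of `z`, normalised to lie in `[0, 2π)`. -/
def argument (z : ℂ) : ℝ := toIcoMod Real.two_pi_pos 0 z.arg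

/-- `lam 1, …, lam (K R)` lists every point of `Γ_R` exactly once, in nondecreasing order of the
argument (ties being broken arbitrarily), and the indices are read modulo `K R`. -/
structure IsArgOrdering (R : ℝ) (lam : ℕ → ℂ) : Prop where
  bijOn : Set.BijOn lam (Set.Icc 1 (K R)) (Gam R)
  sorted : MonotoneOn (fun j => argument (lam j)) (Set.Icc 1 (K R))
  periodic : ∀ j, lam (j + K R) = lam j

/-- The rectangle `G = [-1/√2, 1/√2] × [0, 2π)`, with points `(r, θ)`. -/
def G : Set (ℝ × ℝ) := Set.Icc (-(1 / √2)) (1 / √2) ×ˢ Set.Ico 0 (2 * Real.pi)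

/-- The uniform probability measure on `G`. -/
def unifG : Measure (ℝ × ℝ) := ProbabilityTheory.cond volume G

/-- The rotation `T_θ` of the plane about the origin by `θ`. -/
def T (θ : ℝ) (z : ℂ) : ℂ := Complex.exp (θ * Complex.I) * z

/-- `A_∞(r, θ)`: the area of the part of `S_{r,θ} = (r, 0) + T_θ S` to the left of the `y` axis. -/
def areaInf (r θ : ℝ) : ℝ :=
  volume.real {z ∈ (fun w => (r : ℂ) + T θ w) '' unitSquare | z.re ≤ 0}

/-- The straight semi-infinite strip `[0, ∞) × [-1/√2, 1/√2]`. -/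
def straightStrip : Set ℂ := Set.Ici (0 : ℝ) ×ℂ Set.Icc (-(1 / √2)) (1 / √2)

/-- The affine isometry placing the straight strip in the plane: the strip is tilted by `θ` and
shifted along its short side so that its point with coordinates `(0, r)` lands at the origin. -/
def Q (r θ : ℝ) (z : ℂ) : ℂ :=
  T θ z - (r : ℂ) * Complex.exp (((θ + Real.pi / 2 : ℝ) : ℂ) * Complex.I)

/-- The inverse of `Q r θ`: the coordinates of a point with respect to the tilted strip, the real
part being along the long side and the imaginary part along the short side. -/
def P (r θ : ℝ) (w : ℂ) : ℂ :=
  T (-θ) (w + (r : ℂ) * Complex.exp (((θ + Real.pi / 2 : ℝ) : ℂ) * Complex.I))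

/-- The tilted, shifted semi-infinite strip. -/
def strip (r θ : ℝ) : Set ℂ := Q r θ '' straightStrip

/-- `kap 1, kap 2, …` lists every lattice point of the strip other than the origin exactly once, in
nondecreasing order of the projection onto the long side (ties being broken arbitrarily). -/
structure IsStripOrdering (r θ : ℝ) (kap : ℕ → ℂ) : Prop where
  bijOn : Set.BijOn kap (Set.Ici 1) ((strip r θ ∩ lattice) \ {0})
  sorted : MonotoneOn (fun l => (P r θ (kap l)).re) (Set.Ici 1)

/-- `ρ_k(r, θ)`: the projection of the `k`-th listed point onto the short side of the strip. -/
def rho (kap : ℝ → ℝ → ℕ → ℂ) (k : ℕ) (r θ : ℝ) : ℝ := (P r θ (kap r θ k)).im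

/-- The random variable `A_∞(r, θ)` on `G`. -/
def X (p : ℝ × ℝ) : ℝ := areaInf p.1 p.2

/-- The random variable `A_{∞,k}(r, θ) = A_∞(ρ_k(r, θ), θ)` on `G`. -/
def Y (kap : ℝ → ℝ → ℕ → ℂ) (k : ℕ) (p : ℝ × ℝ) : ℝ := areaInf (rho kap k p.1 p.2) p.2

end CircleLattice

end

noncomputable section

namespace CircleLattice

open ComplexConjugate

/-! ### Rotations and rectangles -/

/-! Seen from a lattice point z near the circle, the disc is a half-plane up to O(1/‖z‖) and the
annulus is a straight strip of half-width 1/√2. So, in the limit, everything near z depends only on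
s = ‖z‖ - R and u = z/‖z‖: the area at z is close to `halfArea s u`, the k-th point before z in the
order of argument is z + p with p the k-th lattice point of the strip with short direction u and
shift s, and the area there is close to `halfArea (shortCoord s u p) u`. Averages over Γ_R thus
become averages of an explicit function `localFun` of (s, u), once these pairs are known to
equidistribute.

Equidistribution (`tendsto_sum_nearCircle`) is proved softly. If u₀ is orthogonal to no nonzero
lattice vector, the projections of ℤ² to u₀ are dense. On an arc of length about √R around u₀, a
translation by any w can therefore be imitated by a lattice vector with nearly the same projection,
and lattice translations do not change lattice sums (`tendsto_localized_shift`). Averaging over u₀,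
almost every one being generic, shows that sums over ℤ² and ℤ² + w differ by o(R); averaging over w
in the unit cell replaces the lattice sum by an area integral, computed in polar coordinates.

`localFun` can be discontinuous only where a lattice point lies on an edge of the strip or two
points have the same long coordinate. `degeneracy` measures the distance to such configurations; its
zero set is null and is cut off in `tendsto_sum_Gam`. Off it the order of the points is stable under
small perturbations (`Separated.isKth_iff`), so the annulus order agrees with the strip order
(`apply_eq_add_kth`), however ties are broken.

The strip points clockwise and hence produces predecessors; a cyclic change of index turns these
into successors. Finally E[X] = 1/2 by the symmetry r ↦ -r, and E[Y] = E[X] because for each R the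
k-step shift permutes Γ_R, an identity that survives the limit. -/

lemma volume_reProdIm (s t : Set ℝ) : volume (s ×ℂ t) = volume s * volume t := by
  have h : s ×ℂ t = Complex.measurableEquivRealProd ⁻¹' (s ×ˢ t) := by
    ext z; simp [Complex.mem_reProdIm]
  rw [h, Complex.volume_preserving_equiv_real_prod.measure_preimage_equiv,
    Measure.volume_eq_prod, Measure.prod_prod]

lemma volume_rect (a b c d : ℝ) (hab : a ≤ b) (hcd : c ≤ d) :
    volume.real (Set.Icc a b ×ℂ Set.Icc c d) = (b - a) * (d - c) := by
  rw [measureReal_def, volume_reProdIm, Real.volume_Icc, Real.volume_Icc, ENNReal.toReal_mul,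
    ENNReal.toReal_ofReal (by linarith), ENNReal.toReal_ofReal (by linarith)]

lemma volume_rect_ne_top (a b c d : ℝ) : volume (Set.Icc a b ×ℂ Set.Icc c d) ≠ ⊤ := by
  rw [volume_reProdIm, Real.volume_Icc, Real.volume_Icc]
  exact ENNReal.mul_ne_top ENNReal.ofReal_ne_top ENNReal.ofReal_ne_top

lemma measurePreserving_mul_left {u : ℂ} (hu : ‖u‖ = 1) :
    MeasurePreserving (fun w : ℂ => u * w) := by
  have := (rotation (⟨u, by simpa [Submonoid.unitSphere] using hu⟩ : Circle)).measurePreserving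
  exact this

lemma measurableEmbedding_mul_left {u : ℂ} (hu : ‖u‖ = 1) :
    MeasurableEmbedding (fun w : ℂ => u * w) := by
  have := (rotation (⟨u, by simpa [Submonoid.unitSphere] using hu⟩ : Circle)).toHomeomorph.measurableEmbedding
  exact this

lemma volume_preimage_mul_left {u : ℂ} (hu : ‖u‖ = 1) (s : Set ℂ) :
    volume ((fun w : ℂ => u * w) ⁻¹' s) = volume s :=
  (measurePreserving_mul_left hu).measure_preimage_emb (measurableEmbedding_mul_left hu) s

lemma norm_le_one_of_mem_unitSquare {w : ℂ} (hw : w ∈ unitSquare) : ‖w‖ ≤ 1 := by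
  obtain ⟨h1, h2⟩ := Complex.mem_reProdIm.1 hw
  refine (Complex.norm_le_abs_re_add_abs_im w).trans ?_
  have := abs_le.2 h1
  have := abs_le.2 h2
  linarith

lemma volume_real_unitSquare : volume.real unitSquare = 1 := by
  unfold unitSquare
  rw [volume_rect _ _ _ _ (by norm_num) (by norm_num)]; norm_num

lemma volume_unitSquare_ne_top : volume unitSquare ≠ ⊤ := volume_rect_ne_top _ _ _ _

/-- The part of the unit square, translated by `s` in the direction `u`, that lies behind the line
through the origin orthogonal to `u`. -/
def halfArea (s : ℝ) (u : ℂ) : ℝ := volume.real {w ∈ unitSquare | s + (conj u * w).re ≤ 0}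

lemma volume_sep_ne_top (p : ℂ → Prop) : volume {w ∈ unitSquare | p w} ≠ ⊤ :=
  ne_top_of_le_ne_top volume_unitSquare_ne_top (measure_mono (Set.sep_subset _ _))

lemma volume_real_sep_le_one (p : ℂ → Prop) : volume.real {w ∈ unitSquare | p w} ≤ 1 := by
  rw [← volume_real_unitSquare]
  exact measureReal_mono (Set.sep_subset _ _) volume_unitSquare_ne_top

/-- The square lies in the unit disc, so after rotating u to 1 the set fits in a rectangle of sides
2ε and 2. The constant 4 in the later area estimates comes from here. -/
lemma volume_real_thin_strip {u : ℂ} (hu : ‖u‖ = 1) (s : ℝ) {ε : ℝ} (hε : 0 ≤ ε) :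
    volume.real {w ∈ unitSquare | |s + (conj u * w).re| ≤ ε} ≤ 4 * ε := by
  have hu' : ‖conj u‖ = 1 := by simpa using hu
  have hsub : {w ∈ unitSquare | |s + (conj u * w).re| ≤ ε} ⊆
      (fun w : ℂ => conj u * w) ⁻¹' (Set.Icc (-s - ε) (-s + ε) ×ℂ Set.Icc (-1) 1) := by
    rintro w ⟨hw, hs⟩
    rw [Set.mem_preimage, Complex.mem_reProdIm]
    have h1 := abs_le.1 hs
    refine ⟨⟨by linarith, by linarith⟩, ?_⟩
    rw [Set.mem_Icc, ← abs_le]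
    refine (Complex.abs_im_le_norm _).trans ?_
    rw [norm_mul, hu', one_mul]
    exact norm_le_one_of_mem_unitSquare hw
  have hv := volume_preimage_mul_left hu' (Set.Icc (-s - ε) (-s + ε) ×ℂ Set.Icc (-1) 1)
  refine (measureReal_mono hsub (by rw [hv]; exact volume_rect_ne_top _ _ _ _)).trans ?_
  rw [measureReal_def, hv, ← measureReal_def, volume_rect _ _ _ _ (by linarith) (by linarith)]
  linarith

/-- A region squeezed between two parallel half-planes differs from the middle one only inside a
thin strip. This gives both the Lipschitz bound for `halfArea` and the comparison of disc and
half-plane. -/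
lemma abs_volume_sep_sub_halfArea_le {u : ℂ} (hu : ‖u‖ = 1) (s : ℝ) {ε : ℝ} (hε : 0 ≤ ε)
    {p : ℂ → Prop} (h1 : ∀ w ∈ unitSquare, s + (conj u * w).re < -ε → p w)
    (h2 : ∀ w ∈ unitSquare, p w → s + (conj u * w).re ≤ ε) :
    |volume.real {w ∈ unitSquare | p w} - halfArea s u| ≤ 4 * ε := by
  have hD := volume_real_thin_strip hu s hε
  set D := {w ∈ unitSquare | |s + (conj u * w).re| ≤ ε}
  have e1 : {w ∈ unitSquare | p w} ⊆ {w ∈ unitSquare | s + (conj u * w).re ≤ 0} ∪ D := by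
    rintro w ⟨hw, hp⟩
    by_cases h : s + (conj u * w).re ≤ 0
    · exact Or.inl ⟨hw, h⟩
    · exact Or.inr ⟨hw, abs_le.2 ⟨by linarith, h2 w hw hp⟩⟩
  have e2 : {w ∈ unitSquare | s + (conj u * w).re ≤ 0} ⊆ {w ∈ unitSquare | p w} ∪ D := by
    rintro w ⟨hw, hp⟩
    by_cases h : s + (conj u * w).re < -ε
    · exact Or.inl ⟨hw, h1 w hw h⟩
    · exact Or.inr ⟨hw, abs_le.2 ⟨by linarith, by linarith⟩⟩
  have i1 := (measureReal_mono e1 (measure_union_ne_top (volume_sep_ne_top _)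
    (volume_sep_ne_top _))).trans (measureReal_union_le _ _)
  have i2 := (measureReal_mono e2 (measure_union_ne_top (volume_sep_ne_top _)
    (volume_sep_ne_top _))).trans (measureReal_union_le _ _)
  unfold halfArea
  rw [abs_le]
  constructor <;> linarith

lemma halfArea_nonneg (s : ℝ) (u : ℂ) : 0 ≤ halfArea s u := measureReal_nonneg

lemma halfArea_le_one (s : ℝ) (u : ℂ) : halfArea s u ≤ 1 := volume_real_sep_le_one _

lemma abs_halfArea_le_one (s : ℝ) (u : ℂ) : |halfArea s u| ≤ 1 := by
  rw [abs_of_nonneg (halfArea_nonneg s u)]; exact halfArea_le_one s u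

/-- Only u has to be a unit vector, while u' is arbitrary; hence continuity holds in the ambient ℝ ×
ℂ at every point of ℝ × S¹, not merely along it. -/
lemma abs_halfArea_sub_le {u : ℂ} (hu : ‖u‖ = 1) (s s' : ℝ) (u' : ℂ) :
    |halfArea s' u' - halfArea s u| ≤ 4 * (|s' - s| + ‖u' - u‖) := by
  have key : ∀ w ∈ unitSquare, |(s' + (conj u' * w).re) - (s + (conj u * w).re)|
      ≤ |s' - s| + ‖u' - u‖ := by
    intro w hw
    have : (s' + (conj u' * w).re) - (s + (conj u * w).re) =
        (s' - s) + (conj (u' - u) * w).re := by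
      simp only [map_sub, sub_mul, Complex.sub_re]; ring
    rw [this]
    refine (abs_add_le _ _).trans (add_le_add le_rfl ((Complex.abs_re_le_norm _).trans ?_))
    rw [norm_mul, RCLike.norm_conj]
    exact mul_le_of_le_one_right (norm_nonneg _) (norm_le_one_of_mem_unitSquare hw)
  refine abs_volume_sep_sub_halfArea_le hu s (by positivity) ?_ ?_
  · intro w hw h
    have := abs_le.1 (key w hw)
    linarith [this.2]
  · intro w hw h
    have := abs_le.1 (key w hw)
    linarith [this.1]

lemma continuousAt_halfArea {x : ℝ × ℂ} (hx : ‖x.2‖ = 1) :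
    ContinuousAt (fun x : ℝ × ℂ => halfArea x.1 x.2) x := by
  rw [ContinuousAt, tendsto_iff_dist_tendsto_zero]
  refine squeeze_zero (fun _ => dist_nonneg)
    (fun y => (abs_halfArea_sub_le hx x.1 y.1 y.2)) ?_
  have : Continuous fun y : ℝ × ℂ => 4 * (|y.1 - x.1| + ‖y.2 - x.2‖) := by fun_prop
  simpa using this.tendsto x

/-! ### Expansion of the norm -/

lemma conj_dir_mul_self {z : ℂ} (hz : z ≠ 0) : conj (z / (‖z‖ : ℂ)) * z = (‖z‖ : ℂ) := by
  have h : (‖z‖ : ℂ) ≠ 0 := by simpa using hz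
  rw [map_div₀, Complex.conj_ofReal, div_mul_eq_mul_div, mul_comm, Complex.mul_conj,
    Complex.normSq_eq_norm_sq]
  field_simp
  push_cast; ring

lemma norm_dir {z : ℂ} (hz : z ≠ 0) : ‖z / (‖z‖ : ℂ)‖ = 1 := by
  rw [norm_div, Complex.norm_real, norm_norm, div_self (norm_ne_zero_iff.2 hz)]

/-- In the frame of z the vector z + y is (‖z‖ + a, b) with a² + b² = ‖y‖². The lower bound drops b;
the upper bound follows by squaring. -/
lemma abs_norm_add_sub_le {z y : ℂ} (hz : z ≠ 0) (hy : ‖y‖ ≤ ‖z‖ / 2) :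
    |‖z + y‖ - ‖z‖ - (conj (z / (‖z‖ : ℂ)) * y).re| ≤ ‖y‖ ^ 2 / ‖z‖ := by
  set u := z / (‖z‖ : ℂ) with hu
  have hn : 0 < ‖z‖ := norm_pos_iff.2 hz
  have hu1 : ‖conj u‖ = 1 := by rw [RCLike.norm_conj]; exact norm_dir hz
  have e : conj u * (z + y) = ⟨‖z‖ + (conj u * y).re, (conj u * y).im⟩ := by
    rw [mul_add, hu, conj_dir_mul_self hz]
    apply Complex.ext <;> simp
  have e1 : ‖z + y‖ ^ 2 = (‖z‖ + (conj u * y).re) ^ 2 + (conj u * y).im ^ 2 := by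
    have : ‖z + y‖ = ‖conj u * (z + y)‖ := by rw [norm_mul, hu1, one_mul]
    rw [this, e, ← Complex.normSq_eq_norm_sq, Complex.normSq_mk]; ring
  have e2 : ‖y‖ ^ 2 = (conj u * y).re ^ 2 + (conj u * y).im ^ 2 := by
    have : ‖y‖ = ‖conj u * y‖ := by rw [norm_mul, hu1, one_mul]
    rw [this, ← Complex.normSq_eq_norm_sq, Complex.normSq_apply]; ring
  set a := (conj u * y).re
  set b := (conj u * y).im
  have ha : |a| ≤ ‖z‖ / 2 := by
    refine le_trans ?_ hy
    refine abs_le_of_sq_le_sq (by nlinarith [sq_nonneg b]) (norm_nonneg y)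
  have ha' := abs_le.1 ha
  have hc : 0 ≤ ‖y‖ ^ 2 / ‖z‖ := by positivity
  rw [abs_le]
  constructor
  · have : ‖z‖ + a ≤ ‖z + y‖ := abs_le_of_sq_le_sq' (by nlinarith [sq_nonneg b]) (norm_nonneg _) |>.2
    linarith
  · have : ‖z + y‖ ≤ ‖z‖ + a + ‖y‖ ^ 2 / ‖z‖ := by
      refine abs_le_of_sq_le_sq' ?_ (by linarith) |>.2
      -- Since |a| ≤ ‖z‖/2, the factor 2(‖z‖ + a)/‖z‖ is at least 1, so the cross term of the square
      -- absorbs all of ‖y‖².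
      have h1 : ‖y‖ ^ 2 ≤ 2 * (‖z‖ + a) * (‖y‖ ^ 2 / ‖z‖) := by
        have : 2 * (‖z‖ + a) * (‖y‖ ^ 2 / ‖z‖) = (2 * (‖z‖ + a) / ‖z‖) * ‖y‖ ^ 2 := by ring
        rw [this]
        refine le_mul_of_one_le_left (sq_nonneg _) ?_
        rw [one_le_div hn]; linarith
      nlinarith [sq_nonneg a, sq_nonneg (‖y‖ ^ 2 / ‖z‖)]
    linarith

lemma norm_dir_sub_dir_le {z y : ℂ} (hz : z ≠ 0) (hy : y ≠ 0) :
    ‖y / (‖y‖ : ℂ) - z / (‖z‖ : ℂ)‖ ≤ 2 * ‖y - z‖ / ‖z‖ := by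
  have hn : 0 < ‖z‖ := norm_pos_iff.2 hz
  have hm : 0 < ‖y‖ := norm_pos_iff.2 hy
  have hn' : (‖z‖ : ℂ) ≠ 0 := by exact_mod_cast hn.ne'
  have hm' : (‖y‖ : ℂ) ≠ 0 := by exact_mod_cast hm.ne'
  have e : y / (‖y‖ : ℂ) - z / (‖z‖ : ℂ) =
      (y - z) / (‖z‖ : ℂ) + (y / (‖y‖ : ℂ)) * (((‖z‖ - ‖y‖ : ℝ) : ℂ) / (‖z‖ : ℂ)) := by
    push_cast
    field_simp
    ring
  rw [e]
  refine (norm_add_le _ _).trans ?_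
  rw [norm_mul, norm_dir hy, one_mul, norm_div, norm_div, Complex.norm_real, Complex.norm_real,
    norm_norm, Real.norm_eq_abs, ← add_div]
  gcongr
  have := abs_norm_sub_norm_le z y
  rw [norm_sub_rev] at this
  linarith

/-! ### The two area functions -/

lemma areaInDisc_eq (R : ℝ) (z : ℂ) :
    areaInDisc R z = volume.real {w ∈ unitSquare | ‖z + w‖ < R} := by
  unfold areaInDisc
  rw [measureReal_def, measureReal_def]
  congr 1
  rw [← measure_preimage_add volume z]
  congr 1
  ext w
  simp only [Set.mem_preimage, Set.mem_inter_iff, Set.mem_image, add_right_inj, exists_eq_right,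
    Metric.mem_ball, dist_zero_right, Set.mem_ofPred_eq]

lemma areaInDisc_nonneg (R : ℝ) (z : ℂ) : 0 ≤ areaInDisc R z := measureReal_nonneg

lemma areaInDisc_le_one (R : ℝ) (z : ℂ) : areaInDisc R z ≤ 1 := by
  rw [areaInDisc_eq]; exact volume_real_sep_le_one _

lemma abs_areaInDisc_le_one (R : ℝ) (z : ℂ) : |areaInDisc R z| ≤ 1 := by
  rw [abs_of_nonneg (areaInDisc_nonneg R z)]; exact areaInDisc_le_one R z

/-- Points of the square at z + h are within C + 1 of z, where the linear expansion of the norm at z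
has error at most (C + 1)²/‖z‖. Expanding at z, not at z + h, gives both areas the same direction.
-/
lemma abs_areaInDisc_sub_halfArea_le (R : ℝ) {z h : ℂ} {C : ℝ} (hC : ‖h‖ ≤ C) (hz : z ≠ 0)
    (hzC : 2 * (C + 1) ≤ ‖z‖) :
    |areaInDisc R (z + h) - halfArea (‖z‖ - R + (conj (z / (‖z‖ : ℂ)) * h).re) (z / (‖z‖ : ℂ))|
      ≤ 4 * ((C + 1) ^ 2 / ‖z‖) := by
  have key : ∀ w ∈ unitSquare, |‖z + h + w‖ - R - (‖z‖ - R + (conj (z / (‖z‖ : ℂ)) * h).re +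
      (conj (z / (‖z‖ : ℂ)) * w).re)| ≤ (C + 1) ^ 2 / ‖z‖ := by
    intro w hw
    have hw1 := norm_le_one_of_mem_unitSquare hw
    have hn : ‖h + w‖ ≤ C + 1 := (norm_add_le _ _).trans (by linarith)
    have := abs_norm_add_sub_le hz (y := h + w) (by linarith)
    rw [mul_add, Complex.add_re, ← add_assoc] at this
    have e : (‖z + h + w‖ - R - (‖z‖ - R + (conj (z / (‖z‖ : ℂ)) * h).re +
      (conj (z / (‖z‖ : ℂ)) * w).re)) = ‖z + h + w‖ - ‖z‖ - ((conj (z / (‖z‖ : ℂ)) * h).re +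
      (conj (z / (‖z‖ : ℂ)) * w).re) := by ring
    rw [e]
    refine this.trans ?_
    gcongr
  rw [areaInDisc_eq]
  refine abs_volume_sep_sub_halfArea_le (norm_dir hz) _ (by positivity) ?_ ?_
  · intro w hw h1
    have := abs_le.1 (key w hw)
    linarith [this.2]
  · intro w hw h1
    have := abs_le.1 (key w hw)
    linarith [this.1]

lemma halfArea_mul_I (s : ℝ) (u : ℂ) : halfArea s (Complex.I * u) = halfArea s u := by
  unfold halfArea
  rw [measureReal_def, measureReal_def,
    ← volume_preimage_mul_left (u := Complex.I) (by simp) {w ∈ unitSquare | s + _ ≤ 0}]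
  congr 2
  ext w
  have : conj (Complex.I * u) * (Complex.I * w) = conj u * w := by
    rw [map_mul, Complex.conj_I]; linear_combination (-conj u * w) * Complex.I_mul_I
  simp only [Set.mem_preimage, Set.mem_ofPred_eq, this]
  simp only [unitSquare, Complex.mem_reProdIm,
    Set.mem_Icc, Complex.mul_re, Complex.I_re, Complex.I_im, Complex.mul_im]
  constructor
  · rintro ⟨⟨⟨a, b⟩, c, d⟩, e⟩
    exact ⟨⟨⟨by linarith, by linarith⟩, by linarith, by linarith⟩, e⟩
  · rintro ⟨⟨⟨a, b⟩, c, d⟩, e⟩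
    exact ⟨⟨⟨by linarith, by linarith⟩, by linarith, by linarith⟩, e⟩

lemma volume_preimage_conj (s : Set ℂ) : volume ((fun w : ℂ => conj w) ⁻¹' s) = volume s :=
  (Complex.conjLIE.measurePreserving).measure_preimage_emb
    Complex.conjLIE.toHomeomorph.measurableEmbedding s

lemma halfArea_conj (s : ℝ) (u : ℂ) : halfArea s (conj u) = halfArea s u := by
  unfold halfArea
  rw [measureReal_def, measureReal_def, ← volume_preimage_conj {w ∈ unitSquare | s + _ ≤ 0}]
  congr 2
  ext w
  simp only [Set.mem_preimage, Set.mem_ofPred_eq, unitSquare, Complex.mem_reProdIm,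
    Set.mem_Icc, Complex.conj_re, Complex.conj_im, Complex.mul_re, mul_neg, neg_mul, neg_neg]
  constructor
  · rintro ⟨⟨⟨a, b⟩, c, d⟩, e⟩
    exact ⟨⟨⟨by linarith, by linarith⟩, by linarith, by linarith⟩, by linarith⟩
  · rintro ⟨⟨⟨a, b⟩, c, d⟩, e⟩
    exact ⟨⟨⟨by linarith, by linarith⟩, by linarith, by linarith⟩, by linarith⟩

lemma norm_exp_I (θ : ℝ) : ‖Complex.exp (θ * Complex.I)‖ = 1 := Complex.norm_exp_ofReal_mul_I θ

/-- The real part of exp(iθ)w is the projection of w to exp(-iθ). The reflection and quarter-turn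
symmetries of the square replace this direction by i·exp(iθ), the short direction of the strip, so
that areas and strip coordinates refer to one vector. -/
lemma areaInf_eq (r θ : ℝ) :
    areaInf r θ = halfArea r (Complex.I * Complex.exp (θ * Complex.I)) := by
  rw [halfArea_mul_I, ← halfArea_conj]
  unfold areaInf halfArea
  rw [measureReal_def, measureReal_def, ← measure_preimage_add volume (r : ℂ),
    ← volume_preimage_mul_left (norm_exp_I θ)]
  congr 2
  ext w
  have hinj : ∀ x, T θ x = Complex.exp (θ * Complex.I) * w ↔ x = w := fun x => by
    simp [T, Complex.exp_ne_zero]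
  simp only [Set.mem_preimage, Set.mem_ofPred_eq, Set.mem_image, add_right_inj, hinj,
    exists_eq_right, Complex.conj_conj, Complex.add_re, Complex.ofReal_re]

/-- The central symmetry of the square exchanges the two half-planes, whose common boundary is null.
-/
lemma halfArea_neg {u : ℂ} (hu : ‖u‖ = 1) (s : ℝ) : halfArea (-s) u = 1 - halfArea s u := by
  have h0 : volume.real {w ∈ unitSquare | |s + (conj u * w).re| ≤ 0} = 0 :=
    le_antisymm (by simpa using volume_real_thin_strip hu s le_rfl) measureReal_nonneg
  have h1 : halfArea (-s) u = volume.real {w ∈ unitSquare | 0 ≤ s + (conj u * w).re} := by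
    unfold halfArea
    rw [measureReal_def, measureReal_def,
      ← volume_preimage_mul_left (u := -1) (by simp) {w ∈ unitSquare | -s + _ ≤ 0}]
    congr 2
    ext w
    simp only [Set.mem_preimage, Set.mem_ofPred_eq, unitSquare, Complex.mem_reProdIm,
      Set.mem_Icc, neg_one_mul, mul_neg, Complex.neg_re, Complex.neg_im]
    constructor
    · rintro ⟨⟨⟨a, b⟩, c, d⟩, e⟩
      exact ⟨⟨⟨by linarith, by linarith⟩, by linarith, by linarith⟩, by linarith⟩
    · rintro ⟨⟨⟨a, b⟩, c, d⟩, e⟩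
      exact ⟨⟨⟨by linarith, by linarith⟩, by linarith, by linarith⟩, by linarith⟩
  have hu1 : unitSquare = {w ∈ unitSquare | 0 ≤ s + (conj u * w).re} ∪
      {w ∈ unitSquare | s + (conj u * w).re ≤ 0} := by
    ext w
    simp only [Set.mem_union, Set.mem_ofPred_eq, ← and_or_left]
    exact ⟨fun h => ⟨h, le_total _ _⟩, fun h => h.1⟩
  have hm : MeasurableSet {w ∈ unitSquare | s + (conj u * w).re ≤ 0} := by
    have h1 : MeasurableSet unitSquare := by
      have : IsClosed unitSquare := IsClosed.reProdIm isClosed_Icc isClosed_Icc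
      exact this.measurableSet
    have h2 : MeasurableSet {w : ℂ | s + (conj u * w).re ≤ 0} :=
      measurableSet_le (by fun_prop) measurable_const
    exact h1.inter h2
  have h2 := measureReal_union_add_inter (μ := volume) (s := {w ∈ unitSquare | 0 ≤ s + (conj u * w).re}) hm
    (volume_sep_ne_top _) (volume_sep_ne_top _)
  rw [← hu1, volume_real_unitSquare] at h2
  have h3 : {w ∈ unitSquare | 0 ≤ s + (conj u * w).re} ∩
      {w ∈ unitSquare | s + (conj u * w).re ≤ 0} = {w ∈ unitSquare | |s + (conj u * w).re| ≤ 0} := by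
    ext w
    simp only [Set.mem_inter_iff, Set.mem_ofPred_eq, abs_nonpos_iff]
    constructor
    · rintro ⟨⟨a, b⟩, _, c⟩; exact ⟨a, le_antisymm c b⟩
    · rintro ⟨a, b⟩; exact ⟨⟨a, b.ge⟩, a, b.le⟩
  rw [h3, h0] at h2
  rw [h1]
  change _ = 1 - volume.real _
  linarith

/-! ### Lattice points, cells and counting -/

/-- The lattice point with integer coordinates `p`. -/
def pt (p : ℤ × ℤ) : ℂ := (p.1 : ℂ) + (p.2 : ℂ) * Complex.I

@[simp] lemma pt_re (p : ℤ × ℤ) : (pt p).re = p.1 := by simp [pt]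
@[simp] lemma pt_im (p : ℤ × ℤ) : (pt p).im = p.2 := by simp [pt]

lemma pt_add (p q : ℤ × ℤ) : pt (p + q) = pt p + pt q := by
  apply Complex.ext <;> simp

lemma pt_sub (p q : ℤ × ℤ) : pt (p - q) = pt p - pt q := by
  apply Complex.ext <;> simp

lemma pt_injective : Function.Injective pt := by
  intro p q h
  have h1 := congrArg Complex.re h
  have h2 := congrArg Complex.im h
  simp only [pt_re, pt_im, Int.cast_inj] at h1 h2
  exact Prod.ext h1 h2

@[simp] lemma pt_zero : pt 0 = 0 := by simp [pt]

lemma mem_lattice_iff {z : ℂ} : z ∈ lattice ↔ ∃ p, pt p = z := by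
  constructor
  · rintro ⟨m, n, rfl⟩; exact ⟨(m, n), rfl⟩
  · rintro ⟨p, rfl⟩; exact ⟨p.1, p.2, rfl⟩

lemma finite_norm_pt_le (ρ : ℝ) : {p : ℤ × ℤ | ‖pt p‖ ≤ ρ}.Finite := by
  refine (Set.Finite.prod (Set.finite_Icc (-⌈ρ⌉) ⌈ρ⌉) (Set.finite_Icc (-⌈ρ⌉) ⌈ρ⌉)).subset ?_
  intro p hp
  have hp' : ‖pt p‖ ≤ ρ := hp
  have h1 := (Complex.abs_re_le_norm (pt p)).trans hp'
  have h2 := (Complex.abs_im_le_norm (pt p)).trans hp'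
  rw [pt_re, abs_le] at h1
  rw [pt_im, abs_le] at h2
  have hc := Int.le_ceil ρ
  refine ⟨⟨?_, ?_⟩, ?_, ?_⟩ <;> (rify; linarith)

/-- The lattice points of norm at most `ρ`. -/
def ballPts (ρ : ℝ) : Finset (ℤ × ℤ) := (finite_norm_pt_le ρ).toFinset

@[simp] lemma mem_ballPts {ρ : ℝ} {p : ℤ × ℤ} : p ∈ ballPts ρ ↔ ‖pt p‖ ≤ ρ := by
  simp [ballPts]

/-- The fundamental cell of the integer lattice. -/
def cell : Set ℂ := Set.Ico (0 : ℝ) 1 ×ℂ Set.Ico (0 : ℝ) 1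

lemma norm_le_of_mem_cell {w : ℂ} (hw : w ∈ cell) : ‖w‖ ≤ 2 := by
  obtain ⟨⟨a, b⟩, c, d⟩ := Complex.mem_reProdIm.1 hw
  refine (Complex.norm_le_abs_re_add_abs_im w).trans ?_
  rw [abs_of_nonneg a, abs_of_nonneg c]; linarith

lemma measurableSet_cell : MeasurableSet cell := by
  have : cell = Complex.re ⁻¹' Set.Ico 0 1 ∩ Complex.im ⁻¹' Set.Ico 0 1 := rfl
  rw [this]
  exact (Complex.measurable_re measurableSet_Ico).inter (Complex.measurable_im measurableSet_Ico)

lemma volume_cell : volume cell = 1 := by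
  rw [cell, volume_reProdIm]; simp

lemma existsUnique_sub_mem_cell (z : ℂ) : ∃! p : ℤ × ℤ, z - pt p ∈ cell := by
  refine ⟨(⌊z.re⌋, ⌊z.im⌋), ?_, ?_⟩
  · refine Complex.mem_reProdIm.2 ⟨?_, ?_⟩
    · simp [Int.fract_lt_one]
    · simp [Int.fract_lt_one]
  · intro p hp
    obtain ⟨⟨a, b⟩, c, d⟩ := Complex.mem_reProdIm.1 hp
    simp only [Complex.sub_re, Complex.sub_im, pt_re, pt_im] at a b c d
    refine Prod.ext ?_ ?_
    · exact (Int.floor_eq_iff.2 ⟨by linarith, by linarith⟩).symm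
    · exact (Int.floor_eq_iff.2 ⟨by linarith, by linarith⟩).symm

/-- The translate of the cell by a lattice point. -/
def cellAt (p : ℤ × ℤ) : Set ℂ := (fun z => z - pt p) ⁻¹' cell

lemma measurableSet_cellAt (p : ℤ × ℤ) : MeasurableSet (cellAt p) :=
  measurableSet_cell.preimage (by fun_prop)

lemma volume_cellAt (p : ℤ × ℤ) : volume (cellAt p) = 1 := by
  rw [cellAt, (measurePreserving_sub_right volume (pt p)).measure_preimage
    measurableSet_cell.nullMeasurableSet, volume_cell]

/-- The lattice translates of the unit cell are disjoint and of area one, so counting reduces to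
measuring a region containing them. -/
lemma card_le_volume {A : Finset (ℤ × ℤ)} {E : Set ℂ} (hE : volume E ≠ ⊤)
    (h : ∀ p ∈ A, ∀ w ∈ cell, pt p + w ∈ E) : (A.card : ℝ) ≤ volume.real E := by
  have h1 : (⋃ p ∈ A, cellAt p) ⊆ E := by
    intro z hz
    simp only [Set.mem_iUnion] at hz
    obtain ⟨p, hp, hz⟩ := hz
    have := h p hp _ hz
    simpa using this
  have h2 := measure_biUnion_finset (μ := volume) (s := A) (f := cellAt) (by
    intro p _ q _ hpq
    refine Set.disjoint_left.2 fun z hz1 hz2 => hpq ?_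
    exact (existsUnique_sub_mem_cell z).unique hz1 hz2) (fun p _ => measurableSet_cellAt p)
  simp only [volume_cellAt, Finset.sum_const, nsmul_eq_mul, mul_one] at h2
  have h3 := measure_mono (μ := volume) h1
  rw [h2] at h3
  have := ENNReal.toReal_mono hE h3
  simpa [measureReal_def] using this

lemma abs_tsum_le_card_mul {f : ℤ × ℤ → ℝ} {A : Finset (ℤ × ℤ)} (hA : ∀ p, f p ≠ 0 → p ∈ A)
    {η : ℝ} (hη : ∀ p ∈ A, |f p| ≤ η) : |∑' p, f p| ≤ A.card * η := by
  rw [tsum_eq_sum (s := A) (fun p hp => by by_contra h; exact hp (hA p h))]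
  refine (Finset.abs_sum_le_sum_abs _ _).trans ((Finset.sum_le_sum hη).trans ?_)
  simp

lemma summable_of_finset {f : ℤ × ℤ → ℝ} {A : Finset (ℤ × ℤ)} (hA : ∀ p, f p ≠ 0 → p ∈ A) :
    Summable f :=
  summable_of_ne_finset_zero (s := A) (fun p hp => by by_contra h; exact hp (hA p h))

/-- Unfolding of an integral over the plane to the cell. -/
lemma integral_eq_setIntegral_cell {f : ℂ → ℝ} (hf : Integrable f) {A : Finset (ℤ × ℤ)}
    (hA : ∀ p, ∀ w ∈ cell, f (pt p + w) ≠ 0 → p ∈ A) :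
    ∫ z, f z = ∫ w in cell, ∑ p ∈ A, f (pt p + w) := by
  have h1 : ∀ z, f z = ∑ p ∈ A, (cellAt p).indicator f z := by
    intro z
    obtain ⟨p, hp, hu⟩ := existsUnique_sub_mem_cell z
    by_cases hpA : p ∈ A
    · rw [Finset.sum_eq_single_of_mem p hpA, Set.indicator_of_mem (show z ∈ cellAt p from hp)]
      intro q _ hq
      exact Set.indicator_of_notMem (s := cellAt q) (fun h => hq (hu q h)) f
    · have h0 : f z = 0 := by
        by_contra h
        exact hpA (hA p _ hp (by simpa using h))
      rw [h0, Finset.sum_eq_zero]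
      intro q _
      by_cases hq : z ∈ cellAt q
      · rw [Set.indicator_of_mem hq, h0]
      · exact Set.indicator_of_notMem hq _
  have h2 : ∀ p w, (cellAt p).indicator f (pt p + w) = cell.indicator (fun w => f (pt p + w)) w := by
    intro p w
    by_cases hw : w ∈ cell
    · rw [Set.indicator_of_mem hw, Set.indicator_of_mem]
      simpa [cellAt] using hw
    · rw [Set.indicator_of_notMem hw, Set.indicator_of_notMem]
      simpa [cellAt] using hw
  calc ∫ z, f z = ∫ z, ∑ p ∈ A, (cellAt p).indicator f z := integral_congr_ae (.of_forall h1)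
    _ = ∑ p ∈ A, ∫ z, (cellAt p).indicator f z :=
        integral_finsetSum _ fun p _ => hf.indicator (measurableSet_cellAt p)
    _ = ∑ p ∈ A, ∫ w in cell, f (pt p + w) := by
        refine Finset.sum_congr rfl fun p _ => ?_
        rw [← integral_add_left_eq_self _ (pt p), ← integral_indicator measurableSet_cell]
        exact integral_congr_ae (.of_forall (h2 p))
    _ = ∫ w in cell, ∑ p ∈ A, f (pt p + w) := by
        rw [integral_finsetSum]
        intro p _
        exact (hf.comp_add_left (pt p)).integrableOn

/-- Replacing w' by another vector of norm at most 2 changes the norm by at most 4, so the cells lie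
in an annulus of half-width W + 4, whose area is linear in R. -/
lemma card_annulus_le {R W : ℝ} (hW : 0 ≤ W) (hR : W + 4 ≤ R) {w' : ℂ} (hw' : ‖w'‖ ≤ 2)
    {A : Finset (ℤ × ℤ)} (hA : ∀ p ∈ A, |‖pt p + w'‖ - R| ≤ W) :
    (A.card : ℝ) ≤ 4 * Real.pi * (W + 5) * R := by
  have hsub : Metric.ball (0 : ℂ) (R - W - 4) ⊆ Metric.closedBall 0 (R + W + 4) :=
    Metric.ball_subset_closedBall.trans (Metric.closedBall_subset_closedBall (by linarith))
  have hE : volume (Metric.closedBall (0 : ℂ) (R + W + 4) \ Metric.ball 0 (R - W - 4)) ≠ ⊤ :=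
    ne_top_of_le_ne_top (measure_closedBall_lt_top (x := (0 : ℂ)) (r := R + W + 4)).ne
      (measure_mono Set.sdiff_subset)
  refine (card_le_volume hE ?_).trans ?_
  · intro p hp w hw
    have h1 := abs_le.1 (hA p hp)
    have h2 := norm_le_of_mem_cell hw
    have h3 : |‖pt p + w‖ - ‖pt p + w'‖| ≤ 4 := by
      refine (abs_norm_sub_norm_le _ _).trans ?_
      rw [add_sub_add_left_eq_sub]
      exact (norm_sub_le _ _).trans (by linarith)
    have h3 := abs_le.1 h3
    constructor
    · rw [mem_closedBall_zero_iff]; linarith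
    · rw [mem_ball_zero_iff, not_lt]; linarith
  · rw [measureReal_sdiff hsub Metric.isOpen_ball.measurableSet measure_closedBall_lt_top.ne,
      measureReal_def, measureReal_def, Complex.volume_closedBall, Complex.volume_ball]
    simp only [ENNReal.toReal_mul, ENNReal.toReal_pow, ENNReal.coe_toReal, NNReal.coe_real_pi]
    rw [ENNReal.toReal_ofReal (by linarith), ENNReal.toReal_ofReal (by linarith)]
    have := Real.pi_pos
    have h : 0 ≤ R := by linarith
    have e : (R + W + 4) ^ 2 * Real.pi - (R - W - 4) ^ 2 * Real.pi = 4 * Real.pi * (W + 4) * R := by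
      ring
    rw [e]
    have : 0 ≤ Real.pi * R := by positivity
    nlinarith

/-- An angular window 1/√R is narrow enough for the arc to deviate from its tangent by at most 1.
The block then fits in a rectangle of sides 2(W + 5) and 4√R + 8, and 4√R + 8 ≤ 12√R. -/
lemma card_block_le {R W : ℝ} (hW : 0 ≤ W) (hR : W ≤ R) (hR1 : 1 ≤ R) {u₀ : ℂ} (hu₀ : ‖u₀‖ = 1)
    {w' : ℂ} (hw' : ‖w'‖ ≤ 2) {A : Finset (ℤ × ℤ)}
    (hA : ∀ p ∈ A, pt p + w' ≠ 0 ∧ |‖pt p + w'‖ - R| ≤ W ∧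
      ‖(pt p + w') / (‖pt p + w'‖ : ℂ) - u₀‖ ≤ 1 / √R) :
    (A.card : ℝ) ≤ 24 * (W + 5) * √R := by
  have hu₀' : ‖conj u₀‖ = 1 := by simpa using hu₀
  have hs : 1 ≤ √R := Real.one_le_sqrt.2 hR1
  have hss : √R * √R = R := Real.mul_self_sqrt (by linarith)
  have hv := volume_preimage_mul_left hu₀'
    (Set.Icc (R - (W + 5)) (R + (W + 5)) ×ℂ Set.Icc (-(2 * √R + 4)) (2 * √R + 4))
  refine (card_le_volume (E := (fun z => conj u₀ * z) ⁻¹' (Set.Icc (R - (W + 5)) (R + (W + 5)) ×ℂ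
    Set.Icc (-(2 * √R + 4)) (2 * √R + 4))) (by rw [hv]; exact volume_rect_ne_top _ _ _ _) ?_).trans ?_
  · intro p hp w hw
    obtain ⟨hz, h1, h2⟩ := hA p hp
    set z := pt p + w' with hzdef
    set u := z / (‖z‖ : ℂ) with hu
    have hu1 : ‖u‖ = 1 := norm_dir hz
    have hzu : z = ‖z‖ * u := by
      have : (‖z‖ : ℂ) ≠ 0 := by simpa using hz
      rw [hu]; field_simp
    have e : pt p + w = z + (w - w') := by rw [hzdef]; ring
    have hy : ‖conj u₀ * (w - w')‖ ≤ 4 := by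
      rw [norm_mul, hu₀', one_mul]
      exact (norm_sub_le _ _).trans (by linarith [norm_le_of_mem_cell hw])
    have hyr := abs_le.1 ((Complex.abs_re_le_norm _).trans hy)
    have hyi := abs_le.1 ((Complex.abs_im_le_norm _).trans hy)
    have h1' := abs_le.1 h1
    have n1 : (u.re) ^ 2 + u.im ^ 2 = 1 := by
      have := Complex.sq_norm u; rw [hu1, Complex.normSq_apply] at this; linarith
    have n0 : (u₀.re) ^ 2 + u₀.im ^ 2 = 1 := by
      have := Complex.sq_norm u₀; rw [hu₀, Complex.normSq_apply] at this; linarith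
    have nd : ‖u - u₀‖ ^ 2 = (u.re - u₀.re) ^ 2 + (u.im - u₀.im) ^ 2 := by
      rw [Complex.sq_norm, Complex.normSq_apply]; simp; ring
    have hre : (conj u₀ * u).re = 1 - ‖u - u₀‖ ^ 2 / 2 := by
      rw [nd]; simp; nlinarith
    have him : |(conj u₀ * u).im| ≤ ‖u - u₀‖ := by
      have : (conj u₀ * u).im = (conj u₀ * (u - u₀)).im := by simp; ring
      rw [this]
      refine (Complex.abs_im_le_norm _).trans ?_
      rw [norm_mul, hu₀', one_mul]
    have hd2 : ‖u - u₀‖ ^ 2 ≤ 1 / R := by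
      have := pow_le_pow_left₀ (norm_nonneg _) h2 2
      rwa [div_pow, one_pow, sq √R, hss] at this
    have hzR : ‖z‖ ≤ 2 * R := by linarith
    -- This quantity is the sagitta of the arc.
    have b1 : ‖z‖ * (‖u - u₀‖ ^ 2 / 2) ≤ 1 := by
      have : ‖z‖ * (‖u - u₀‖ ^ 2 / 2) ≤ (2 * R) * ((1 / R) / 2) := by gcongr
      refine this.trans (le_of_eq ?_)
      field_simp
    have b0 : 0 ≤ ‖z‖ * (‖u - u₀‖ ^ 2 / 2) := by positivity
    have b2 : |‖z‖ * (conj u₀ * u).im| ≤ 2 * √R := by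
      rw [abs_mul, abs_norm]
      have : ‖z‖ * |(conj u₀ * u).im| ≤ (2 * R) * (1 / √R) := by
        gcongr
        exact him.trans h2
      refine this.trans (le_of_eq ?_)
      rw [mul_assoc, mul_one_div]
      nth_rewrite 1 [← hss]
      field_simp
    have b2' := abs_le.1 b2
    have ez : conj u₀ * z = ‖z‖ * (conj u₀ * u) := by
      nth_rewrite 1 [hzu]; ring
    have ere : (conj u₀ * z).re = ‖z‖ - ‖z‖ * (‖u - u₀‖ ^ 2 / 2) := by
      rw [ez, Complex.re_ofReal_mul, hre]; ring
    have eim : (conj u₀ * z).im = ‖z‖ * (conj u₀ * u).im := by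
      rw [ez, Complex.im_ofReal_mul]
    rw [Set.mem_preimage, e, mul_add, Complex.mem_reProdIm, Complex.add_re, Complex.add_im, ere, eim]
    exact ⟨⟨by linarith, by linarith⟩, by linarith, by linarith⟩
  · rw [measureReal_def, hv, ← measureReal_def, volume_rect _ _ _ _ (by linarith) (by linarith)]
    nlinarith

section

/-! ### Equidistribution of lattice points near a large circle -/

/-- The function on the plane obtained from a function of the signed distance to the circle of
radius `R` and of the outward unit normal. -/
def nearCircle (g : ℝ × ℂ → ℝ) (R : ℝ) (z : ℂ) : ℝ := g (‖z‖ - R, z / (‖z‖ : ℂ))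

/-- The hat function localising to a neighbourhood. -/
def hat (x : ℝ) : ℝ := max 0 (1 - x)

lemma continuous_hat : Continuous hat := by unfold hat; fun_prop

lemma hat_nonneg (x : ℝ) : 0 ≤ hat x := le_max_left _ _

lemma hat_le_one {x : ℝ} (hx : 0 ≤ x) : hat x ≤ 1 := max_le zero_le_one (by linarith)

lemma lt_one_of_hat_ne_zero {x : ℝ} (hx : hat x ≠ 0) : x < 1 := by
  by_contra h
  exact hx (max_eq_left (by linarith))

lemma abs_hat_sub_hat_le (x y : ℝ) : |hat x - hat y| ≤ |x - y| := by
  unfold hat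
  have := abs_max_sub_max_le_max 0 (1 - x) 0 (1 - y)
  refine this.trans (max_le (by simp) (le_of_eq ?_))
  rw [abs_sub_comm]; congr 1; ring

/-! ### Generic directions and sums localised to an arc of length √R. -/

variable {g : ℝ × ℂ → ℝ} {W : ℝ}

lemma exists_bound_of_support (hg : ContinuousOn g (Set.univ ×ˢ Metric.sphere 0 1))
    (hW : ∀ s u, W < |s| → g (s, u) = 0) :
    ∃ G, 0 ≤ G ∧ ∀ s u, ‖u‖ = 1 → |g (s, u)| ≤ G := by
  have hK : IsCompact (Set.Icc (-W) W ×ˢ Metric.sphere (0 : ℂ) 1) :=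
    isCompact_Icc.prod (isCompact_sphere 0 1)
  obtain ⟨G, hG⟩ := hK.exists_bound_of_continuousOn
    (hg.mono (Set.prod_mono (Set.subset_univ _) le_rfl))
  refine ⟨max G 0, le_max_right _ _, fun s u hu => ?_⟩
  by_cases hs : W < |s|
  · rw [hW s u hs]; simp
  · refine le_trans ?_ (le_max_left _ _)
    exact hG (s, u) ⟨abs_le.1 (not_lt.1 hs), by simpa using hu⟩

lemma exists_uniform_of_support (hg : ContinuousOn g (Set.univ ×ˢ Metric.sphere 0 1))
    (hW : ∀ s u, W < |s| → g (s, u) = 0) {η : ℝ} (hη : 0 < η) :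
    ∃ δ, 0 < δ ∧ ∀ s s' u u', ‖u‖ = 1 → ‖u'‖ = 1 → |s - s'| < δ → ‖u - u'‖ < δ →
      |g (s, u) - g (s', u')| ≤ η := by
  have hK : IsCompact (Set.Icc (-(W + 1)) (W + 1) ×ˢ Metric.sphere (0 : ℂ) 1) :=
    isCompact_Icc.prod (isCompact_sphere 0 1)
  have huc := hK.uniformContinuousOn_of_continuous
    (hg.mono (Set.prod_mono (Set.subset_univ _) le_rfl))
  obtain ⟨δ, hδ, h⟩ := Metric.uniformContinuousOn_iff.1 huc η hη
  -- The bound 1 ensures that if one of s, s' leaves [-(W + 1), W + 1], the other is still beyond W,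
  -- so both values vanish.
  refine ⟨min δ 1, by positivity, fun s s' u u' hu hu' h1 h2 => ?_⟩
  have h1a := h1.trans_le (min_le_left _ _)
  have h1b := h1.trans_le (min_le_right _ _)
  have h2a := h2.trans_le (min_le_left _ _)
  have t1 : |s| ≤ |s'| + |s - s'| := by
    have := abs_add_le s' (s - s'); rwa [add_sub_cancel] at this
  have t2 : |s'| ≤ |s| + |s - s'| := by
    have := abs_add_le s (s' - s); rwa [add_sub_cancel, abs_sub_comm s' s] at this
  by_cases ha : W + 1 < |s|
  · rw [hW s u (by linarith), hW s' u' (by linarith)]; simpa using hη.le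
  by_cases hb : W + 1 < |s'|
  · rw [hW s u (by linarith), hW s' u' (by linarith)]; simpa using hη.le
  refine (h (s, u) ⟨abs_le.1 (not_lt.1 ha), by simpa using hu⟩ (s', u')
    ⟨abs_le.1 (not_lt.1 hb), by simpa using hu'⟩ ?_).le
  rw [Prod.dist_eq, max_lt_iff, Real.dist_eq, dist_eq_norm]
  exact ⟨h1a, h2a⟩

/-- A unit vector is generic if it is not orthogonal to a nonzero lattice vector. -/
def Generic (u : ℂ) : Prop := ∀ p : ℤ × ℤ, p ≠ 0 → (conj u * pt p).re ≠ 0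

lemma conj_mul_pt_re (u : ℂ) (p : ℤ × ℤ) : (conj u * pt p).re = u.re * p.1 + u.im * p.2 := by
  simp

/-- The coordinates of a generic u have irrational ratio, so the subgroup of ℝ that they generate is
dense. -/
lemma Generic.exists_near {u : ℂ} (hu : Generic u) (x : ℝ) {ε : ℝ} (hε : 0 < ε) :
    ∃ p : ℤ × ℤ, |(conj u * pt p).re - x| < ε := by
  have hb : u.im ≠ 0 := by
    have := hu (0, 1) (by simp)
    rw [conj_mul_pt_re] at this
    simpa using this
  have hirr : Irrational (u.re / u.im) := by
    rintro ⟨q, hq⟩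
    refine hu ((q.den : ℤ), -q.num) (fun h => ?_) ?_
    · have := congrArg Prod.fst h
      simp at this
    · rw [conj_mul_pt_re]
      have hd : (q.den : ℝ) ≠ 0 := by exact_mod_cast q.den_ne_zero
      rw [eq_div_iff hb, Rat.cast_def, div_mul_eq_mul_div, div_eq_iff hd] at hq
      push_cast
      linarith
  have hd := dense_addSubgroupClosure_pair_iff.2 hirr
  obtain ⟨y, hy, hyx⟩ := hd.exists_dist_lt x hε
  obtain ⟨m, n, hmn⟩ := AddSubgroup.mem_closure_pair.1 hy
  refine ⟨(m, n), ?_⟩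
  rw [conj_mul_pt_re]
  rw [Real.dist_eq, abs_sub_comm] at hyx
  have : u.re * (m : ℝ) + u.im * (n : ℝ) = y := by
    rw [← hmn]; simp; ring
  simpa [this] using hyx

lemma countable_setOf_re_eq_zero {h : ℂ} (hh : h ≠ 0) :
    {φ : ℝ | (conj (Complex.exp (φ * Complex.I)) * h).re = 0}.Countable := by
  refine (Set.countable_range fun n : ℤ => (2 * n + 1) * Real.pi / 2 + h.arg).mono ?_
  intro φ hφ
  have h1 : (conj (Complex.exp (φ * Complex.I)) * h).re = ‖h‖ * Real.cos (φ - h.arg) := by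
    rw [Real.cos_sub]
    simp only [Complex.mul_re, Complex.conj_re, Complex.conj_im, Complex.exp_ofReal_mul_I_re,
      Complex.exp_ofReal_mul_I_im]
    linear_combination -Real.cos φ * Complex.norm_mul_cos_arg h -
      Real.sin φ * Complex.norm_mul_sin_arg h
  rw [Set.mem_ofPred_eq, h1, mul_eq_zero, norm_eq_zero, Real.cos_eq_zero_iff] at hφ
  obtain ⟨k, hk⟩ := hφ.resolve_left hh
  exact ⟨k, by simp only; linarith⟩

lemma ae_generic : ∀ᵐ φ : ℝ, Generic (Complex.exp (φ * Complex.I)) := by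
  unfold Generic
  rw [ae_all_iff]
  intro p
  by_cases hp : p = 0
  · exact .of_forall fun _ h => absurd hp h
  · have hpt : pt p ≠ 0 := fun h => hp (pt_injective (h.trans pt_zero.symm))
    filter_upwards [(countable_setOf_re_eq_zero hpt).ae_notMem volume] with φ hφ _
    exact hφ

/-- The function `nearCircle g R` cut off to a neighbourhood of the direction `u₀`. -/
def localized (g : ℝ × ℂ → ℝ) (R : ℝ) (u₀ z : ℂ) : ℝ :=
  nearCircle g R z * hat (√R * ‖z / (‖z‖ : ℂ) - u₀‖)

lemma nearCircle_support (hW : ∀ s u, W < |s| → g (s, u) = 0) {R : ℝ} (hR : W < R) {z : ℂ}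
    (hz : nearCircle g R z ≠ 0) : z ≠ 0 ∧ |‖z‖ - R| ≤ W := by
  have h1 : |‖z‖ - R| ≤ W := by
    by_contra h
    exact hz (hW _ _ (not_le.1 h))
  refine ⟨?_, h1⟩
  rintro rfl
  rw [norm_zero, zero_sub, abs_neg] at h1
  linarith [le_abs_self R]

lemma localized_support (hW : ∀ s u, W < |s| → g (s, u) = 0) {R : ℝ} (hR : W < R) (hR0 : 0 < R)
    {u₀ z : ℂ} (hz : localized g R u₀ z ≠ 0) :
    z ≠ 0 ∧ |‖z‖ - R| ≤ W ∧ ‖z / (‖z‖ : ℂ) - u₀‖ ≤ 1 / √R := by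
  obtain ⟨h1, h2⟩ := nearCircle_support hW hR (left_ne_zero_of_mul hz)
  refine ⟨h1, h2, ?_⟩
  have := lt_one_of_hat_ne_zero (right_ne_zero_of_mul hz)
  rw [le_div_iff₀ (Real.sqrt_pos.2 hR0), mul_comm]
  exact this.le

lemma mem_ballPts_of_near {R : ℝ} {w : ℂ} (hw : ‖w‖ ≤ 2) {p : ℤ × ℤ}
    (h : |‖pt p + w‖ - R| ≤ W) : p ∈ ballPts (R + W + 2) := by
  rw [mem_ballPts]
  have h1 := abs_le.1 h
  have : ‖pt p‖ ≤ ‖pt p + w‖ + ‖w‖ := by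
    have := norm_sub_le (pt p + w) w; rwa [add_sub_cancel_right] at this
  linarith

/-- A bounded displacement y nearly orthogonal to u₀ moves the norm by less than δ and the direction
by O(1/R). The kernel varies on the scale 1/√R, which is much larger than 1/R, so both factors are
nearly constant. -/
lemma abs_localized_sub_le {η δ G R M : ℝ}
    (hG : ∀ s u, ‖u‖ = 1 → |g (s, u)| ≤ G)
    (hδ : ∀ s s' u u', ‖u‖ = 1 → ‖u'‖ = 1 → |s - s'| < δ → ‖u - u'‖ < δ →
      |g (s, u) - g (s', u')| ≤ η)
    (hR0 : 0 < R) {u₀ z y : ℂ} (hz : z ≠ 0) (hzR : R / 2 ≤ ‖z‖)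
    (hzu : ‖z / (‖z‖ : ℂ) - u₀‖ ≤ 1 / √R) (hy : |(conj u₀ * y).re| < δ / 2) (hyM : ‖y‖ ≤ M)
    (hM1 : 4 * M < R) (hM2 : M * (1 / √R) + 2 * M ^ 2 / R < δ / 2) (hM3 : 4 * M / R < δ)
    (hM4 : √R * (4 * M / R) < η) :
    |localized g R u₀ (z + y) - localized g R u₀ z| ≤ (1 + G) * η := by
  have hzy : z + y ≠ 0 := by
    intro h
    have : ‖z‖ = ‖y‖ := by rw [eq_neg_of_add_eq_zero_left h, norm_neg]
    linarith
  have hnz : 0 < ‖z‖ := norm_pos_iff.2 hz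
  have hM0 : 0 ≤ M := (norm_nonneg _).trans hyM
  set u := z / (‖z‖ : ℂ) with hu
  have hu1 : ‖u‖ = 1 := norm_dir hz
  have hu2 : ‖(z + y) / (‖z + y‖ : ℂ)‖ = 1 := norm_dir hzy
  have d1 : |(‖z + y‖ - R) - (‖z‖ - R)| < δ := by
    have h1 := abs_norm_add_sub_le hz (y := y) (by linarith)
    have h2 : ‖y‖ ^ 2 / ‖z‖ ≤ 2 * M ^ 2 / R := by
      rw [div_le_div_iff₀ hnz hR0]
      have : ‖y‖ ^ 2 ≤ M ^ 2 := pow_le_pow_left₀ (norm_nonneg _) hyM 2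
      nlinarith [sq_nonneg M]
    have h3 : |(conj u * y).re| ≤ |(conj u₀ * y).re| + M * (1 / √R) := by
      have : (conj u * y).re = (conj u₀ * y).re + (conj (u - u₀) * y).re := by
        simp only [map_sub, sub_mul, Complex.sub_re]; ring
      rw [this]
      refine (abs_add_le _ _).trans (add_le_add le_rfl ((Complex.abs_re_le_norm _).trans ?_))
      rw [norm_mul, RCLike.norm_conj, mul_comm]
      gcongr
    have h1' := abs_le.1 h1
    have h3' := abs_le.1 h3
    rw [abs_lt]
    constructor <;> linarith [abs_le.1 h3]
  have d2 : ‖(z + y) / (‖z + y‖ : ℂ) - u‖ ≤ 4 * M / R := by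
    refine (norm_dir_sub_dir_le hz hzy).trans ?_
    rw [add_sub_cancel_left, div_le_div_iff₀ hnz hR0]
    nlinarith
  have e1 : |nearCircle g R (z + y) - nearCircle g R z| ≤ η :=
    hδ _ _ _ _ hu2 hu1 d1 (d2.trans_lt hM3)
  have e2 : |hat (√R * ‖(z + y) / (‖z + y‖ : ℂ) - u₀‖) - hat (√R * ‖u - u₀‖)| ≤ η := by
    refine (abs_hat_sub_hat_le _ _).trans ?_
    rw [← mul_sub, abs_mul, abs_of_nonneg (Real.sqrt_nonneg R)]
    refine le_trans ?_ hM4.le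
    gcongr
    refine (abs_norm_sub_norm_le _ _).trans ?_
    rwa [sub_sub_sub_cancel_right]
  have e3 : |nearCircle g R z| ≤ G := hG _ _ hu1
  have e4 : |hat (√R * ‖(z + y) / (‖z + y‖ : ℂ) - u₀‖)| ≤ 1 := by
    rw [abs_of_nonneg (hat_nonneg _)]; exact hat_le_one (by positivity)
  unfold localized
  rw [← hu]
  have : nearCircle g R (z + y) * hat (√R * ‖(z + y) / (‖z + y‖ : ℂ) - u₀‖) -
      nearCircle g R z * hat (√R * ‖u - u₀‖) =
      (nearCircle g R (z + y) - nearCircle g R z) * hat (√R * ‖(z + y) / (‖z + y‖ : ℂ) - u₀‖) +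
      nearCircle g R z * (hat (√R * ‖(z + y) / (‖z + y‖ : ℂ) - u₀‖) - hat (√R * ‖u - u₀‖)) := by
    ring
  rw [this]
  refine (abs_add_le _ _).trans ?_
  rw [abs_mul, abs_mul, add_mul, one_mul]
  refine add_le_add ?_ ?_
  · exact (mul_le_of_le_one_right (abs_nonneg _) e4).trans e1
  · exact mul_le_mul e3 e2 (abs_nonneg _) ((abs_nonneg _).trans e3)

/-- The shift w is replaced by a lattice vector h with almost the same projection to u₀. The
translation by h preserves the lattice sum exactly, and the remaining O(√R) differences are
uniformly small. -/
lemma tendsto_localized_shift (hg : ContinuousOn g (Set.univ ×ˢ Metric.sphere 0 1))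
    (hW0 : 0 < W) (hW : ∀ s u, W < |s| → g (s, u) = 0) {u₀ : ℂ} (hu₀ : ‖u₀‖ = 1)
    (hgen : Generic u₀) {w : ℂ} (hw : ‖w‖ ≤ 2) :
    Tendsto (fun R : ℝ => (1 / √R) *
      ∑' p, (localized g R u₀ (pt p) - localized g R u₀ (pt p + w))) atTop (𝓝 0) := by
  obtain ⟨G, hG0, hG⟩ := exists_bound_of_support hg hW
  rw [Metric.tendsto_atTop']
  intro ε hε
  set B := 24 * (W + 5) with hB
  have hBpos : 0 < B := by positivity
  -- At most 2B√R terms, each at most (1 + G)η, are divided by √R.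
  obtain ⟨η, hη, hηε⟩ : ∃ η > 0, 2 * B * (1 + G) * η < ε := by
    refine ⟨ε / (2 * B * (1 + G) + 1), by positivity, ?_⟩
    rw [mul_div_assoc', div_lt_iff₀ (by positivity)]
    nlinarith [show 0 < 2 * B * (1 + G) by positivity]
  obtain ⟨δ, hδ0, hδ⟩ := exists_uniform_of_support hg hW hη
  obtain ⟨h, hh⟩ := hgen.exists_near ((conj u₀ * w).re) (half_pos hδ0)
  set y := pt h - w with hy
  set M := ‖y‖ with hM
  have hyre : |(conj u₀ * y).re| < δ / 2 := by
    rw [hy, mul_sub, Complex.sub_re]; exact hh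
  have hinv : Tendsto (fun R : ℝ => R⁻¹) atTop (𝓝 0) := tendsto_inv_atTop_zero
  have hsinv : Tendsto (fun R : ℝ => (√R)⁻¹) atTop (𝓝 0) :=
    tendsto_inv_atTop_zero.comp Real.tendsto_sqrt_atTop
  have c2 : ∀ᶠ R : ℝ in atTop, M * (1 / √R) + 2 * M ^ 2 / R < δ / 2 := by
    have : Tendsto (fun R : ℝ => M * (√R)⁻¹ + 2 * M ^ 2 * R⁻¹) atTop (𝓝 (M * 0 + 2 * M ^ 2 * 0)) :=
      (hsinv.const_mul _).add (hinv.const_mul _)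
    rw [mul_zero, mul_zero, add_zero] at this
    filter_upwards [this.eventually_lt_const (half_pos hδ0)] with R hR
    simpa [div_eq_mul_inv] using hR
  have c3 : ∀ᶠ R : ℝ in atTop, 4 * M / R < δ := by
    have := hinv.const_mul (4 * M)
    rw [mul_zero] at this
    filter_upwards [this.eventually_lt_const hδ0] with R hR
    simpa [div_eq_mul_inv] using hR
  have c4 : ∀ᶠ R : ℝ in atTop, √R * (4 * M / R) < η := by
    have := hsinv.const_mul (4 * M)
    rw [mul_zero] at this
    filter_upwards [this.eventually_lt_const hη, eventually_gt_atTop 0] with R hR hR0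
    have e : √R * (4 * M / R) = 4 * M * (√R)⁻¹ := by
      have := Real.sqrt_pos.2 hR0
      rw [mul_div_assoc', div_eq_iff hR0.ne']
      nth_rewrite 3 [← Real.mul_self_sqrt hR0.le]
      field_simp
    rwa [e]
  have hev : ∀ᶠ R : ℝ in atTop, dist ((1 / √R) *
      ∑' p, (localized g R u₀ (pt p) - localized g R u₀ (pt p + w))) 0 < ε := by
    filter_upwards [c2, c3, c4, eventually_gt_atTop (4 * M), eventually_ge_atTop (2 * W),
      eventually_ge_atTop 1] with R h2 h3 h4 h1 hRW hR1
    have hR0 : 0 < R := by linarith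
    have hs0 : 0 < √R := Real.sqrt_pos.2 hR0
    have hWR : W < R := by linarith
    set Φ := localized g R u₀ with hΦ
    have hsup : ∀ {w' : ℂ} (_ : ‖w'‖ ≤ 2) (p), Φ (pt p + w') ≠ 0 → p ∈ ballPts (R + W + 2) :=
      fun hw' p hp => mem_ballPts_of_near hw' (localized_support hW hWR hR0 hp).2.1
    have hsup0 : ∀ p, Φ (pt p) ≠ 0 → p ∈ ballPts (R + W + 2) := fun p hp =>
      hsup (w' := 0) (by simp) p (by simpa using hp)
    set A1 := (ballPts (R + W + 2)).filter (fun p => Φ (pt p + w) ≠ 0) with hA1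
    set A0 := (ballPts (R + W + 2)).filter (fun p => Φ (pt p) ≠ 0) with hA0
    set A2 := A0.map (Equiv.subRight h).toEmbedding with hA2
    have k1 : (A1.card : ℝ) ≤ B * √R := card_block_le hW0.le hWR.le hR1 hu₀ hw
      fun p hp => localized_support hW hWR hR0 (Finset.mem_filter.1 hp).2
    have k0 : (A0.card : ℝ) ≤ B * √R := card_block_le (w' := 0) hW0.le hWR.le hR1 hu₀ (by simp)
      fun p hp => by simpa using localized_support hW hWR hR0 (Finset.mem_filter.1 hp).2
    have k2 : (A2.card : ℝ) ≤ B * √R := by rw [hA2, Finset.card_map]; exact k0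
    have m1 : ∀ p, Φ (pt p + w) ≠ 0 → p ∈ A1 := fun p hp => Finset.mem_filter.2 ⟨hsup hw p hp, hp⟩
    have m0 : ∀ p, Φ (pt p) ≠ 0 → p ∈ A0 := fun p hp => Finset.mem_filter.2 ⟨hsup0 p hp, hp⟩
    have m2 : ∀ p, Φ (pt p + pt h) ≠ 0 → p ∈ A2 := fun p hp => by
      rw [hA2, Finset.mem_map]
      exact ⟨p + h, m0 _ (by rwa [pt_add]), by simp⟩
    -- Reindexing by the lattice translation h.
    have hsum : ∑' p, (Φ (pt p) - Φ (pt p + w)) = ∑' p, (Φ (pt p + pt h) - Φ (pt p + w)) := by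
      rw [(summable_of_finset m0).tsum_sub (summable_of_finset m1),
        (summable_of_finset m2).tsum_sub (summable_of_finset m1)]
      congr 1
      rw [← (Equiv.addRight h).tsum_eq]
      simp [pt_add]
    -- The comparison needs a base point in the support; either of the two points may serve, with
    -- displacement y or -y.
    have hterm : ∀ p ∈ A1 ∪ A2, |Φ (pt p + pt h) - Φ (pt p + w)| ≤ (1 + G) * η := by
      intro p _
      by_cases hp1 : Φ (pt p + w) ≠ 0
      · obtain ⟨s1, s2, s3⟩ := localized_support hW hWR hR0 hp1
        have := abs_localized_sub_le hG hδ hR0 s1 (by linarith [(abs_le.1 s2).1]) s3 hyre le_rfl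
          h1 h2 h3 h4
        rwa [show pt p + w + y = pt p + pt h by rw [hy]; ring] at this
      by_cases hp2 : Φ (pt p + pt h) ≠ 0
      · obtain ⟨s1, s2, s3⟩ := localized_support hW hWR hR0 hp2
        have := abs_localized_sub_le hG hδ hR0 s1 (by linarith [(abs_le.1 s2).1]) s3 (y := -y)
          (by rwa [mul_neg, Complex.neg_re, abs_neg]) (norm_neg y).le h1 h2 h3 h4
        rwa [show pt p + pt h + -y = pt p + w by rw [hy]; ring, abs_sub_comm] at this
      · push Not at hp1 hp2
        rw [hp1, hp2, sub_zero, abs_zero]; positivity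
    have hbd := abs_tsum_le_card_mul (f := fun p => Φ (pt p + pt h) - Φ (pt p + w))
      (A := A1 ∪ A2) (fun p hp => by
        rw [Finset.mem_union]
        by_contra hcon
        push Not at hcon
        have a1 : Φ (pt p + w) = 0 := by by_contra h'; exact hcon.1 (m1 p h')
        have a2 : Φ (pt p + pt h) = 0 := by by_contra h'; exact hcon.2 (m2 p h')
        exact hp (by rw [a1, a2, sub_zero])) hterm
    have hcard : ((A1 ∪ A2).card : ℝ) ≤ 2 * B * √R := by
      have : ((A1 ∪ A2).card : ℝ) ≤ A1.card + A2.card := by exact_mod_cast Finset.card_union_le _ _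
      linarith
    rw [hsum, dist_zero_right, Real.norm_eq_abs, abs_mul, abs_of_pos (by positivity : 0 < 1 / √R)]
    calc 1 / √R * |∑' p, (Φ (pt p + pt h) - Φ (pt p + w))|
        ≤ 1 / √R * ((2 * B * √R) * ((1 + G) * η)) := by
          gcongr
          exact hbd.trans (by gcongr)
      _ = 2 * B * (1 + G) * η := by field_simp
      _ < ε := hηε
  obtain ⟨N, hN⟩ := (eventually_atTop.1 hev)
  exact ⟨N, fun R hR => hN R hR.le⟩

end

/-! ### From arcs to the whole circle: averaging over directions and over the unit cell. -/

section

variable {g : ℝ × ℂ → ℝ} {W : ℝ}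

/-- The mass of the localising kernel. -/
def hatMass (R : ℝ) : ℝ :=
  ∫ φ in (-Real.pi)..Real.pi, hat (√R * ‖1 - Complex.exp (φ * Complex.I)‖)

lemma integral_hat_eq_hatMass (R : ℝ) {u : ℂ} (hu : ‖u‖ = 1) :
    ∫ φ in (-Real.pi)..Real.pi, hat (√R * ‖u - Complex.exp (φ * Complex.I)‖) = hatMass R := by
  set f : ℝ → ℝ := fun φ => hat (√R * ‖1 - Complex.exp (φ * Complex.I)‖) with hf
  have hper : Function.Periodic f (2 * Real.pi) := by
    intro φ
    simp only [hf]
    congr 4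
    push_cast
    rw [add_mul, Complex.exp_add, Complex.exp_two_pi_mul_I, mul_one]
  have hshift : ∀ φ : ℝ, hat (√R * ‖u - Complex.exp (φ * Complex.I)‖) = f (φ - u.arg) := by
    intro φ
    have hu' : u = Complex.exp (u.arg * Complex.I) := by
      have := Complex.norm_mul_exp_arg_mul_I u
      rw [hu, Complex.ofReal_one, one_mul] at this
      exact this.symm
    have e : u - Complex.exp (φ * Complex.I) =
        u * (1 - Complex.exp (((φ - u.arg : ℝ) : ℂ) * Complex.I)) := by
      rw [mul_sub, mul_one]
      congr 1
      nth_rewrite 1 [hu']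
      rw [← Complex.exp_add]
      congr 1
      push_cast; ring
    simp only [hf]
    rw [e, norm_mul, hu, one_mul]
  rw [intervalIntegral.integral_congr (g := fun φ => f (φ - u.arg)) (fun φ _ => hshift φ),
    intervalIntegral.integral_comp_sub_right f]
  have := hper.intervalIntegral_add_eq (-Real.pi - u.arg) (-Real.pi)
  rw [show -Real.pi - u.arg + 2 * Real.pi = Real.pi - u.arg by ring,
    show -Real.pi + 2 * Real.pi = Real.pi by ring] at this
  exact this

lemma continuous_hat_dir (R : ℝ) (u : ℂ) :
    Continuous fun φ : ℝ => hat (√R * ‖u - Complex.exp (φ * Complex.I)‖) :=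
  continuous_hat.comp (by fun_prop)

lemma norm_one_sub_exp_le (φ : ℝ) : ‖1 - Complex.exp (φ * Complex.I)‖ ≤ |φ| := by
  rw [norm_sub_rev, mul_comm]
  exact Real.norm_exp_I_mul_ofReal_sub_one_le

/-- The kernel is at least 1/2 for |φ| ≤ 1/(2√R). Only a lower bound matters, because the mass is
divided out. -/
lemma hatMass_ge {R : ℝ} (hR : 1 ≤ R) : 1 / 2 ≤ √R * hatMass R := by
  have hs : 1 ≤ √R := Real.one_le_sqrt.2 hR
  have hs0 : 0 < √R := by linarith
  have hpi := Real.pi_gt_three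
  set a := 1 / (2 * √R) with ha
  have ha0 : 0 < a := by positivity
  have ha1 : a ≤ 1 := by rw [ha, div_le_one (by positivity)]; linarith
  have hsub : Set.Ioc (-a) a ⊆ Set.Ioc (-Real.pi) Real.pi :=
    Set.Ioc_subset_Ioc (by linarith) (by linarith)
  have hint : IntegrableOn (fun φ : ℝ => hat (√R * ‖1 - Complex.exp (φ * Complex.I)‖))
      (Set.Ioc (-Real.pi) Real.pi) :=
    ((continuous_hat_dir R 1).integrableOn_Icc).mono_set Set.Ioc_subset_Icc_self
  have h1 : ∫ φ in Set.Ioc (-a) a, (1 / 2 : ℝ) ≤ hatMass R := by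
    unfold hatMass
    rw [intervalIntegral.integral_of_le (by linarith)]
    refine le_trans ?_ (setIntegral_mono_set hint (.of_forall fun _ => hat_nonneg _)
      hsub.eventuallyLE)
    refine setIntegral_mono_on (by simp) (hint.mono_set hsub) measurableSet_Ioc fun φ hφ => ?_
    have hφ' : |φ| ≤ a := abs_le.2 ⟨hφ.1.le, hφ.2⟩
    have : √R * ‖1 - Complex.exp (φ * Complex.I)‖ ≤ √R * a := by
      gcongr; exact (norm_one_sub_exp_le φ).trans hφ'
    have e : √R * a = 1 / 2 := by rw [ha]; field_simp
    rw [e] at this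
    exact (by linarith : (1 / 2 : ℝ) ≤ 1 - _).trans (le_max_right _ _)
  rw [setIntegral_const, measureReal_def, Real.volume_Ioc, ENNReal.toReal_ofReal (by linarith),
    smul_eq_mul] at h1
  have e : √R * ((a - -a) * (1 / 2)) = 1 / 2 := by rw [ha]; field_simp; ring
  rw [← e]
  gcongr

lemma integral_localized (g : ℝ × ℂ → ℝ) (R : ℝ) {z : ℂ} (hz : z ≠ 0) :
    ∫ φ in (-Real.pi)..Real.pi, localized g R (Complex.exp (φ * Complex.I)) z =
      nearCircle g R z * hatMass R := by
  unfold localized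
  rw [intervalIntegral.integral_const_mul, integral_hat_eq_hatMass R (norm_dir hz)]

lemma mem_ballPts_of_nearCircle_ne_zero (hW : ∀ s u, W < |s| → g (s, u) = 0) {R : ℝ} (hR : W < R)
    {w : ℂ} (hw : ‖w‖ ≤ 2) {p : ℤ × ℤ} (hp : nearCircle g R (pt p + w) ≠ 0) :
    p ∈ ballPts (R + W + 2) :=
  mem_ballPts_of_near hw (nearCircle_support hW hR hp).2

lemma summable_nearCircle (hW : ∀ s u, W < |s| → g (s, u) = 0) {R : ℝ} (hR : W < R)
    {w : ℂ} (hw : ‖w‖ ≤ 2) : Summable fun p => nearCircle g R (pt p + w) :=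
  summable_of_finset fun _ hp => mem_ballPts_of_nearCircle_ne_zero hW hR hw hp

lemma abs_tsum_nearCircle_le (hW0 : 0 < W) (hW : ∀ s u, W < |s| → g (s, u) = 0) {G : ℝ}
    (hG0 : 0 ≤ G) (hG : ∀ s u, ‖u‖ = 1 → |g (s, u)| ≤ G) {R : ℝ} (hR : W + 4 ≤ R)
    {w : ℂ} (hw : ‖w‖ ≤ 2) :
    |∑' p, nearCircle g R (pt p + w)| ≤ (4 * Real.pi * (W + 5) * R) * G := by
  have hWR : W < R := by linarith
  refine (abs_tsum_le_card_mul (A := (ballPts (R + W + 2)).filter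
    (fun p => nearCircle g R (pt p + w) ≠ 0)) (η := G) ?_ ?_).trans ?_
  · exact fun p hp => Finset.mem_filter.2 ⟨mem_ballPts_of_nearCircle_ne_zero hW hWR hw hp, hp⟩
  · intro p hp
    exact hG _ _ (norm_dir (nearCircle_support hW hWR (Finset.mem_filter.1 hp).2).1)
  · gcongr
    exact card_annulus_le hW0.le hR hw
      fun p hp => (nearCircle_support hW hWR (Finset.mem_filter.1 hp).2).2

lemma tsum_nearCircle_shift_eq (hW : ∀ s u, W < |s| → g (s, u) = 0) {R : ℝ} (hR : W < R)
    {w : ℂ} (hw : ‖w‖ ≤ 2) :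
    ∑' p, (nearCircle g R (pt p) - nearCircle g R (pt p + w)) =
      ∑ p ∈ ballPts (R + W + 2), (nearCircle g R (pt p) - nearCircle g R (pt p + w)) := by
  refine tsum_eq_sum fun p hp => ?_
  have h1 : nearCircle g R (pt p) = 0 := by
    by_contra h
    exact hp (mem_ballPts_of_nearCircle_ne_zero hW hR (w := 0) (by simp) (by simpa using h))
  have h2 : nearCircle g R (pt p + w) = 0 := by
    by_contra h
    exact hp (mem_ballPts_of_nearCircle_ne_zero hW hR hw h)
  rw [h1, h2, sub_zero]

/-- Integrating the localised sums over all directions recovers the full sum times `hatMass`.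
Dominated convergence applies: almost every direction is generic, and `card_block_le` bounds each
normalised sum. -/
lemma tendsto_nearCircle_shift (hg : ContinuousOn g (Set.univ ×ˢ Metric.sphere 0 1))
    (hW0 : 0 < W) (hW : ∀ s u, W < |s| → g (s, u) = 0) {w : ℂ} (hw : ‖w‖ ≤ 2) :
    Tendsto (fun R : ℝ => (1 / R) *
      ∑' p, (nearCircle g R (pt p) - nearCircle g R (pt p + w))) atTop (𝓝 0) := by
  obtain ⟨G, hG0, hG⟩ := exists_bound_of_support hg hW
  set N : ℝ → ℝ → ℝ := fun R φ => (1 / √R) * ∑ p ∈ ballPts (R + W + 2),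
    (localized g R (Complex.exp (φ * Complex.I)) (pt p) -
      localized g R (Complex.exp (φ * Complex.I)) (pt p + w)) with hN
  have hfin : ∀ {R : ℝ} (_ : W < R) (u₀ : ℂ), ∑' p, (localized g R u₀ (pt p) -
      localized g R u₀ (pt p + w)) = ∑ p ∈ ballPts (R + W + 2), (localized g R u₀ (pt p) -
      localized g R u₀ (pt p + w)) := by
    intro R hR u₀
    refine tsum_eq_sum fun p hp => ?_
    have h1 : localized g R u₀ (pt p) = 0 := by
      by_contra h
      exact hp (mem_ballPts_of_near (w := 0) (by simp)
        (by simpa using (localized_support hW hR (hW0.trans hR) h).2.1))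
    have h2 : localized g R u₀ (pt p + w) = 0 := by
      by_contra h
      exact hp (mem_ballPts_of_near hw (localized_support hW hR (hW0.trans hR) h).2.1)
    rw [h1, h2, sub_zero]
  have hcont : ∀ R z, Continuous fun φ : ℝ => localized g R (Complex.exp (φ * Complex.I)) z :=
    fun R z => (continuous_hat_dir R _).const_mul _
  have hNcont : ∀ R, Continuous (N R) := fun R =>
    (continuous_finsetSum _ fun p _ => (hcont R _).sub (hcont R _)).const_mul _
  have hlim : Tendsto (fun R => ∫ φ in (-Real.pi)..Real.pi, N R φ) atTop
      (𝓝 (∫ φ in (-Real.pi)..Real.pi, (0 : ℝ))) := by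
    refine intervalIntegral.tendsto_integral_filter_of_dominated_convergence
      (fun _ => 2 * (24 * (W + 5)) * G) ?_ ?_ ?_ ?_
    · exact .of_forall fun R => (hNcont R).aestronglyMeasurable
    · filter_upwards [eventually_gt_atTop W, eventually_ge_atTop 1] with R hR hR1
      refine .of_forall fun φ _ => ?_
      have hR0 : 0 < R := hW0.trans hR
      have hs0 : 0 < √R := Real.sqrt_pos.2 hR0
      set u₀ := Complex.exp (φ * Complex.I) with hu₀
      have hle : ∀ z, |localized g R u₀ z| ≤ G := by
        intro z
        by_cases hz : localized g R u₀ z = 0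
        · rw [hz, abs_zero]; exact hG0
        · have h0 := (localized_support hW hR hR0 hz).1
          unfold localized
          rw [abs_mul, abs_of_nonneg (hat_nonneg _)]
          exact (mul_le_of_le_one_right (abs_nonneg _) (hat_le_one (by positivity))).trans
            (hG _ _ (norm_dir h0))
      have hb : ∀ w' : ℂ, ‖w'‖ ≤ 2 → |∑' p, localized g R u₀ (pt p + w')| ≤
          (24 * (W + 5) * √R) * G := by
        intro w' hw'
        refine (abs_tsum_le_card_mul (A := (ballPts (R + W + 2)).filter
          (fun p => localized g R u₀ (pt p + w') ≠ 0)) ?_ (fun p _ => hle _)).trans ?_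
        · intro p hp
          exact Finset.mem_filter.2
            ⟨mem_ballPts_of_near hw' (localized_support hW hR hR0 hp).2.1, hp⟩
        · gcongr
          exact card_block_le hW0.le hR.le hR1 (norm_exp_I φ) hw'
            fun p hp => localized_support hW hR hR0 (Finset.mem_filter.1 hp).2
      have hsm : ∀ w' : ℂ, ‖w'‖ ≤ 2 → Summable fun p => localized g R u₀ (pt p + w') :=
        fun w' hw' => summable_of_finset (A := ballPts (R + W + 2))
          fun p hp => mem_ballPts_of_near hw' (localized_support hW hR hR0 hp).2.1
      have b0 := hb 0 (by simp)
      have s0 := hsm 0 (by simp)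
      simp only [add_zero] at b0 s0
      simp only [hN]
      rw [← hfin hR, s0.tsum_sub (hsm w hw), Real.norm_eq_abs, abs_mul,
        abs_of_pos (by positivity : 0 < 1 / √R)]
      calc 1 / √R * _ ≤ 1 / √R * ((24 * (W + 5) * √R) * G + (24 * (W + 5) * √R) * G) := by
            gcongr
            exact (abs_sub _ _).trans (add_le_add b0 (hb w hw))
        _ = 2 * (24 * (W + 5)) * G := by field_simp; ring
    · exact intervalIntegrable_const
    · filter_upwards [ae_generic] with φ hφ _
      refine (tendsto_localized_shift hg hW0 hW (norm_exp_I φ) hφ hw).congr' ?_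
      filter_upwards [eventually_gt_atTop W] with R hR
      rw [hfin hR]
  rw [intervalIntegral.integral_zero] at hlim
  have hlim2 := (hlim.norm).const_mul 2
  rw [norm_zero, mul_zero] at hlim2
  refine squeeze_zero_norm' ?_ hlim2
  filter_upwards [eventually_gt_atTop W, eventually_ge_atTop 1] with R hR hR1
  have hR0 : 0 < R := hW0.trans hR
  have hs0 : 0 < √R := Real.sqrt_pos.2 hR0
  have hm := hatMass_ge hR1
  have hint : ∀ z, ∫ φ in (-Real.pi)..Real.pi, localized g R (Complex.exp (φ * Complex.I)) z =
      nearCircle g R z * hatMass R := by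
    intro z
    by_cases hz : z = 0
    · have h1 : nearCircle g R z = 0 := by
        by_contra h
        exact (nearCircle_support hW hR h).1 hz
      unfold localized
      rw [h1]; simp
    · exact integral_localized g R hz
  have hfin' := tsum_nearCircle_shift_eq hW hR hw
  have e : √R * ∫ φ in (-Real.pi)..Real.pi, N R φ =
      (∑' p, (nearCircle g R (pt p) - nearCircle g R (pt p + w))) * hatMass R := by
    simp only [hN]
    rw [intervalIntegral.integral_const_mul, intervalIntegral.integral_finsetSum, hfin',
      Finset.sum_mul, ← mul_assoc, mul_one_div_cancel hs0.ne', one_mul]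
    · refine Finset.sum_congr rfl fun p _ => ?_
      rw [intervalIntegral.integral_sub ((hcont R _).intervalIntegrable _ _)
        ((hcont R _).intervalIntegrable _ _), hint, hint, sub_mul]
    · intro p _
      exact ((hcont R _).sub (hcont R _)).intervalIntegrable _ _
  set S := ∑' p, (nearCircle g R (pt p) - nearCircle g R (pt p + w))
  set J := ∫ φ in (-Real.pi)..Real.pi, N R φ
  have h2 : R * |J| = |S| * (√R * hatMass R) := by
    have hm0 : 0 < hatMass R := by
      by_contra h
      have : √R * hatMass R ≤ 0 := mul_nonpos_of_nonneg_of_nonpos hs0.le (not_lt.1 h)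
      linarith
    have := congrArg (fun x => √R * |x|) e
    simp only [abs_mul, abs_of_pos hs0, abs_of_pos hm0] at this
    rw [← mul_assoc, Real.mul_self_sqrt hR0.le] at this
    rw [this]; ring
  rw [Real.norm_eq_abs, Real.norm_eq_abs, abs_mul, abs_of_pos (by positivity : 0 < 1 / R),
    one_div_mul_eq_div, div_le_iff₀ hR0]
  nlinarith [mul_le_mul_of_nonneg_left hm (abs_nonneg S)]

lemma continuous_nearCircle (hg : ContinuousOn g (Set.univ ×ˢ Metric.sphere 0 1))
    (hW : ∀ s u, W < |s| → g (s, u) = 0) {R : ℝ} (hR : W < R) : Continuous (nearCircle g R) := by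
  rw [continuous_iff_continuousAt]
  intro z
  by_cases hz : z = 0
  · have : nearCircle g R =ᶠ[𝓝 z] fun _ => 0 := by
      rw [hz]
      filter_upwards [Metric.ball_mem_nhds (0 : ℂ) (sub_pos.2 hR)] with y hy
      by_contra h
      have := (nearCircle_support hW hR h).2
      rw [mem_ball_zero_iff] at hy
      linarith [(abs_le.1 this).1]
    exact continuousAt_const.congr this.symm
  · have hmaps : ∀ᶠ y in 𝓝 z, ((‖y‖ - R, y / (‖y‖ : ℂ)) : ℝ × ℂ) ∈
        (Set.univ ×ˢ Metric.sphere (0 : ℂ) 1 : Set (ℝ × ℂ)) := by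
      filter_upwards [isOpen_ne.mem_nhds hz] with y hy
      exact ⟨Set.mem_univ _, by simpa using norm_dir hy⟩
    have hc : ContinuousAt (fun y : ℂ => ((‖y‖ - R, y / (‖y‖ : ℂ)) : ℝ × ℂ)) z := by
      have : (‖z‖ : ℂ) ≠ 0 := by simpa using hz
      fun_prop (disch := assumption)
    have h1 := hg _ hmaps.self_of_nhds
    exact h1.tendsto.comp (tendsto_nhdsWithin_iff.2 ⟨hc.tendsto, hmaps⟩)

/-- The set of pairs of a signed distance and an angle. -/
def angleStrip : Set (ℝ × ℝ) := Set.univ ×ˢ Set.Ioo (-Real.pi) Real.pi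

/-- In polar coordinates with radius R + s the Jacobian is R + s. The part s ≤ -R, absent from polar
coordinates, contributes nothing since g vanishes for |s| > W. -/
lemma integral_nearCircle (hW0 : 0 < W) (hW : ∀ s u, W < |s| → g (s, u) = 0) {R : ℝ} (hR : W < R) :
    ∫ z, nearCircle g R z =
      ∫ x in angleStrip, (R + x.1) * g (x.1, Complex.exp (x.2 * Complex.I)) := by
  rw [← Complex.integral_comp_polarCoord_symm]
  have hms : MeasurableSet polarCoord.target := polarCoord.open_target.measurableSet
  have hms' : MeasurableSet angleStrip := MeasurableSet.univ.prod measurableSet_Ioo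
  rw [← integral_indicator hms, ← integral_indicator hms',
    ← integral_add_right_eq_self _ ((R, 0) : ℝ × ℝ)]
  refine integral_congr_ae (.of_forall fun x => ?_)
  simp only
  by_cases hx : x ∈ angleStrip
  · rw [Set.indicator_of_mem hx]
    have hx2 : x.2 ∈ Set.Ioo (-Real.pi) Real.pi := hx.2
    by_cases h0 : 0 < x.1 + R
    · rw [Set.indicator_of_mem (by
        rw [polarCoord_target]
        exact ⟨by simpa using h0, by simpa using hx2⟩)]
      simp only [smul_eq_mul, Prod.fst_add, nearCircle]
      have e1 : Complex.polarCoord.symm (x + (R, 0)) =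
          ((x.1 + R : ℝ) : ℂ) * Complex.exp (x.2 * Complex.I) := by
        rw [Complex.polarCoord_symm_apply, Complex.exp_mul_I]
        simp
      have e2 : ‖Complex.polarCoord.symm (x + (R, 0))‖ = x.1 + R := by
        rw [e1, norm_mul, norm_exp_I, mul_one, Complex.norm_real, Real.norm_eq_abs, abs_of_pos h0]
      have h0' : ((x.1 + R : ℝ) : ℂ) ≠ 0 := by exact_mod_cast h0.ne'
      rw [e2, e1, mul_div_cancel_left₀ _ h0', add_sub_cancel_right, add_comm]
    · rw [Set.indicator_of_notMem, hW, mul_zero]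
      · rw [abs_of_neg (by linarith)]; linarith
      · rw [polarCoord_target]
        exact fun h => h0 (by simpa using h.1)
  · rw [Set.indicator_of_notMem hx, Set.indicator_of_notMem]
    intro h
    rw [polarCoord_target] at h
    exact hx ⟨Set.mem_univ _, by simpa using h.2⟩

lemma continuous_angle (hg : ContinuousOn g (Set.univ ×ˢ Metric.sphere 0 1)) :
    Continuous fun x : ℝ × ℝ => g (x.1, Complex.exp (x.2 * Complex.I)) := by
  rw [← continuousOn_univ]
  refine hg.comp (f := fun x : ℝ × ℝ => (x.1, Complex.exp (x.2 * Complex.I))) (by fun_prop) ?_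
  intro x _
  exact ⟨Set.mem_univ _, by simp⟩

lemma integrableOn_angleStrip {f : ℝ × ℝ → ℝ} (hf : Continuous f) (hW : ∀ x, W < |x.1| → f x = 0) :
    IntegrableOn f angleStrip := by
  have h1 : IntegrableOn f (Set.Icc (-W) W ×ˢ Set.Icc (-Real.pi) Real.pi) :=
    hf.continuousOn.integrableOn_compact (isCompact_Icc.prod isCompact_Icc)
  have h2 : IntegrableOn f (Set.Icc (-W) W ×ˢ Set.Ioo (-Real.pi) Real.pi) :=
    h1.mono_set (Set.prod_mono le_rfl Set.Ioo_subset_Icc_self)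
  refine h2.of_forall_sdiff_eq_zero (MeasurableSet.univ.prod measurableSet_Ioo) ?_
  rintro x ⟨hx1, hx2⟩
  refine hW x ?_
  by_contra h
  exact hx2 ⟨abs_le.1 (not_lt.1 h), hx1.2⟩

lemma tendsto_integral_nearCircle (hg : ContinuousOn g (Set.univ ×ˢ Metric.sphere 0 1))
    (hW0 : 0 < W) (hW : ∀ s u, W < |s| → g (s, u) = 0) :
    Tendsto (fun R : ℝ => (1 / R) * ∫ z, nearCircle g R z) atTop
      (𝓝 (∫ x in angleStrip, g (x.1, Complex.exp (x.2 * Complex.I)))) := by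
  have hc := continuous_angle hg
  have i1 := integrableOn_angleStrip hc (W := W) fun x hx => hW _ _ hx
  have i2 := integrableOn_angleStrip (f := fun x => x.1 * g (x.1, Complex.exp (x.2 * Complex.I)))
    (continuous_fst.mul hc) (W := W) fun x hx => by rw [hW _ _ hx, mul_zero]
  have hlim : Tendsto (fun R : ℝ => (∫ x in angleStrip, g (x.1, Complex.exp (x.2 * Complex.I))) +
      R⁻¹ * ∫ x in angleStrip, x.1 * g (x.1, Complex.exp (x.2 * Complex.I))) atTop
      (𝓝 ((∫ x in angleStrip, g (x.1, Complex.exp (x.2 * Complex.I))) + 0 *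
        ∫ x in angleStrip, x.1 * g (x.1, Complex.exp (x.2 * Complex.I)))) :=
    tendsto_const_nhds.add (tendsto_inv_atTop_zero.mul_const _)
  rw [zero_mul, add_zero] at hlim
  refine hlim.congr' ?_
  filter_upwards [eventually_gt_atTop W] with R hR
  have hR0 : 0 < R := hW0.trans hR
  rw [integral_nearCircle hW0 hW hR]
  simp only [add_mul]
  rw [integral_add (i1.const_mul R) i2, integral_const_mul, mul_add, ← mul_assoc,
    one_div_mul_cancel hR0.ne', one_mul, one_div]

/-- Equidistribution of the lattice points near the circle of radius `R`. -/
theorem tendsto_sum_nearCircle (hg : ContinuousOn g (Set.univ ×ˢ Metric.sphere 0 1))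
    (hW0 : 0 < W) (hW : ∀ s u, W < |s| → g (s, u) = 0) :
    Tendsto (fun R : ℝ => (1 / R) * ∑' p, nearCircle g R (pt p)) atTop
      (𝓝 (∫ x in angleStrip, g (x.1, Complex.exp (x.2 * Complex.I)))) := by
  obtain ⟨G, hG0, hG⟩ := exists_bound_of_support hg hW
  -- The average of the shifted sums over w in the cell is the integral over the plane, so the
  -- lattice sum is compared with an area.
  have hlim : Tendsto (fun R : ℝ => ∫ w in cell, (1 / R) * ∑ p ∈ ballPts (R + W + 2),
      (nearCircle g R (pt p) - nearCircle g R (pt p + w))) atTop (𝓝 (∫ w in cell, (0 : ℝ))) := by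
    refine tendsto_integral_filter_of_dominated_convergence
      (fun _ => 2 * (4 * Real.pi * (W + 5)) * G) ?_ ?_ ?_ ?_
    · filter_upwards [eventually_gt_atTop W] with R hR
      have hc := continuous_nearCircle hg hW hR
      exact Continuous.aestronglyMeasurable (by fun_prop)
    · filter_upwards [eventually_ge_atTop (W + 4)] with R hR
      rw [ae_restrict_iff' measurableSet_cell]
      refine .of_forall fun w hw => ?_
      have hw2 := norm_le_of_mem_cell hw
      have hR' : W < R := by linarith
      have hR0 : 0 < R := hW0.trans hR'
      have b0 := abs_tsum_nearCircle_le hW0 hW hG0 hG hR (w := 0) (by simp)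
      have b1 := abs_tsum_nearCircle_le hW0 hW hG0 hG hR hw2
      have s0 := summable_nearCircle hW hR' (w := 0) (by simp)
      simp only [add_zero] at b0 s0
      rw [← tsum_nearCircle_shift_eq hW hR' hw2, s0.tsum_sub (summable_nearCircle hW hR' hw2),
        Real.norm_eq_abs, abs_mul, abs_of_pos (by positivity : 0 < 1 / R)]
      calc 1 / R * _ ≤ 1 / R * ((4 * Real.pi * (W + 5) * R) * G +
            (4 * Real.pi * (W + 5) * R) * G) := by
            gcongr
            exact (abs_sub _ _).trans (add_le_add b0 b1)
        _ = 2 * (4 * Real.pi * (W + 5)) * G := by field_simp; ring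
    · rw [integrable_const_iff]
      right
      exact ⟨by rw [Measure.restrict_apply_univ, volume_cell]; exact ENNReal.one_lt_top⟩
    · rw [ae_restrict_iff' measurableSet_cell]
      refine .of_forall fun w hw => ?_
      refine (tendsto_nearCircle_shift hg hW0 hW (norm_le_of_mem_cell hw)).congr' ?_
      filter_upwards [eventually_gt_atTop W] with R hR
      rw [tsum_nearCircle_shift_eq hW hR (norm_le_of_mem_cell hw)]
  rw [integral_zero] at hlim
  have hsum := hlim.add (tendsto_integral_nearCircle hg hW0 hW)
  rw [zero_add] at hsum
  refine hsum.congr' ?_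
  filter_upwards [eventually_gt_atTop W] with R hR
  have hc := continuous_nearCircle hg hW hR
  have hcs : HasCompactSupport (nearCircle g R) := by
    refine HasCompactSupport.intro (isCompact_closedBall (0 : ℂ) (R + W)) fun z hz => ?_
    by_contra h
    have := (abs_le.1 (nearCircle_support hW hR h).2).2
    exact hz (mem_closedBall_zero_iff.2 (by linarith))
  rw [integral_eq_setIntegral_cell (hc.integrable_of_hasCompactSupport hcs)
    (A := ballPts (R + W + 2)) (fun p w hw hp =>
      mem_ballPts_of_nearCircle_ne_zero hW hR (norm_le_of_mem_cell hw) hp),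
    integral_const_mul, ← mul_add]
  congr 1
  simp only [Finset.sum_sub_distrib]
  have hi : ∀ f : ℂ → ℝ, Continuous f → IntegrableOn f cell := by
    intro f hf
    refine (hf.continuousOn.integrableOn_compact (isCompact_closedBall (0 : ℂ) 2)).mono_set ?_
    exact fun w hw => mem_closedBall_zero_iff.2 (norm_le_of_mem_cell hw)
  rw [integral_sub (hi _ continuous_const) (hi _ (by fun_prop)), sub_add_cancel, setIntegral_const,
    measureReal_def, volume_cell, ENNReal.toReal_one, one_smul]
  refine (tsum_eq_sum fun p hp => ?_).symm
  by_contra h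
  exact hp (mem_ballPts_of_nearCircle_ne_zero hW hR (w := 0) (by simp) (by simpa using h))

end

/-! ### Sums over the lattice points of an annulus -/

lemma inv_sqrt_two_lt_one : 1 / √2 < 1 := by
  rw [div_lt_one (by positivity)]
  exact Real.one_lt_sqrt_two

lemma inv_sqrt_two_pos : 0 < 1 / √2 := by positivity

lemma mem_Gam_iff {R : ℝ} {p : ℤ × ℤ} : pt p ∈ Gam R ↔ |‖pt p‖ - R| < 1 / √2 := by
  have : pt p ∈ Gam R ↔ R - 1 / √2 < ‖pt p‖ ∧ ‖pt p‖ < R + 1 / √2 :=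
    ⟨fun h => h.2, fun h => ⟨mem_lattice_iff.2 ⟨p, rfl⟩, h⟩⟩
  rw [this, abs_lt]
  constructor <;> rintro ⟨a, b⟩ <;> constructor <;> linarith

/-- A ramp vanishing below `δ` and equal to one above `2 δ`. -/
def ramp (δ x : ℝ) : ℝ := min 1 (max 0 (x / δ - 1))

lemma continuous_ramp (δ : ℝ) : Continuous (ramp δ) := by unfold ramp; fun_prop

lemma ramp_nonneg (δ x : ℝ) : 0 ≤ ramp δ x := le_min zero_le_one (le_max_left _ _)

lemma ramp_le_one (δ x : ℝ) : ramp δ x ≤ 1 := min_le_left _ _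

lemma ramp_eq_zero {δ x : ℝ} (hδ : 0 < δ) (hx : x ≤ δ) : ramp δ x = 0 := by
  have : x / δ ≤ 1 := (div_le_one hδ).2 hx
  unfold ramp
  rw [max_eq_left (by linarith), min_eq_right zero_le_one]

lemma ramp_eq_one {δ x : ℝ} (hδ : 0 < δ) (hx : 2 * δ ≤ x) : ramp δ x = 1 := by
  have : 2 ≤ x / δ := (le_div_iff₀ hδ).2 hx
  unfold ramp
  rw [max_eq_right (by linarith), min_eq_left (by linarith)]

/-- A cutoff function equal to one on `[-1, 1]` and supported in `[-2, 2]`. -/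
def cut (s : ℝ) : ℝ := max 0 (min 1 (2 - |s|))

lemma continuous_cut : Continuous cut := by unfold cut; fun_prop

lemma cut_nonneg (s : ℝ) : 0 ≤ cut s := le_max_left _ _

lemma cut_le_one (s : ℝ) : cut s ≤ 1 := max_le zero_le_one (min_le_left _ _)

lemma cut_eq_one {s : ℝ} (hs : |s| ≤ 1) : cut s = 1 := by
  unfold cut
  rw [min_eq_left (by linarith), max_eq_right zero_le_one]

lemma cut_eq_zero {s : ℝ} (hs : 2 < |s|) : cut s = 0 := by
  unfold cut
  rw [max_eq_left]
  exact (min_le_right _ _).trans (by linarith)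

lemma integrableOn_cutoff_bound :
    IntegrableOn (fun x : ℝ × ℝ => max 0 (3 - |x.1|)) angleStrip :=
  integrableOn_angleStrip (W := 3) (by fun_prop) fun x hx => max_eq_left (by linarith)

/-! ### Test functions that are continuous only off a null set. -/

section

variable {d : ℝ × ℂ → ℝ} {f : ℝ × ℂ → ℝ}

lemma continuousOn_mul_ramp (hd : Continuous d) (hd0 : ∀ x, 0 ≤ d x)
    (hcont : ∀ x, ‖x.2‖ = 1 → 0 < d x → ContinuousAt f x) {δ : ℝ} (hδ : 0 < δ) :
    ContinuousOn (fun x => f x * ramp δ (d x)) (Set.univ ×ˢ Metric.sphere 0 1) := by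
  rintro x ⟨_, hx⟩
  have hx1 : ‖x.2‖ = 1 := by simpa using hx
  refine ContinuousAt.continuousWithinAt ?_
  rcases (hd0 x).eq_or_lt with h | h
  · have : (fun x => f x * ramp δ (d x)) =ᶠ[𝓝 x] fun _ => 0 := by
      filter_upwards [hd.continuousAt.eventually_lt continuousAt_const
        (show d x < δ by rw [← h]; exact hδ)] with y hy
      rw [ramp_eq_zero hδ hy.le, mul_zero]
    exact continuousAt_const.congr this.symm
  · exact (hcont x hx1 h).mul ((continuous_ramp δ).comp hd).continuousAt

lemma aestronglyMeasurable_of_continuousAt (hd : Continuous d)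
    (hdae : ∀ᵐ x : ℝ × ℝ, 0 < d (x.1, Complex.exp (x.2 * Complex.I)))
    (hcont : ∀ x, ‖x.2‖ = 1 → 0 < d x → ContinuousAt f x) :
    AEStronglyMeasurable fun x : ℝ × ℝ => f (x.1, Complex.exp (x.2 * Complex.I)) := by
  set U := {x : ℝ × ℝ | 0 < d (x.1, Complex.exp (x.2 * Complex.I))} with hU
  have hce : Continuous fun x : ℝ × ℝ => (x.1, Complex.exp (x.2 * Complex.I)) := by fun_prop
  have hUo : IsOpen U := isOpen_lt continuous_const (hd.comp hce)
  have h1 : ContinuousOn (fun x : ℝ × ℝ => f (x.1, Complex.exp (x.2 * Complex.I))) U := by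
    intro x hx
    exact (ContinuousAt.comp (f := fun x : ℝ × ℝ => (x.1, Complex.exp (x.2 * Complex.I)))
      (hcont _ (norm_exp_I x.2) hx) hce.continuousAt).continuousWithinAt
  have h2 := h1.aestronglyMeasurable (μ := volume) hUo.measurableSet
  rwa [Measure.restrict_eq_self_of_ae_mem] at h2
  exact hdae

lemma tendsto_integral_ramp (hd : Continuous d)
    (hdae : ∀ᵐ x : ℝ × ℝ, 0 < d (x.1, Complex.exp (x.2 * Complex.I)))
    (hb : ∀ x, |f x| ≤ 1) (hsupp : ∀ s u, 1 / √2 ≤ |s| → f (s, u) = 0)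
    (hcont : ∀ x, ‖x.2‖ = 1 → 0 < d x → ContinuousAt f x) :
    Tendsto (fun δ => ∫ x in angleStrip, f (x.1, Complex.exp (x.2 * Complex.I)) *
      ramp δ (d (x.1, Complex.exp (x.2 * Complex.I)))) (𝓝[>] 0)
      (𝓝 (∫ x in angleStrip, f (x.1, Complex.exp (x.2 * Complex.I)))) := by
  have hm := aestronglyMeasurable_of_continuousAt hd hdae hcont
  have hce : Continuous fun x : ℝ × ℝ => d (x.1, Complex.exp (x.2 * Complex.I)) := by fun_prop
  refine tendsto_integral_filter_of_dominated_convergence _ ?_ ?_ integrableOn_cutoff_bound ?_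
  · exact .of_forall fun δ => (hm.mul
      ((continuous_ramp δ).comp hce).aestronglyMeasurable).restrict
  · refine .of_forall fun δ => .of_forall fun x => ?_
    rw [Real.norm_eq_abs, abs_mul, abs_of_nonneg (ramp_nonneg _ _)]
    by_cases hs : 1 / √2 ≤ |x.1|
    · rw [hsupp _ _ hs, abs_zero, zero_mul]; exact le_max_left _ _
    · refine le_trans ?_ (le_max_right _ _)
      have := mul_le_mul (hb (x.1, Complex.exp (x.2 * Complex.I)))
        (ramp_le_one δ (d (x.1, Complex.exp (x.2 * Complex.I)))) (ramp_nonneg _ _) zero_le_one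
      linarith [inv_sqrt_two_lt_one]
  · refine ae_restrict_of_ae ?_
    filter_upwards [hdae] with x hx
    refine tendsto_const_nhds.congr' ?_
    filter_upwards [self_mem_nhdsWithin, mem_nhdsWithin_of_mem_nhds (Iio_mem_nhds (half_pos hx))]
      with δ h1 h2
    rw [ramp_eq_one h1 (by have : δ < _ := h2; linarith), mul_one]

/-- The error term in the cutoff argument. -/
def cutoffError (d : ℝ × ℂ → ℝ) (δ : ℝ) (x : ℝ × ℂ) : ℝ := (1 - ramp δ (d x) + δ) * cut x.1

lemma tendsto_integral_cutoffError (hd : Continuous d)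
    (hdae : ∀ᵐ x : ℝ × ℝ, 0 < d (x.1, Complex.exp (x.2 * Complex.I))) :
    Tendsto (fun δ => ∫ x in angleStrip, cutoffError d δ (x.1, Complex.exp (x.2 * Complex.I)))
      (𝓝[>] 0) (𝓝 0) := by
  have hce : Continuous fun x : ℝ × ℝ => d (x.1, Complex.exp (x.2 * Complex.I)) := by fun_prop
  have key := tendsto_integral_filter_of_dominated_convergence
    (μ := volume.restrict angleStrip) (l := 𝓝[>] (0 : ℝ)) (f := fun _ => (0 : ℝ))
    (F := fun δ x => cutoffError d δ (x.1, Complex.exp (x.2 * Complex.I)))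
    (fun x => 2 * max 0 (3 - |x.1|)) ?_ ?_ (integrableOn_cutoff_bound.const_mul 2) ?_
  · simpa using key
  · refine .of_forall fun δ => Continuous.aestronglyMeasurable ?_
    unfold cutoffError
    have h1 := (continuous_ramp δ).comp hce
    have h2 : Continuous fun x : ℝ × ℝ => cut x.1 := continuous_cut.comp continuous_fst
    exact ((continuous_const.sub h1).add continuous_const).mul h2
  · filter_upwards [self_mem_nhdsWithin, mem_nhdsWithin_of_mem_nhds (Iio_mem_nhds zero_lt_one)]
      with δ (h1 : 0 < δ) (h2 : δ < 1)
    refine .of_forall fun x => ?_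
    have r0 := ramp_nonneg δ (d (x.1, Complex.exp (x.2 * Complex.I)))
    have r1 := ramp_le_one δ (d (x.1, Complex.exp (x.2 * Complex.I)))
    unfold cutoffError
    rw [Real.norm_eq_abs, abs_mul, abs_of_nonneg (by linarith), abs_of_nonneg (cut_nonneg _)]
    refine mul_le_mul (by linarith) ?_ (cut_nonneg _) (by norm_num)
    by_cases hs : 2 < |x.1|
    · simp only [cut_eq_zero hs]; exact le_max_left _ _
    · exact (cut_le_one _).trans (le_trans (by linarith) (le_max_right _ _))
  · refine ae_restrict_of_ae ?_
    filter_upwards [hdae] with x hx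
    have h1 : Tendsto (fun δ : ℝ => δ * cut x.1) (𝓝[>] 0) (𝓝 (0 * cut x.1)) :=
      (tendsto_id.mono_left nhdsWithin_le_nhds).mul_const _
    rw [zero_mul] at h1
    refine h1.congr' ?_
    filter_upwards [self_mem_nhdsWithin, mem_nhdsWithin_of_mem_nhds (Iio_mem_nhds (half_pos hx))]
      with δ h1 h2
    unfold cutoffError
    rw [ramp_eq_one h1 (by have : δ < _ := h2; linarith), sub_self, zero_add]

/-- If `F R z` is approximated, away from a closed null set, by a function of the signed distance
to the circle of radius `R` and of the outward unit normal that is continuous off that set, then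
its sums over `Γ_R` are asymptotic to an integral. -/
theorem tendsto_sum_Gam (hd : Continuous d) (hd0 : ∀ x, 0 ≤ d x)
    (hdae : ∀ᵐ x : ℝ × ℝ, 0 < d (x.1, Complex.exp (x.2 * Complex.I)))
    (hb : ∀ x, |f x| ≤ 1) (hsupp : ∀ s u, 1 / √2 ≤ |s| → f (s, u) = 0)
    (hcont : ∀ x, ‖x.2‖ = 1 → 0 < d x → ContinuousAt f x)
    {F : ℝ → ℂ → ℝ} (hF : ∀ R z, |F R z| ≤ 1)
    (happ : ∀ δ > 0, ∀ᶠ R : ℝ in atTop, ∀ z ∈ Gam R, δ ≤ d (‖z‖ - R, z / (‖z‖ : ℂ)) →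
      |F R z - f (‖z‖ - R, z / (‖z‖ : ℂ))| ≤ δ) :
    Tendsto (fun R : ℝ => (1 / R) * ∑' p, (Gam R).indicator (F R) (pt p)) atTop
      (𝓝 (∫ x in angleStrip, f (x.1, Complex.exp (x.2 * Complex.I)))) := by
  rw [Metric.tendsto_nhds]
  intro ε hε
  have t1 := Metric.tendsto_nhds.1 (tendsto_integral_ramp hd hdae hb hsupp hcont) (ε / 4)
    (by positivity)
  have t2 := Metric.tendsto_nhds.1 (tendsto_integral_cutoffError hd hdae) (ε / 4) (by positivity)
  obtain ⟨δ, ⟨h1, h2⟩, hδ⟩ := ((t1.and t2).and self_mem_nhdsWithin).exists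
  replace hδ : 0 < δ := hδ
  have hg := continuousOn_mul_ramp hd hd0 hcont hδ
  have hgW : ∀ s u, 2 < |s| → f (s, u) * ramp δ (d (s, u)) = 0 := fun s u hs => by
    rw [hsupp s u (by linarith [inv_sqrt_two_lt_one]), zero_mul]
  have he : ContinuousOn (cutoffError d δ) (Set.univ ×ˢ Metric.sphere 0 1) := by
    have c1 := (continuous_ramp δ).comp hd
    have c2 : Continuous fun x : ℝ × ℂ => cut x.1 := continuous_cut.comp continuous_fst
    exact (((continuous_const.sub c1).add continuous_const).mul c2).continuousOn
  have heW : ∀ s u, 2 < |s| → cutoffError d δ (s, u) = 0 := fun s u hs => by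
    unfold cutoffError
    simp only [cut_eq_zero hs, mul_zero]
  have u1 := Metric.tendsto_nhds.1 (tendsto_sum_nearCircle hg zero_lt_two hgW) (ε / 4)
    (by positivity)
  have u2 := Metric.tendsto_nhds.1 (tendsto_sum_nearCircle he zero_lt_two heW) (ε / 4)
    (by positivity)
  filter_upwards [u1, u2, happ δ hδ, eventually_gt_atTop 2] with R v1 v2 hR hR2
  have hR0 : 0 < R := by linarith
  -- Where d ≥ δ the approximation costs δ, and where the ramp is below 1 the bound |F| ≤ 1 costs 1
  -- - ramp. The majorant is continuous and compactly supported in s, so equidistribution applies to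
  -- it, and its integral is small.
  have hterm : ∀ p, |(Gam R).indicator (F R) (pt p) -
      nearCircle (fun x => f x * ramp δ (d x)) R (pt p)| ≤ nearCircle (cutoffError d δ) R (pt p) := by
    intro p
    unfold nearCircle cutoffError
    beta_reduce
    set x : ℝ × ℂ := (‖pt p‖ - R, pt p / (‖pt p‖ : ℂ)) with hx
    have r0 := ramp_nonneg δ (d x)
    have r1 := ramp_le_one δ (d x)
    by_cases hp : pt p ∈ Gam R
    · rw [Set.indicator_of_mem hp]
      have hs : |‖pt p‖ - R| ≤ 1 := ((mem_Gam_iff.1 hp).trans inv_sqrt_two_lt_one).le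
      rw [cut_eq_one hs, mul_one]
      have e : F R (pt p) - f x * ramp δ (d x) = (F R (pt p) - f x) * ramp δ (d x) +
          F R (pt p) * (1 - ramp δ (d x)) := by ring
      rw [e]
      refine (abs_add_le _ _).trans ?_
      rw [abs_mul, abs_mul, abs_of_nonneg r0, abs_of_nonneg (sub_nonneg.2 r1), add_comm]
      refine add_le_add (mul_le_of_le_one_left (sub_nonneg.2 r1) (hF _ _)) ?_
      by_cases hdx : δ ≤ d x
      · have := hR _ hp hdx
        exact (mul_le_of_le_one_right (abs_nonneg _) r1).trans this
      · rw [ramp_eq_zero hδ (not_le.1 hdx).le, mul_zero]; exact hδ.le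
    · have hfx : f x = 0 := hsupp _ _ (not_lt.1 (fun h => hp (mem_Gam_iff.2 h)))
      rw [Set.indicator_of_notMem hp, hfx, zero_mul, sub_zero, abs_zero]
      exact mul_nonneg (by linarith) (cut_nonneg _)
  have s1 : Summable fun p => nearCircle (fun x => f x * ramp δ (d x)) R (pt p) := by
    have := summable_nearCircle (g := fun x => f x * ramp δ (d x)) hgW hR2 (w := 0) (by simp)
    simpa using this
  have s2 : Summable fun p => nearCircle (cutoffError d δ) R (pt p) := by
    have := summable_nearCircle heW hR2 (w := 0) (by simp)
    simpa using this
  have s3 : Summable fun p => (Gam R).indicator (F R) (pt p) := by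
    refine summable_of_finset (A := ballPts (R + 1 + 2)) fun p hp => ?_
    have hp' : pt p ∈ Gam R := Set.mem_of_indicator_ne_zero hp
    refine mem_ballPts_of_near (w := 0) (by simp) ?_
    simpa using ((mem_Gam_iff.1 hp').trans inv_sqrt_two_lt_one).le
  have hsum : |(1 / R) * (∑' p, (Gam R).indicator (F R) (pt p)) -
      (1 / R) * ∑' p, nearCircle (fun x => f x * ramp δ (d x)) R (pt p)| ≤
      (1 / R) * ∑' p, nearCircle (cutoffError d δ) R (pt p) := by
    rw [← mul_sub, ← s3.tsum_sub s1, abs_mul, abs_of_pos (by positivity : 0 < 1 / R)]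
    gcongr
    have sd : Summable fun p => ‖(Gam R).indicator (F R) (pt p) -
      nearCircle (fun x => f x * ramp δ (d x)) R (pt p)‖ :=
      Summable.of_nonneg_of_le (fun _ => norm_nonneg _) hterm s2
    exact (norm_tsum_le_tsum_norm sd).trans (sd.tsum_le_tsum hterm s2)
  rw [Real.dist_eq] at h1 h2 v1 v2 ⊢
  have h1' := abs_lt.1 h1
  have h2' := abs_lt.1 h2
  have v1' := abs_lt.1 v1
  have v2' := abs_lt.1 v2
  have hsum' := abs_le.1 hsum
  rw [abs_lt]
  constructor <;> linarith

end

/-! ### The combinatorics of the `k`-th point of a strip -/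

/-- Take the t-least p whose initial segment has at least k elements. If it had more, the element
just before p would already have k. -/
lemma exists_card_filter_le_eq {α : Type*} {V : Finset α} {t : α → ℝ} (ht : Set.InjOn t V) {k : ℕ}
    (hk : 1 ≤ k) (hkV : k ≤ V.card) : ∃ p ∈ V, (V.filter (fun x => t x ≤ t p)).card = k := by
  classical
  have hne : V.Nonempty := Finset.card_pos.1 (by omega)
  obtain ⟨M, hM, hMmax⟩ := V.exists_max_image t hne
  obtain ⟨p, hp, hpmin⟩ := (V.filter fun p => k ≤ (V.filter (fun x => t x ≤ t p)).card).exists_min_image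
    t ⟨M, Finset.mem_filter.2 ⟨hM, by rwa [Finset.filter_true_of_mem hMmax]⟩⟩
  obtain ⟨hpV, hpk⟩ := Finset.mem_filter.1 hp
  refine ⟨p, hpV, le_antisymm ?_ hpk⟩
  by_contra hcon
  have hsplit : V.filter (fun x => t x ≤ t p) = insert p (V.filter fun x => t x < t p) := by
    ext x
    simp only [Finset.mem_filter, Finset.mem_insert]
    constructor
    · rintro ⟨hx, hle⟩
      rcases hle.lt_or_eq with h | h
      · exact Or.inr ⟨hx, h⟩
      · exact Or.inl (ht hx hpV h)
    · rintro (rfl | ⟨hx, h⟩)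
      · exact ⟨hpV, le_rfl⟩
      · exact ⟨hx, h.le⟩
  have hcard := Finset.card_insert_le p (V.filter fun x => t x < t p)
  rw [← hsplit] at hcard
  have hne' : (V.filter fun x => t x < t p).Nonempty := Finset.card_pos.1 (by omega)
  obtain ⟨x, hx, hxmax⟩ := (V.filter fun x => t x < t p).exists_max_image t hne'
  obtain ⟨hxV, hxp⟩ := Finset.mem_filter.1 hx
  have hsub : (V.filter fun x => t x < t p) ⊆ V.filter (fun y => t y ≤ t x) := fun y hy =>
    Finset.mem_filter.2 ⟨(Finset.mem_filter.1 hy).1, hxmax y hy⟩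
  have := Finset.card_le_card hsub
  have := hpmin x (Finset.mem_filter.2 ⟨hxV, by omega⟩)
  linarith

lemma eq_of_card_filter_le_eq {α : Type*} {V : Finset α} {t : α → ℝ} (ht : Set.InjOn t V) {p q : α}
    (hp : p ∈ V) (hq : q ∈ V)
    (h : (V.filter (fun x => t x ≤ t p)).card = (V.filter (fun x => t x ≤ t q)).card) : p = q := by
  wlog hpq : t p ≤ t q generalizing p q
  · exact (this hq hp h.symm (not_le.1 hpq).le).symm
  have hsub : V.filter (fun x => t x ≤ t p) ⊆ V.filter (fun x => t x ≤ t q) := fun y hy =>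
    Finset.mem_filter.2 ⟨(Finset.mem_filter.1 hy).1, (Finset.mem_filter.1 hy).2.trans hpq⟩
  have := Finset.eq_of_subset_of_card_le hsub h.ge
  have hqm : q ∈ V.filter (fun x => t x ≤ t p) := by
    rw [this]; exact Finset.mem_filter.2 ⟨hq, le_rfl⟩
  exact ht hp hq (le_antisymm hpq (Finset.mem_filter.1 hqm).2)

/-- The points of `N` with positive long coordinate `t` and short coordinate `q` in the open
window. -/
def window (N : Finset (ℤ × ℤ)) (q t : ℤ × ℤ → ℝ) : Finset (ℤ × ℤ) :=
  N.filter fun p => 0 < t p ∧ |q p| < 1 / √2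

lemma mem_window {N : Finset (ℤ × ℤ)} {q t : ℤ × ℤ → ℝ} {p : ℤ × ℤ} :
    p ∈ window N q t ↔ p ∈ N ∧ 0 < t p ∧ |q p| < 1 / √2 := Finset.mem_filter

/-- `p` is the `k`-th point of the window in the order given by `t`. -/
def IsKth (k : ℕ) (N : Finset (ℤ × ℤ)) (q t : ℤ × ℤ → ℝ) (p : ℤ × ℤ) : Prop :=
  p ∈ window N q t ∧ ((window N q t).filter (fun x => t x ≤ t p)).card = k

/-- The coordinates `(t, q)` are `δ`-separated from a configuration in which points lie on the
boundary of the strip or have the same long coordinate. -/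
structure Separated (δ : ℝ) (N : Finset (ℤ × ℤ)) (q t : ℤ × ℤ → ℝ) : Prop where
  short : ∀ p ∈ N, δ ≤ |(|q p| - 1 / √2)|
  long : ∀ p ∈ N, ∀ p' ∈ N, p ≠ p' → δ ≤ |t p - t p'|

lemma Separated.injOn {δ : ℝ} (hδ : 0 < δ) {N : Finset (ℤ × ℤ)} {q t : ℤ × ℤ → ℝ}
    (h : Separated δ N q t) : Set.InjOn t (window N q t) := by
  intro p hp p' hp' e
  by_contra hne
  have := h.long p (mem_window.1 hp).1 p' (mem_window.1 hp').1 hne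
  rw [e, sub_self, abs_zero] at this
  linarith

lemma IsKth.unique {δ : ℝ} (hδ : 0 < δ) {k : ℕ} {N : Finset (ℤ × ℤ)} {q t : ℤ × ℤ → ℝ}
    (h : Separated δ N q t) {p p' : ℤ × ℤ} (hp : IsKth k N q t p) (hp' : IsKth k N q t p') :
    p = p' :=
  eq_of_card_filter_le_eq (h.injOn hδ) hp.1 hp'.1 (hp.2.trans hp'.2.symm)

/-- Moving t by less than δ/2 preserves all comparisons, including those with 0 ∈ N, which encode t
> 0; moving q by less than δ carries no point across an edge of the window. -/
lemma Separated.isKth_iff {δ : ℝ} (hδ : 0 < δ) {k : ℕ} {N : Finset (ℤ × ℤ)} (h0 : (0 : ℤ × ℤ) ∈ N)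
    {q t q' t' : ℤ × ℤ → ℝ} (h : Separated δ N q t) (ht0 : t 0 = 0) (ht0' : t' 0 = 0)
    (hq : ∀ p ∈ N, |q' p - q p| < δ) (ht : ∀ p ∈ N, |t' p - t p| < δ / 2) (p : ℤ × ℤ) :
    IsKth k N q' t' p ↔ IsKth k N q t p := by
  have hord : ∀ p ∈ N, ∀ p' ∈ N, (t' p ≤ t' p' ↔ t p ≤ t p') := by
    intro p hp p' hp'
    by_cases e : p = p'
    · rw [e]; simp
    have h1 := h.long p hp p' hp' e
    have h2 := abs_lt.1 (ht p hp)
    have h3 := abs_lt.1 (ht p' hp')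
    rcases le_abs.1 h1 with h4 | h4
    · exact ⟨fun _ => by linarith, fun _ => by linarith⟩
    · exact ⟨fun _ => by linarith, fun _ => by linarith⟩
  have hpos : ∀ p ∈ N, (0 < t' p ↔ 0 < t p) := by
    intro p hp
    have := hord p hp 0 h0
    rw [ht0, ht0'] at this
    rw [← not_le, ← not_le, this]
  have hwin : window N q' t' = window N q t := by
    refine Finset.filter_congr fun p hp => ?_
    rw [hpos p hp]
    refine and_congr_right fun _ => ?_
    have h1 := h.short p hp
    have h2 := (abs_abs_sub_abs_le (q' p) (q p)).trans_lt (hq p hp)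
    rw [abs_lt] at h2
    rcases le_abs.1 h1 with h4 | h4
    · exact ⟨fun _ => by linarith, fun _ => by linarith⟩
    · exact ⟨fun _ => by linarith, fun _ => by linarith⟩
  unfold IsKth
  rw [hwin]
  refine and_congr_right fun hp => ?_
  rw [Finset.filter_congr fun x hx => hord x (mem_window.1 hx).1 p (mem_window.1 hp).1]

/-! ### Strip coordinates of lattice points -/

/-- The short coordinate of a lattice point in the strip with short direction `u` and shift `s`. -/
def shortCoord (s : ℝ) (u : ℂ) (p : ℤ × ℤ) : ℝ := s + (conj u * pt p).re

/-- The long coordinate of a lattice point in the strip with short direction `u`. -/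
def longCoord (u : ℂ) (p : ℤ × ℤ) : ℝ := -(conj u * pt p).im

lemma shortCoord_zero (s : ℝ) (u : ℂ) : shortCoord s u 0 = s := by simp [shortCoord]

lemma longCoord_zero (u : ℂ) : longCoord u 0 = 0 := by simp [longCoord]

lemma longCoord_sub (u : ℂ) (p p' : ℤ × ℤ) :
    longCoord u (p - p') = longCoord u p - longCoord u p' := by
  simp only [longCoord, pt_sub, mul_sub, Complex.sub_im]; ring

lemma continuous_shortCoord (p : ℤ × ℤ) : Continuous fun x : ℝ × ℂ => shortCoord x.1 x.2 p := by
  unfold shortCoord; fun_prop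

lemma continuous_longCoord (p : ℤ × ℤ) : Continuous fun x : ℝ × ℂ => longCoord x.2 p := by
  unfold longCoord; fun_prop

lemma abs_longCoord_le {u : ℂ} (hu : ‖u‖ = 1) (p : ℤ × ℤ) : |longCoord u p| ≤ ‖pt p‖ := by
  unfold longCoord
  rw [abs_neg]
  refine (Complex.abs_im_le_norm _).trans ?_
  rw [norm_mul, RCLike.norm_conj, hu, one_mul]

lemma norm_pt_le {u : ℂ} (hu : ‖u‖ = 1) (s : ℝ) (p : ℤ × ℤ) :
    ‖pt p‖ ≤ |s| + |shortCoord s u p| + |longCoord u p| := by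
  have h1 : ‖pt p‖ = ‖conj u * pt p‖ := by rw [norm_mul, RCLike.norm_conj, hu, one_mul]
  rw [h1]
  refine (Complex.norm_le_abs_re_add_abs_im _).trans ?_
  unfold longCoord
  rw [abs_neg]
  gcongr
  have : (conj u * pt p).re = shortCoord s u p - s := by unfold shortCoord; ring
  rw [this, add_comm]
  exact abs_sub _ _

/-- The long coordinate is the projection to u of the quarter turn of the lattice vector. -/
lemma Generic.longCoord_ne_zero {u : ℂ} (hu : Generic u) {p : ℤ × ℤ} (hp : p ≠ 0) :
    longCoord u p ≠ 0 := by
  have := hu (-p.2, p.1) (fun h => hp (by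
    rw [Prod.mk_eq_zero, neg_eq_zero] at h
    exact Prod.ext h.2 h.1))
  convert this using 1
  simp [longCoord]
  ring

lemma exists_pt_near (c : ℂ) : ∃ p, ‖pt p - c‖ ≤ 1 / √2 := by
  refine ⟨(round c.re, round c.im), ?_⟩
  have h1 := abs_le.1 (abs_sub_round c.re)
  have h2 := abs_le.1 (abs_sub_round c.im)
  rw [← Real.sqrt_sq (norm_nonneg _), ← Complex.normSq_eq_norm_sq, Complex.normSq_apply, one_div,
    ← Real.sqrt_inv]
  apply Real.sqrt_le_sqrt
  simp only [Complex.sub_re, Complex.sub_im, pt_re, pt_im]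
  nlinarith

/-- The half-width 1/√2 of the strip is the covering radius of ℤ²: a nearest lattice point to a
point of the axis lies in the strip. -/
lemma exists_pt_in_strip {u : ℂ} (hu : ‖u‖ = 1) (s a : ℝ) :
    ∃ p, |shortCoord s u p| ≤ 1 / √2 ∧ |longCoord u p - a| ≤ 1 / √2 := by
  obtain ⟨p, hp⟩ := exists_pt_near (u * ⟨-s, -a⟩)
  have huu : conj u * u = 1 := by
    rw [mul_comm, Complex.mul_conj, Complex.normSq_eq_norm_sq, hu]; simp
  have e : conj u * pt p = conj u * (pt p - u * ⟨-s, -a⟩) + ⟨-s, -a⟩ := by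
    rw [mul_sub, ← mul_assoc, huu, one_mul, sub_add_cancel]
  have hn : ‖conj u * (pt p - u * ⟨-s, -a⟩)‖ ≤ 1 / √2 := by
    rwa [norm_mul, RCLike.norm_conj, hu, one_mul]
  refine ⟨p, ?_, ?_⟩
  · unfold shortCoord
    rw [e, Complex.add_re, add_comm, add_assoc, neg_add_cancel, add_zero]
    exact (Complex.abs_re_le_norm _).trans hn
  · unfold longCoord
    rw [e, Complex.add_im, neg_add, neg_neg, add_sub_cancel_right, abs_neg]
    exact (Complex.abs_im_le_norm _).trans hn

/-- The lattice points among which the `k`-th point of a strip is found. -/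
def nbhd (k : ℕ) : Finset (ℤ × ℤ) := ballPts (2 * k + 5)

/-- The differences of points of `nbhd k`. -/
def nbhdDiff (k : ℕ) : Finset (ℤ × ℤ) := ballPts (2 * (2 * k + 5))

lemma zero_mem_nbhd (k : ℕ) : (0 : ℤ × ℤ) ∈ nbhd k := by
  rw [nbhd, mem_ballPts, pt_zero, norm_zero]; positivity

lemma nbhd_subset (k : ℕ) : nbhd k ⊆ nbhdDiff k := by
  intro p hp
  rw [nbhd, mem_ballPts] at hp
  rw [nbhdDiff, mem_ballPts]
  linarith [norm_nonneg (pt p)]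

lemma sub_mem_nbhdDiff {k : ℕ} {p p' : ℤ × ℤ} (hp : p ∈ nbhd k) (hp' : p' ∈ nbhd k) :
    p - p' ∈ nbhdDiff k := by
  rw [nbhd, mem_ballPts] at hp hp'
  rw [nbhdDiff, mem_ballPts, pt_sub]
  exact (norm_sub_le _ _).trans (by linarith)

/-- The distance, in terms of the coordinates of the points of `nbhdDiff k`, to a degenerate
configuration. -/
def degeneracy (k : ℕ) (x : ℝ × ℂ) : ℝ :=
  (nbhdDiff k).inf' ⟨0, nbhd_subset k (zero_mem_nbhd k)⟩ fun p =>
    min |(|shortCoord x.1 x.2 p| - 1 / √2)| (if p = 0 then 1 else |longCoord x.2 p|)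

lemma continuous_degeneracy (k : ℕ) : Continuous (degeneracy k) := by
  refine Continuous.finset_inf'_apply _ fun p _ => ?_
  refine Continuous.min ?_ ?_
  · exact ((continuous_shortCoord p).abs.sub continuous_const).abs
  · split_ifs
    · exact continuous_const
    · exact (continuous_longCoord p).abs

lemma degeneracy_nonneg (k : ℕ) (x : ℝ × ℂ) : 0 ≤ degeneracy k x := by
  refine Finset.le_inf' _ _ fun p _ => le_min (abs_nonneg _) ?_
  split_ifs
  · exact zero_le_one
  · exact abs_nonneg _

lemma degeneracy_le_short {k : ℕ} (x : ℝ × ℂ) {p : ℤ × ℤ} (hp : p ∈ nbhdDiff k) :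
    degeneracy k x ≤ |(|shortCoord x.1 x.2 p| - 1 / √2)| :=
  (Finset.inf'_le _ hp).trans (min_le_left _ _)

lemma degeneracy_le_long {k : ℕ} (x : ℝ × ℂ) {p : ℤ × ℤ} (hp : p ∈ nbhdDiff k) (h0 : p ≠ 0) :
    degeneracy k x ≤ |longCoord x.2 p| := by
  refine (Finset.inf'_le _ hp).trans ((min_le_right _ _).trans ?_)
  rw [if_neg h0]

/-- Long separation of two points is the long coordinate of their difference, which is why the
minimum in `degeneracy` runs over `nbhdDiff k` rather than `nbhd k`. -/
lemma separated_degeneracy (k : ℕ) (x : ℝ × ℂ) {δ : ℝ} (hδ : δ ≤ degeneracy k x) :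
    Separated δ (nbhd k) (shortCoord x.1 x.2) (longCoord x.2) where
  short p hp := hδ.trans (degeneracy_le_short x (nbhd_subset k hp))
  long p hp p' hp' hne := by
    rw [← longCoord_sub]
    exact hδ.trans (degeneracy_le_long x (sub_mem_nbhdDiff hp hp') (sub_ne_zero.2 hne))

/-- By Fubini with the angle as outer variable: for a generic angle no long coordinate vanishes, and
only finitely many s place a point on an edge. -/
lemma ae_degeneracy_pos (k : ℕ) :
    ∀ᵐ x : ℝ × ℝ, 0 < degeneracy k (x.1, Complex.exp (x.2 * Complex.I)) := by
  have hswap : ∀ᵐ y : ℝ × ℝ ∂(volume.prod volume),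
      0 < degeneracy k (y.2, Complex.exp (y.1 * Complex.I)) := by
    have hm : MeasurableSet {y : ℝ × ℝ | 0 < degeneracy k (y.2, Complex.exp (y.1 * Complex.I))} :=
      (isOpen_lt continuous_const ((continuous_degeneracy k).comp (by fun_prop))).measurableSet
    rw [Measure.ae_prod_iff_ae_ae hm]
    filter_upwards [ae_generic] with φ hφ
    have hfin : ∀ p ∈ nbhdDiff k, ∀ᵐ s : ℝ,
        |shortCoord s (Complex.exp (φ * Complex.I)) p| - 1 / √2 ≠ 0 := by
      intro p _
      set c := (conj (Complex.exp (φ * Complex.I)) * pt p).re with hc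
      have hcount : ({1 / √2 - c, -(1 / √2) - c} : Set ℝ).Countable :=
        (Set.finite_singleton _ |>.insert _).countable
      filter_upwards [hcount.ae_notMem volume] with s hs h
      refine hs ?_
      rw [sub_eq_zero, shortCoord, ← hc, abs_eq inv_sqrt_two_pos.le] at h
      rcases h with h | h
      · left; linarith
      · right; rw [Set.mem_singleton_iff]; linarith
    have := (ae_ball_iff (nbhdDiff k).countable_toSet).2 hfin
    filter_upwards [this] with s hs
    refine (Finset.lt_inf'_iff _).2 fun p hp => lt_min (abs_pos.2 (hs p hp)) ?_
    split_ifs with h0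
    · exact zero_lt_one
    · exact abs_pos.2 (hφ.longCoord_ne_zero h0)
  exact (Measure.measurePreserving_swap (μ := (volume : Measure ℝ))
    (ν := (volume : Measure ℝ))).quasiMeasurePreserving.ae hswap

lemma exists_isKth {k : ℕ} (hk : 1 ≤ k) {s : ℝ} {u : ℂ} (hu : ‖u‖ = 1) (hs : |s| < 1 / √2)
    (hd : 0 < degeneracy k (s, u)) :
    ∃ p, IsKth k (nbhd k) (shortCoord s u) (longCoord u) p ∧ longCoord u p ≤ 2 * k + 1 := by
  -- Axis points at heights 2, 4, …, 2k yield k different lattice points, since 2 exceeds √2, all of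
  -- height at most 2k + 1. As `V` is an initial segment of the window, ranks in `V` and in the
  -- window agree.
  have hw := inv_sqrt_two_lt_one
  have hsep := separated_degeneracy k (s, u) le_rfl
  set V := (window (nbhd k) (shortCoord s u) (longCoord u)).filter
    (fun p => longCoord u p ≤ 2 * k + 1) with hV
  choose P hP using fun i : ℕ => exists_pt_in_strip hu s (2 * ((i : ℝ) + 1))
  have hmem : ∀ i ∈ Finset.range k, P i ∈ V := by
    intro i hi
    have hik : (i : ℝ) + 1 ≤ k := by exact_mod_cast Finset.mem_range.1 hi
    obtain ⟨h1, h2⟩ := hP i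
    have h2 := abs_le.1 h2
    have hi0 : (0 : ℝ) ≤ i := Nat.cast_nonneg i
    have hN : P i ∈ nbhd k := by
      rw [nbhd, mem_ballPts]
      refine (norm_pt_le hu s (P i)).trans ?_
      have : |longCoord u (P i)| ≤ 2 * k + 1 := abs_le.2 ⟨by linarith, by linarith⟩
      linarith
    refine Finset.mem_filter.2 ⟨mem_window.2 ⟨hN, by linarith, lt_of_le_of_ne h1 fun h => ?_⟩,
      by linarith⟩
    have := hsep.short _ hN
    rw [h, sub_self, abs_zero] at this
    linarith
  have hinj : Set.InjOn P (Finset.range k) := by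
    intro i _ j _ hij
    have h1 := abs_le.1 (hP i).2
    have h2 := abs_le.1 (hP j).2
    rw [hij] at h1
    have h3 : (i : ℝ) < j + 1 := by linarith
    have h4 : (j : ℝ) < i + 1 := by linarith
    have h3' : i < j + 1 := by exact_mod_cast h3
    have h4' : j < i + 1 := by exact_mod_cast h4
    omega
  have hcard : k ≤ V.card := by
    have := Finset.card_le_card_of_injOn P hmem hinj
    rwa [Finset.card_range] at this
  obtain ⟨p, hp, hpk⟩ := exists_card_filter_le_eq (t := longCoord u)
    ((hsep.injOn hd).mono (by intro x hx; exact (Finset.mem_filter.1 hx).1)) hk hcard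
  obtain ⟨hpw, hple⟩ := Finset.mem_filter.1 hp
  refine ⟨p, ⟨hpw, ?_⟩, hple⟩
  refine Eq.trans ?_ hpk
  rw [hV, Finset.filter_filter]
  congr 1
  ext x
  simp only [Finset.mem_filter]
  exact ⟨fun h => ⟨h.1, h.2.trans hple, h.2⟩, fun h => ⟨h.1, h.2.2⟩⟩

/-- The `k`-th point of the strip (an arbitrary value in degenerate configurations). -/
def kth (k : ℕ) (x : ℝ × ℂ) : ℤ × ℤ :=
  Classical.epsilon (IsKth k (nbhd k) (shortCoord x.1 x.2) (longCoord x.2))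

lemma kth_eq {k : ℕ} {x : ℝ × ℂ} (hd : 0 < degeneracy k x) {p : ℤ × ℤ}
    (hp : IsKth k (nbhd k) (shortCoord x.1 x.2) (longCoord x.2) p) : kth k x = p := by
  exact IsKth.unique hd (separated_degeneracy k x le_rfl) (Classical.epsilon_spec ⟨p, hp⟩) hp

lemma eventually_kth_eq {k : ℕ} {x : ℝ × ℂ} (hd : 0 < degeneracy k x) :
    ∀ᶠ y in 𝓝 x, kth k y = kth k x := by
  have hsep := separated_degeneracy k x le_rfl
  have h1 : ∀ᶠ y in 𝓝 x, ∀ p ∈ nbhd k,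
      |shortCoord y.1 y.2 p - shortCoord x.1 x.2 p| < degeneracy k x := by
    rw [Filter.eventually_all_finset]
    intro p _
    have : ContinuousAt (fun y : ℝ × ℂ => |shortCoord y.1 y.2 p - shortCoord x.1 x.2 p|) x :=
      ((continuous_shortCoord p).sub continuous_const).abs.continuousAt
    exact this.eventually_lt continuousAt_const (by simpa using hd)
  have h2 : ∀ᶠ y in 𝓝 x, ∀ p ∈ nbhd k,
      |longCoord y.2 p - longCoord x.2 p| < degeneracy k x / 2 := by
    rw [Filter.eventually_all_finset]
    intro p _
    have : ContinuousAt (fun y : ℝ × ℂ => |longCoord y.2 p - longCoord x.2 p|) x :=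
      ((continuous_longCoord p).sub continuous_const).abs.continuousAt
    exact this.eventually_lt continuousAt_const (by simpa using hd)
  filter_upwards [h1, h2] with y h1 h2
  unfold kth
  -- The two predicates are equal, so `epsilon` makes the same choice.
  have := funext fun p => propext (hsep.isKth_iff (k := k) hd (zero_mem_nbhd k) (longCoord_zero _)
    (longCoord_zero _) h1 h2 p)
  rw [this]

/-! ### The limiting functions -/

open Classical in
/-- The function of the local picture whose integral is the limit of the averages of
`Ψ (A_R (λ_{j+k})) (A_R (λ_j))`. -/
def localFun (Ψ : ℝ → ℝ → ℝ) (k : ℕ) (x : ℝ × ℂ) : ℝ :=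
  if |x.1| < 1 / √2 then
    Ψ (halfArea x.1 x.2) (halfArea (shortCoord x.1 x.2 (kth k x)) x.2) else 0

/-- Functions of two areas that are bounded by one and Lipschitz. -/
structure Admissible (Ψ : ℝ → ℝ → ℝ) : Prop where
  bound : ∀ a b, |a| ≤ 1 → |b| ≤ 1 → |Ψ a b| ≤ 1
  lipschitz : ∀ a b a' b', |a| ≤ 1 → |b'| ≤ 1 → |Ψ a b - Ψ a' b'| ≤ |a - a'| + |b - b'|

lemma Admissible.continuousAt_comp {Ψ : ℝ → ℝ → ℝ} (hΨ : Admissible Ψ) {α : Type*}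
    [TopologicalSpace α] {a b : α → ℝ} {x : α} (ha : ContinuousAt a x) (hb : ContinuousAt b x)
    (ha1 : ∀ y, |a y| ≤ 1) (hb1 : ∀ y, |b y| ≤ 1) : ContinuousAt (fun y => Ψ (a y) (b y)) x := by
  rw [ContinuousAt, tendsto_iff_dist_tendsto_zero]
  refine squeeze_zero (fun _ => dist_nonneg)
    (fun y => hΨ.lipschitz (a y) (b y) (a x) (b x) (ha1 y) (hb1 x)) ?_
  have : ContinuousAt (fun y => |a y - a x| + |b y - b x|) x := by fun_prop
  simpa using this.tendsto

lemma abs_localFun_le {Ψ : ℝ → ℝ → ℝ} (hΨ : Admissible Ψ) (k : ℕ) (x : ℝ × ℂ) :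
    |localFun Ψ k x| ≤ 1 := by
  unfold localFun
  split_ifs
  · exact hΨ.bound _ _ (abs_halfArea_le_one _ _) (abs_halfArea_le_one _ _)
  · simp

lemma localFun_eq_zero (Ψ : ℝ → ℝ → ℝ) (k : ℕ) {s : ℝ} (u : ℂ) (hs : 1 / √2 ≤ |s|) :
    localFun Ψ k (s, u) = 0 := if_neg (not_lt.2 hs)

/-- The point p = 0 in `degeneracy` keeps |s| away from the jump at 1/√2; the index `kth` is locally
constant, which leaves a composition of continuous functions. -/
lemma continuousAt_localFun {Ψ : ℝ → ℝ → ℝ} (hΨ : Admissible Ψ) {k : ℕ} {x : ℝ × ℂ}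
    (hx : ‖x.2‖ = 1) (hd : 0 < degeneracy k x) : ContinuousAt (localFun Ψ k) x := by
  have hs : |(|x.1| - 1 / √2)| > 0 := by
    have := degeneracy_le_short x (nbhd_subset k (zero_mem_nbhd k))
    rw [shortCoord_zero] at this
    linarith
  have hs' : |x.1| ≠ 1 / √2 := sub_ne_zero.1 (abs_pos.1 hs)
  have hca : ContinuousAt (fun y : ℝ × ℂ => |y.1|) x := continuous_fst.abs.continuousAt
  rcases lt_or_gt_of_ne hs' with h | h
  · have hev : localFun Ψ k =ᶠ[𝓝 x] fun y =>
        Ψ (halfArea y.1 y.2) (halfArea (shortCoord y.1 y.2 (kth k x)) y.2) := by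
      filter_upwards [eventually_kth_eq hd, hca.eventually_lt continuousAt_const h] with y h1 h2
      rw [localFun, if_pos h2, h1]
    refine ContinuousAt.congr ?_ hev.symm
    refine hΨ.continuousAt_comp (continuousAt_halfArea hx) ?_ (fun _ => abs_halfArea_le_one _ _)
      (fun _ => abs_halfArea_le_one _ _)
    have hc : ContinuousAt (fun y : ℝ × ℂ => (shortCoord y.1 y.2 (kth k x), y.2)) x :=
      ((continuous_shortCoord _).prodMk continuous_snd).continuousAt
    exact ContinuousAt.comp (f := fun y : ℝ × ℂ => (shortCoord y.1 y.2 (kth k x), y.2))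
      (g := fun y : ℝ × ℂ => halfArea y.1 y.2) (continuousAt_halfArea hx) hc
  · have hev : localFun Ψ k =ᶠ[𝓝 x] fun _ => 0 := by
      filter_upwards [continuousAt_const.eventually_lt hca h] with y h2
      exact if_neg (not_lt.2 h2.le)
    exact continuousAt_const.congr hev.symm

/-! ### The order of the lattice points by argument -/

lemma abs_arctan_le (x : ℝ) : |Real.arctan x| ≤ |x| := by
  have key : ∀ x : ℝ, 0 ≤ x → Real.arctan x ≤ x := by
    intro x hx
    have := Real.le_tan (Real.arctan_nonneg.2 hx) (Real.arctan_lt_pi_div_two x)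
    rwa [Real.tan_arctan] at this
  rcases le_total 0 x with h | h
  · rw [abs_of_nonneg h, abs_of_nonneg (Real.arctan_nonneg.2 h)]; exact key x h
  · rw [abs_of_nonpos h, abs_of_nonpos (Real.arctan_le_zero.2 h), ← Real.arctan_neg]
    exact key _ (by linarith)

lemma argument_mem (z : ℂ) : argument z ∈ Set.Ico 0 (2 * Real.pi) := by
  have := toIcoMod_mem_Ico Real.two_pi_pos 0 z.arg
  rwa [zero_add] at this

lemma norm_mul_exp_argument (z : ℂ) : (‖z‖ : ℂ) * Complex.exp (argument z * Complex.I) = z := by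
  have h : argument z = z.arg - toIcoDiv Real.two_pi_pos 0 z.arg * (2 * Real.pi) := by
    rw [argument, toIcoMod, zsmul_eq_mul]
  have h2 : Complex.exp (argument z * Complex.I) = Complex.exp (z.arg * Complex.I) := by
    rw [Complex.exp_eq_exp_iff_exists_int]
    refine ⟨-toIcoDiv Real.two_pi_pos 0 z.arg, ?_⟩
    rw [h]; push_cast; ring
  rw [h2, Complex.norm_mul_exp_arg_mul_I]

lemma argument_eq {z : ℂ} (hz : z ≠ 0) {α : ℝ} (hα : α ∈ Set.Ico 0 (2 * Real.pi))
    (h : z = (‖z‖ : ℂ) * Complex.exp (α * Complex.I)) : argument z = α := by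
  have hn : (‖z‖ : ℂ) ≠ 0 := by simpa using hz
  have h1 := mul_left_cancel₀ hn ((norm_mul_exp_argument z).trans h)
  rw [Complex.exp_eq_exp_iff_exists_int] at h1
  obtain ⟨n, hn⟩ := h1
  have h2 : argument z = α + n * (2 * Real.pi) := by
    have := congrArg Complex.im hn
    simpa using this
  have ha := argument_mem z
  have hpi := Real.two_pi_pos
  have n1 : (n : ℝ) < 1 := by
    by_contra hc
    have : 1 * (2 * Real.pi) ≤ n * (2 * Real.pi) := by gcongr; exact not_lt.1 hc
    linarith [ha.2, hα.1]
  have n2 : (-1 : ℝ) < n := by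
    by_contra hc
    have : n * (2 * Real.pi) ≤ -1 * (2 * Real.pi) := by gcongr; exact not_lt.1 hc
    linarith [ha.1, hα.2]
  have n1' : n < 1 := by exact_mod_cast n1
  have n2' : -1 < n := by exact_mod_cast n2
  have : n = 0 := by omega
  rw [h2, this]; simp

lemma dir_eq_exp_argument {z : ℂ} (hz : z ≠ 0) :
    z / (‖z‖ : ℂ) = Complex.exp (argument z * Complex.I) := by
  have hn : (‖z‖ : ℂ) ≠ 0 := by simpa using hz
  rw [div_eq_iff hn, mul_comm, norm_mul_exp_argument]

lemma IsArgOrdering.periodic_mul {R : ℝ} {lam : ℕ → ℂ} (h : IsArgOrdering R lam) (j n : ℕ) :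
    lam (j + n * K R) = lam j := by
  induction n with
  | zero => simp
  | succ n ih => rw [Nat.succ_mul, ← add_assoc, h.periodic, ih]

/-- The signed distance of a neighbour of `z` to the circle of radius `R`. -/
def annulusShort (R : ℝ) (z : ℂ) (p : ℤ × ℤ) : ℝ := ‖z + pt p‖ - R

/-- A rescaled version of the (clockwise) tangent of the angle between `z` and a neighbour. -/
def annulusLong (z : ℂ) (p : ℤ × ℤ) : ℝ :=
  ‖z‖ * longCoord (z / (‖z‖ : ℂ)) p / (‖z‖ + (conj (z / (‖z‖ : ℂ)) * pt p).re)

lemma annulusLong_zero (z : ℂ) : annulusLong z 0 = 0 := by simp [annulusLong, longCoord_zero]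

/-- In the frame of z the point is (‖z‖ + a)(1 + iy), so the argument changes by arctan y. The
hypothesis `hα` excludes a wrap around the positive real axis. -/
lemma argument_add {z : ℂ} (hz : z ≠ 0) {p : ℤ × ℤ} (hp : ‖pt p‖ < ‖z‖)
    (hα : argument z - Real.arctan (annulusLong z p / ‖z‖) ∈ Set.Ico 0 (2 * Real.pi)) :
    argument (z + pt p) = argument z - Real.arctan (annulusLong z p / ‖z‖) := by
  have hn : 0 < ‖z‖ := norm_pos_iff.2 hz
  set u := z / (‖z‖ : ℂ) with hu
  have hu1 : ‖u‖ = 1 := norm_dir hz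
  have huu : u * conj u = 1 := by
    rw [Complex.mul_conj, Complex.normSq_eq_norm_sq, hu1]; simp
  set a := (conj u * pt p).re with ha
  set b := (conj u * pt p).im with hb
  have hap : |a| ≤ ‖pt p‖ := by
    refine (Complex.abs_re_le_norm _).trans ?_
    rw [norm_mul, RCLike.norm_conj, hu1, one_mul]
  have hX : 0 < ‖z‖ + a := by linarith [(abs_le.1 hap).1]
  set y := b / (‖z‖ + a) with hy
  have e1 : annulusLong z p / ‖z‖ = -y := by
    rw [annulusLong, longCoord, ← hu, ← ha, ← hb, hy]
    field_simp
  rw [e1, Real.arctan_neg, sub_neg_eq_add] at hα ⊢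
  have hzp : z + pt p ≠ 0 := by
    intro h
    have : ‖z‖ = ‖pt p‖ := by rw [eq_neg_of_add_eq_zero_left h, norm_neg]
    linarith
  have hsq : 0 < √(1 + y ^ 2) := Real.sqrt_pos.2 (by positivity)
  have hrot : z + pt p = ((‖z‖ + a : ℝ) * √(1 + y ^ 2) : ℝ) *
      Complex.exp ((argument z + Real.arctan y : ℝ) * Complex.I) := by
    have w1 : conj u * (z + pt p) = ((‖z‖ + a : ℝ) : ℂ) * (1 + y * Complex.I) := by
      rw [mul_add, hu, conj_dir_mul_self hz, ← hu]
      have hX' : ((‖z‖ + a : ℝ) : ℂ) ≠ 0 := by exact_mod_cast hX.ne'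
      have : ((‖z‖ + a : ℝ) : ℂ) * (1 + y * Complex.I) = ((‖z‖ + a : ℝ) : ℂ) + b * Complex.I := by
        rw [hy]; push_cast at hX' ⊢; field_simp
      rw [this, ← Complex.re_add_im (conj u * pt p)]
      push_cast; ring
    have w2 : (√(1 + y ^ 2) : ℂ) * Complex.exp (Real.arctan y * Complex.I) =
        1 + y * Complex.I := by
      rw [Complex.exp_mul_I, ← Complex.ofReal_cos, ← Complex.ofReal_sin, Real.cos_arctan,
        Real.sin_arctan]
      have : (√(1 + y ^ 2) : ℂ) ≠ 0 := by exact_mod_cast hsq.ne'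
      push_cast
      field_simp
    calc z + pt p = u * (conj u * (z + pt p)) := by rw [← mul_assoc, huu, one_mul]
      _ = _ := by
        rw [w1, ← w2, hu, dir_eq_exp_argument hz]
        rw [show ((argument z + Real.arctan y : ℝ) : ℂ) * Complex.I =
          argument z * Complex.I + Real.arctan y * Complex.I by push_cast; ring, Complex.exp_add]
        push_cast; ring
  have hnorm : ‖z + pt p‖ = (‖z‖ + a) * √(1 + y ^ 2) := by
    rw [hrot, norm_mul, norm_exp_I, mul_one, Complex.norm_real, Real.norm_eq_abs, abs_of_pos]
    positivity
  refine argument_eq hzp hα ?_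
  rw [hnorm]
  exact hrot

lemma norm_sub_le_of_argument {y z : ℂ} :
    ‖y - z‖ ≤ |‖y‖ - ‖z‖| + ‖z‖ * |argument y - argument z| := by
  have e : y - z = ((‖y‖ - ‖z‖ : ℝ) : ℂ) * Complex.exp (argument y * Complex.I) +
      (‖z‖ : ℂ) * (Complex.exp (argument z * Complex.I) *
        (Complex.exp (Complex.I * (argument y - argument z : ℝ)) - 1)) := by
    have : Complex.exp (argument z * Complex.I) *
        Complex.exp (Complex.I * (argument y - argument z : ℝ)) =
        Complex.exp (argument y * Complex.I) := by
      rw [← Complex.exp_add]; congr 1; push_cast; ring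
    rw [mul_sub, this, mul_one]
    nth_rewrite 1 [← norm_mul_exp_argument y, ← norm_mul_exp_argument z]
    push_cast; ring
  rw [e]
  refine (norm_add_le _ _).trans ?_
  rw [norm_mul, norm_mul, norm_mul, norm_exp_I, norm_exp_I, Complex.norm_real, Complex.norm_real,
    norm_norm, mul_one, one_mul, Real.norm_eq_abs]
  gcongr
  exact Real.norm_exp_I_mul_ofReal_sub_one_le

/-- The filtered set is the interval [j, m). Only the values at j and m must be attained once, so
ties elsewhere are harmless. -/
lemma add_eq_of_card_filter {g : ℕ → ℝ} {n : ℕ} (hg : MonotoneOn g (Set.Icc 1 n)) {k j m : ℕ}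
    (hk : 1 ≤ k) (hj : j ∈ Set.Icc 1 n) (hm : m ∈ Set.Icc 1 n)
    (hm' : ∀ i ∈ Set.Icc 1 n, g i = g m → i = m) (hj' : ∀ i ∈ Set.Icc 1 n, g i = g j → i = j)
    (hcard : ((Finset.Icc 1 n).filter fun i => g j ≤ g i ∧ g i < g m).card = k) : j + k = m := by
  have : ((Finset.Icc 1 n).filter fun i => g j ≤ g i ∧ g i < g m) = Finset.Ico j m := by
    ext i
    rw [Finset.mem_filter, Finset.mem_Ico, Finset.mem_Icc]
    constructor
    · rintro ⟨hi, h1, h2⟩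
      constructor
      · by_contra h
        have := hg hi hj (not_le.1 h).le
        have := hj' i hi (le_antisymm this h1)
        omega
      · by_contra h
        exact absurd (hg hm hi (not_lt.1 h)) (not_le.2 h2)
    · rintro ⟨h1, h2⟩
      have hi : i ∈ Set.Icc 1 n := ⟨hj.1.trans h1, h2.le.trans hm.2⟩
      refine ⟨hi, hg hj hi h1, lt_of_le_of_ne (hg hi hm h2.le) fun h => ?_⟩
      have := hm' i hi h
      omega
  rw [this, Nat.card_Ico] at hcard
  omega

lemma le_iff_le_of_monotoneOn {g : ℕ → ℝ} (hg : MonotoneOn g (Set.Ici 1)) {j : ℕ} (hj : 1 ≤ j)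
    (hj' : ∀ i, 1 ≤ i → g i = g j → i = j) (i : ℕ) (hi : 1 ≤ i) : g i ≤ g j ↔ i ≤ j := by
  constructor
  · intro h
    by_contra hc
    have := hg hj hi (not_le.1 hc).le
    have := hj' i hi (le_antisymm h this)
    omega
  · exact fun h => hg hi hj h

/-! ### The annulus near z compared with the strip: the k-th predecessor. -/

section

variable {k : ℕ} {R δ : ℝ} {z : ℂ}

lemma annulusShort_near (hδ : 0 < δ) (hz : z ≠ 0) (hbig : 8 * (2 * k + 6) ^ 2 ≤ δ * ‖z‖)
    (hδ1 : δ ≤ 1) {p : ℤ × ℤ} (hp : p ∈ nbhd k) :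
    |annulusShort R z p - shortCoord (‖z‖ - R) (z / (‖z‖ : ℂ)) p| < δ := by
  have hn : 0 < ‖z‖ := norm_pos_iff.2 hz
  have hk : (0 : ℝ) ≤ k := Nat.cast_nonneg k
  rw [nbhd, mem_ballPts] at hp
  have hzbig : 8 * (2 * (k : ℝ) + 6) ^ 2 ≤ ‖z‖ := hbig.trans (by nlinarith)
  have h1 := abs_norm_add_sub_le hz (y := pt p) (by nlinarith)
  have e : annulusShort R z p - shortCoord (‖z‖ - R) (z / (‖z‖ : ℂ)) p =
      ‖z + pt p‖ - ‖z‖ - (conj (z / (‖z‖ : ℂ)) * pt p).re := by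
    unfold annulusShort shortCoord; ring
  rw [e]
  refine h1.trans_lt ?_
  rw [div_lt_iff₀ hn]
  have : ‖pt p‖ ^ 2 ≤ (2 * k + 5) ^ 2 := pow_le_pow_left₀ (norm_nonneg _) hp 2
  nlinarith

lemma annulusLong_near (hz : z ≠ 0) (hbig : 8 * (2 * k + 6) ^ 2 ≤ δ * ‖z‖)
    (hδ1 : δ ≤ 1) {p : ℤ × ℤ} (hp : p ∈ nbhd k) :
    |annulusLong z p - longCoord (z / (‖z‖ : ℂ)) p| < δ / 2 := by
  have hn : 0 < ‖z‖ := norm_pos_iff.2 hz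
  have hk : (0 : ℝ) ≤ k := Nat.cast_nonneg k
  rw [nbhd, mem_ballPts] at hp
  have hzbig : 8 * (2 * (k : ℝ) + 6) ^ 2 ≤ ‖z‖ := hbig.trans (by nlinarith)
  have ht := (abs_longCoord_le (norm_dir hz) p).trans hp
  unfold annulusLong
  set u := z / (‖z‖ : ℂ) with hu
  set a := (conj u * pt p).re with ha
  have hap : |a| ≤ 2 * k + 5 := by
    refine ((Complex.abs_re_le_norm _).trans ?_).trans hp
    rw [norm_mul, RCLike.norm_conj, norm_dir hz, one_mul]
  have hX : ‖z‖ / 2 ≤ ‖z‖ + a := by nlinarith [(abs_le.1 hap).1]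
  have hX0 : 0 < ‖z‖ + a := by linarith
  have e : ‖z‖ * longCoord u p / (‖z‖ + a) - longCoord u p =
      -(longCoord u p * a) / (‖z‖ + a) := by
    field_simp; ring
  rw [e, abs_div, abs_neg, abs_mul, abs_of_pos hX0, div_lt_iff₀ hX0]
  have h1 : |longCoord u p| * |a| ≤ (2 * k + 5) * (2 * k + 5) := by gcongr
  have hδ0 : 0 ≤ δ := by
    by_contra h
    have : δ * ‖z‖ < 0 := mul_neg_of_neg_of_pos (not_le.1 h) hn
    nlinarith
  nlinarith [mul_le_mul_of_nonneg_left hX hδ0]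

lemma abs_argument_shift_le (hz : z ≠ 0) (hbig : 8 * (2 * k + 6) ^ 2 ≤ δ * ‖z‖)
    (hδ1 : δ ≤ 1) {p : ℤ × ℤ} (hp : p ∈ nbhd k) :
    |Real.arctan (annulusLong z p / ‖z‖)| < δ := by
  have hn : 0 < ‖z‖ := norm_pos_iff.2 hz
  have hk : (0 : ℝ) ≤ k := Nat.cast_nonneg k
  have h1 := annulusLong_near hz hbig hδ1 hp
  rw [nbhd, mem_ballPts] at hp
  have ht := (abs_longCoord_le (norm_dir hz) p).trans hp
  refine (abs_arctan_le _).trans_lt ?_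
  rw [abs_div, abs_norm, div_lt_iff₀ hn]
  have h2 := abs_lt.1 h1
  have h3 := abs_le.1 ht
  have : |annulusLong z p| ≤ 2 * k + 6 := abs_le.2 ⟨by linarith, by linarith⟩
  nlinarith

/-- The long coordinate of (1, 0) is the sine of the argument; hence z is at angle at least δ from
the positive real axis, and its neighbours do not wrap around. -/
lemma argument_bounds (hz : z ≠ 0) (hd : δ ≤ degeneracy k (‖z‖ - R, z / (‖z‖ : ℂ))) :
    δ ≤ argument z ∧ argument z ≤ 2 * Real.pi - δ := by
  have h1 : ((1, 0) : ℤ × ℤ) ∈ nbhdDiff k := by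
    rw [nbhdDiff, mem_ballPts]
    have : pt (1, 0) = 1 := by simp [pt]
    rw [this, norm_one]
    have hk : (0 : ℝ) ≤ k := Nat.cast_nonneg k
    linarith
  have h2 := hd.trans (degeneracy_le_long _ h1 (by simp))
  have h3 : longCoord (z / (‖z‖ : ℂ)) (1, 0) = Real.sin (argument z) := by
    rw [dir_eq_exp_argument hz]
    simp [longCoord]
  rw [h3] at h2
  have ha := argument_mem z
  constructor
  · have := Real.abs_sin_le_abs (x := argument z)
    rw [abs_of_nonneg ha.1] at this
    linarith
  · have := Real.abs_sin_le_abs (x := 2 * Real.pi - argument z)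
    rw [Real.sin_two_pi_sub, abs_neg,
      abs_of_pos (show 0 < 2 * Real.pi - argument z by linarith [ha.2])] at this
    linarith

lemma argument_neighbour (hδ : 0 < δ) (hz : z ≠ 0) (hbig : 8 * (2 * k + 6) ^ 2 ≤ δ * ‖z‖)
    (hδ1 : δ ≤ 1) (hd : δ ≤ degeneracy k (‖z‖ - R, z / (‖z‖ : ℂ))) {p : ℤ × ℤ} (hp : p ∈ nbhd k) :
    argument (z + pt p) = argument z - Real.arctan (annulusLong z p / ‖z‖) := by
  have h1 := abs_lt.1 (abs_argument_shift_le hz hbig hδ1 hp)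
  have h2 := argument_bounds hz hd
  refine argument_add hz ?_ ⟨by linarith, by linarith⟩
  rw [nbhd, mem_ballPts] at hp
  have hk : (0 : ℝ) ≤ k := Nat.cast_nonneg k
  nlinarith [norm_nonneg z]

/-- Long coordinates grow as arguments decrease, so strip order counts predecessors. The index m +
k(K - 1) is m - k modulo K, written without subtracting k. -/
lemma apply_eq_add_kth (hk : 1 ≤ k) {lam : ℕ → ℂ} (hlam : IsArgOrdering R lam) (hδ : 0 < δ)
    {m : ℕ} (hm : m ∈ Set.Icc 1 (K R)) (hz : lam m ≠ 0)
    (hbig : 8 * (2 * k + 6) ^ 2 ≤ δ * ‖lam m‖)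
    (hd : δ ≤ degeneracy k (‖lam m‖ - R, lam m / (‖lam m‖ : ℂ))) :
    lam (m + k * (K R - 1)) =
      lam m + pt (kth k (‖lam m‖ - R, lam m / (‖lam m‖ : ℂ))) := by
  classical
  have hzG := hlam.bijOn.mapsTo hm
  set z := lam m with hzdef
  set x : ℝ × ℂ := (‖z‖ - R, z / (‖z‖ : ℂ)) with hx
  obtain ⟨c, hc⟩ := mem_lattice_iff.1 hzG.1
  have hn : 0 < ‖z‖ := norm_pos_iff.2 hz
  have hw := inv_sqrt_two_lt_one
  have hs : |‖z‖ - R| < 1 / √2 := by rw [← hc] at hzG ⊢; exact mem_Gam_iff.1 hzG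
  have hδ1 : δ ≤ 1 := by
    have h1 := hd.trans (degeneracy_le_short x (nbhd_subset k (zero_mem_nbhd k)))
    rw [shortCoord_zero, abs_of_neg (sub_neg.2 hs)] at h1
    linarith [abs_nonneg (‖z‖ - R)]
  have hd0 : 0 < degeneracy k x := hδ.trans_le hd
  obtain ⟨p₀, hp₀, hp₀le⟩ := exists_isKth hk (norm_dir hz) hs hd0
  rw [kth_eq hd0 hp₀]
  have hsep := separated_degeneracy k x hd
  have hS : ∀ p ∈ nbhd k, |annulusShort R z p - shortCoord x.1 x.2 p| < δ :=
    fun p hp => annulusShort_near hδ hz hbig hδ1 hp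
  have hL : ∀ p ∈ nbhd k, |annulusLong z p - longCoord x.2 p| < δ / 2 :=
    fun p hp => annulusLong_near hz hbig hδ1 hp
  have hK : IsKth k (nbhd k) (annulusShort R z) (annulusLong z) p₀ :=
    (hsep.isKth_iff hδ (zero_mem_nbhd k) (longCoord_zero _) (annulusLong_zero z) hS hL p₀).2 hp₀
  obtain ⟨hp₀N, hp₀pos, hp₀s⟩ := mem_window.1 hK.1
  have harg : ∀ p ∈ nbhd k, argument (z + pt p) =
      argument z - Real.arctan (annulusLong z p / ‖z‖) :=
    fun p hp => argument_neighbour hδ hz hbig hδ1 hd hp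
  have hord : ∀ p ∈ nbhd k, ∀ p' ∈ nbhd k,
      (argument (z + pt p) ≤ argument (z + pt p') ↔ annulusLong z p' ≤ annulusLong z p) := by
    intro p hp p' hp'
    rw [harg p hp, harg p' hp', sub_le_sub_iff_left, Real.arctan_le_arctan_iff,
      div_le_div_iff_of_pos_right hn]
  have hinj : ∀ p ∈ nbhd k, ∀ p' ∈ nbhd k, argument (z + pt p) = argument (z + pt p') → p = p' := by
    intro p hp p' hp' e
    by_contra hne
    have h1 := hsep.long p hp p' hp' hne
    have h2 : annulusLong z p = annulusLong z p' :=
      le_antisymm ((hord p' hp' p hp).1 e.ge) ((hord p hp p' hp').1 e.le)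
    have h3 := abs_lt.1 (hL p hp)
    have h4 := abs_lt.1 (hL p' hp')
    rcases le_abs.1 h1 with h | h <;> linarith
  have hz0 : z + pt 0 = z := by simp
  have hGam : ∀ p, z + pt p ∈ Gam R ↔ |annulusShort R z p| < 1 / √2 := by
    intro p
    rw [← hc, ← pt_add, mem_Gam_iff, annulusShort, ← pt_add]
  have hT : annulusLong z p₀ ≤ 2 * k + 2 := by
    have := abs_lt.1 (hL p₀ hp₀N)
    linarith
  -- No competitor escapes the finite neighbourhood: the norms differ by at most 2 and the arc is at
  -- most 2k + 2, while `nbhd k` has radius 2k + 5.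
  have hmem : ∀ y ∈ Gam R, argument (z + pt p₀) ≤ argument y → argument y ≤ argument z →
      ∃ p ∈ nbhd k, z + pt p = y := by
    intro y hy h1 h2
    obtain ⟨c', hc'⟩ := mem_lattice_iff.1 hy.1
    refine ⟨c' - c, ?_, by rw [pt_sub, hc, hc']; ring⟩
    have hs' : |‖y‖ - R| < 1 / √2 := by rw [← hc'] at hy ⊢; exact mem_Gam_iff.1 hy
    rw [nbhd, mem_ballPts, pt_sub, hc, hc']
    refine norm_sub_le_of_argument.trans ?_
    have h3 : |‖y‖ - ‖z‖| ≤ 2 := by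
      have a1 := abs_lt.1 hs
      have a2 := abs_lt.1 hs'
      exact abs_le.2 ⟨by linarith, by linarith⟩
    have h4 : |argument y - argument z| ≤ annulusLong z p₀ / ‖z‖ := by
      rw [harg p₀ hp₀N] at h1
      have h5 := (le_abs_self _).trans (abs_arctan_le (annulusLong z p₀ / ‖z‖))
      rw [abs_of_pos (div_pos hp₀pos hn)] at h5
      rw [abs_of_nonpos (by linarith)]
      linarith
    have h6 : ‖z‖ * |argument y - argument z| ≤ annulusLong z p₀ := by
      rw [le_div_iff₀ hn] at h4
      linarith
    linarith
  have hpos : ∀ p ∈ nbhd k, (0 < annulusLong z p ↔ argument (z + pt p) < argument z) := by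
    intro p hp
    have := hord 0 (zero_mem_nbhd k) p hp
    rw [hz0, annulusLong_zero] at this
    rw [← not_le, ← not_le, this]
  obtain ⟨j, hj, hjz⟩ := hlam.bijOn.surjOn ((hGam p₀).2 hp₀s)
  have harg0 : argument (z + pt p₀) < argument z := (hpos p₀ hp₀N).1 hp₀pos
  have hjm : j + k = m := by
    refine add_eq_of_card_filter hlam.sorted hk hj hm ?_ ?_ ?_
    · intro i hi e
      obtain ⟨p, hp, hpy⟩ := hmem (lam i) (hlam.bijOn.mapsTo hi) (by rw [e]; exact harg0.le) e.le
      have : p = 0 := hinj p hp 0 (zero_mem_nbhd k) (by rw [hpy, hz0]; exact e)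
      refine hlam.bijOn.injOn hi hm ?_
      rw [← hpy, this, hz0]
    · intro i hi e
      simp only [hjz] at e
      obtain ⟨p, hp, hpy⟩ := hmem (lam i) (hlam.bijOn.mapsTo hi) e.ge (by rw [e]; exact harg0.le)
      have : p = p₀ := hinj p hp p₀ hp₀N (by rw [hpy]; exact e)
      refine hlam.bijOn.injOn hi hj ?_
      rw [← hpy, this, hjz]
    -- The indices with argument in [arg(z + p₀), arg z) correspond to the window points up to p₀,
    -- of which there are k: p₀ is counted and z is not.
    · rw [← hK.2, ← Finset.card_image_of_injOn (f := lam), ← Finset.card_image_of_injOn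
        (f := fun p => z + pt p) (s := Finset.filter _ (window _ _ _))]
      · congr 1
        ext y
        simp only [Finset.mem_image, Finset.mem_filter, Finset.mem_Icc, mem_window, hjz]
        constructor
        · rintro ⟨i, ⟨hi, h1, h2⟩, rfl⟩
          have hG := hlam.bijOn.mapsTo hi
          obtain ⟨p, hp, hpy⟩ := hmem (lam i) hG h1 h2.le
          rw [← hpy] at h1 h2 hG
          exact ⟨p, ⟨⟨hp, (hpos p hp).2 h2, (hGam p).1 hG⟩, (hord p₀ hp₀N p hp).1 h1⟩, hpy⟩
        · rintro ⟨p, ⟨⟨hp, h1, h2⟩, h3⟩, rfl⟩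
          obtain ⟨i, hi, hiz⟩ := hlam.bijOn.surjOn ((hGam p).2 h2)
          refine ⟨i, ⟨hi, ?_, ?_⟩, hiz⟩
          · rw [hiz]; exact (hord p₀ hp₀N p hp).2 h3
          · rw [hiz]; exact (hpos p hp).1 h1
      · intro p _ p' _ e
        exact pt_injective (add_left_cancel e)
      · intro i hi i' hi' e
        refine hlam.bijOn.injOn ?_ ?_ e
        · exact Finset.mem_Icc.1 (Finset.mem_filter.1 hi).1
        · exact Finset.mem_Icc.1 (Finset.mem_filter.1 hi').1
  have hK1 : 1 ≤ K R := hm.1.trans hm.2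
  have e : m + k * (K R - 1) = j + k * K R := by
    obtain ⟨n, hn⟩ : ∃ n, K R = n + 1 := ⟨K R - 1, by omega⟩
    rw [hn, ← hjm]; simp; ring
  rw [e, hlam.periodic_mul, hjz]

end

/-! ### Averages over the ordered lattice points of the annulus -/

lemma finite_Gam (R : ℝ) : (Gam R).Finite := by
  refine ((ballPts (R + 1 / √2)).finite_toSet.image pt).subset fun z hz => ?_
  obtain ⟨p, rfl⟩ := mem_lattice_iff.1 hz.1
  exact ⟨p, by simpa using hz.2.2.le, rfl⟩

lemma exists_isArgOrdering (R : ℝ) : ∃ lam, IsArgOrdering R lam := by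
  classical
  have hfin := finite_Gam R
  rcases Nat.eq_zero_or_pos (K R) with h0 | hpos
  · have hG : Gam R = ∅ := (Set.ncard_eq_zero hfin).1 h0
    refine ⟨fun _ => 0, ?_, ?_, fun _ => rfl⟩
    · rw [hG, h0]; simp
    · rw [h0]; intro j hj; simp at hj
  · have : Finite (Gam R) := hfin
    set e : Fin (K R) ≃ Gam R := (Finite.equivFinOfCardEq (by rw [Nat.card_coe_set_eq]; rfl)).symm
    set f : Fin (K R) → ℝ := fun i => argument (e i) with hf
    set σ := Tuple.sort f
    have hσ : Monotone (f ∘ σ) := Tuple.monotone_sort f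
    -- Adding K before subtracting 1 avoids truncation at j = 0; the value is j - 1 for 1 ≤ j ≤ K
    -- and is periodic in j.
    set ix : ℕ → Fin (K R) := fun j => ⟨(j + K R - 1) % K R, Nat.mod_lt _ hpos⟩ with hix
    have hixv : ∀ j ∈ Set.Icc 1 (K R), (ix j : ℕ) = j - 1 := by
      intro j hj
      have h1 := hj.1
      have h2 := hj.2
      simp only [hix]
      rw [show j + K R - 1 = (j - 1) + K R by omega, Nat.add_mod_right, Nat.mod_eq_of_lt]
      omega
    refine ⟨fun j => e (σ (ix j)), ⟨?_, ?_, ?_⟩, ?_, ?_⟩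
    · intro j _; exact (e (σ (ix j))).2
    · intro j hj j' hj' h
      have h1 := σ.injective (e.injective (Subtype.ext h))
      have h2 := congrArg Fin.val h1
      rw [hixv j hj, hixv j' hj'] at h2
      have := hj.1
      have := hj'.1
      omega
    · intro z hz
      set i := σ.symm (e.symm ⟨z, hz⟩) with hi
      have hm : (i : ℕ) + 1 ∈ Set.Icc 1 (K R) := ⟨by omega, i.2⟩
      refine ⟨i + 1, hm, ?_⟩
      have : ix (i + 1) = i := Fin.ext (by rw [hixv _ hm]; rfl)
      simp only [this]
      simp [hi]
    · intro j hj j' hj' hle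
      refine hσ ?_
      rw [Fin.le_def, hixv j hj, hixv j' hj']
      omega
    · intro j
      have : ix (j + K R) = ix j := by
        refine Fin.ext ?_
        simp only [hix]
        rw [show j + K R + K R - 1 = (j + K R - 1) + K R by omega, Nat.add_mod_right]
      simp only [this]

lemma sum_Icc_one_eq (f : ℕ → ℝ) (n : ℕ) :
    ∑ j ∈ Finset.Icc 1 n, f j = ∑ i ∈ Finset.range n, f (i + 1) := by
  induction n with
  | zero => simp
  | succ n ih => rw [Finset.sum_Icc_succ_top (by omega), ih, Finset.sum_range_succ]

lemma sum_Icc_add_of_periodic {f : ℕ → ℝ} {n : ℕ} (hf : ∀ j, f (j + n) = f j) (k : ℕ) :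
    ∑ j ∈ Finset.Icc 1 n, f (j + k) = ∑ j ∈ Finset.Icc 1 n, f j := by
  induction k with
  | zero => simp
  | succ k ih =>
    rw [← ih, sum_Icc_one_eq, sum_Icc_one_eq]
    have h1 := Finset.sum_range_succ (fun i => f (i + (k + 1))) n
    have h2 := Finset.sum_range_succ' (fun i => f (i + (k + 1))) n
    have h3 : f (n + (k + 1)) = f (0 + (k + 1)) := by rw [add_comm, hf, zero_add]
    have hshift : ∀ i, f (i + 1 + k) = f (i + (k + 1)) := fun i => by congr 1; ring
    simp only [hshift]
    linarith

lemma tsum_indicator_Gam {R : ℝ} {lam : ℕ → ℂ} (hlam : IsArgOrdering R lam) (F : ℂ → ℝ) :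
    ∑' p, (Gam R).indicator F (pt p) = ∑ j ∈ Finset.Icc 1 (K R), F (lam j) := by
  classical
  set A := (ballPts (R + 1 + 2)).filter (fun p => pt p ∈ Gam R) with hA
  have hmem : ∀ p, pt p ∈ Gam R → p ∈ A := fun p hp => Finset.mem_filter.2
    ⟨mem_ballPts_of_near (w := 0) (by simp)
      (by simpa using ((mem_Gam_iff.1 hp).trans inv_sqrt_two_lt_one).le), hp⟩
  rw [tsum_eq_sum (s := A) (fun p hp => Set.indicator_of_notMem (fun h => hp (hmem p h)) _)]
  have e1 : ∑ p ∈ A, (Gam R).indicator F (pt p) = ∑ p ∈ A, F (pt p) :=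
    Finset.sum_congr rfl fun p hp => Set.indicator_of_mem (Finset.mem_filter.1 hp).2 _
  rw [e1, ← Finset.sum_image (f := F) (g := pt) (fun p _ q _ h => pt_injective h),
    ← Finset.sum_image (f := F) (g := lam)]
  · refine Finset.sum_congr ?_ fun _ _ => rfl
    ext y
    simp only [Finset.mem_image, Finset.mem_Icc]
    constructor
    · rintro ⟨p, hp, rfl⟩
      exact hlam.bijOn.surjOn (Finset.mem_filter.1 hp).2
    · rintro ⟨j, hj, rfl⟩
      have hG := hlam.bijOn.mapsTo hj
      obtain ⟨p, hp⟩ := mem_lattice_iff.1 hG.1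
      exact ⟨p, hmem p (by rw [hp]; exact hG), hp⟩
  · intro i hi j hj h
    exact hlam.bijOn.injOn (Finset.mem_Icc.1 (Finset.mem_coe.1 hi))
      (Finset.mem_Icc.1 (Finset.mem_coe.1 hj)) h

/-- The limit does not mention `lam`, which is the independence of tie-breaking. The case Ψ = 1
counts Γ_R, and the coordinate functions give the marginals. -/
theorem tendsto_ordered_sum {k : ℕ} (hk : 1 ≤ k) {Ψ : ℝ → ℝ → ℝ} (hΨ : Admissible Ψ)
    {lam : ℝ → ℕ → ℂ} (hlam : ∀ R : ℝ, 0 < R → IsArgOrdering R (lam R)) :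
    Tendsto (fun R : ℝ => (1 / R) * ∑ j ∈ Finset.Icc 1 (K R),
      Ψ (areaInDisc R (lam R j)) (areaInDisc R (lam R (j + k * (K R - 1))))) atTop
      (𝓝 (∫ x in angleStrip, localFun Ψ k (x.1, Complex.exp (x.2 * Complex.I)))) := by
  -- Equidistribution sums over points, so the index of a point is recovered by `invFunOn`.
  set F : ℝ → ℂ → ℝ := fun R z => Ψ (areaInDisc R z) (areaInDisc R
    (lam R (Function.invFunOn (lam R) (Set.Icc 1 (K R)) z + k * (K R - 1)))) with hF
  have hk0 : (0 : ℝ) ≤ k := Nat.cast_nonneg k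
  have key := tendsto_sum_Gam (continuous_degeneracy k) (degeneracy_nonneg k) (ae_degeneracy_pos k)
    (abs_localFun_le hΨ k) (fun s u hs => localFun_eq_zero Ψ k u hs)
    (fun x hx hd => continuousAt_localFun hΨ hx hd) (F := F)
    (fun R z => hΨ.bound _ _ (abs_areaInDisc_le_one _ _) (abs_areaInDisc_le_one _ _)) ?_
  · refine key.congr' ?_
    filter_upwards [eventually_gt_atTop 0] with R hR
    rw [tsum_indicator_Gam (hlam R hR)]
    congr 1
    refine Finset.sum_congr rfl fun j hj => ?_
    simp only [hF]
    rw [(hlam R hR).bijOn.injOn.leftInvOn_invFunOn (Finset.mem_Icc.1 hj)]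
  · intro δ hδ
    filter_upwards [eventually_gt_atTop (8 * (2 * (k : ℝ) + 6) ^ 2 / δ + 1),
      eventually_gt_atTop (8 * (2 * (k : ℝ) + 6) ^ 2 + 1)] with R hR hR' z hz hd
    have hR0 : 0 < R := by nlinarith
    obtain ⟨m, hm, hmz⟩ := (hlam R hR0).bijOn.surjOn hz
    have hw := inv_sqrt_two_lt_one
    have hs : |‖z‖ - R| < 1 / √2 := by
      obtain ⟨c, rfl⟩ := mem_lattice_iff.1 hz.1
      exact mem_Gam_iff.1 hz
    have hzR : R - 1 < ‖z‖ := by linarith [(abs_lt.1 hs).1]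
    have hn : 0 < ‖z‖ := by nlinarith
    have hz0 : z ≠ 0 := norm_pos_iff.1 hn
    have hbig : 8 * (2 * (k : ℝ) + 6) ^ 2 ≤ δ * ‖z‖ := by
      have : 8 * (2 * (k : ℝ) + 6) ^ 2 / δ ≤ ‖z‖ := by linarith
      rw [div_le_iff₀ hδ] at this
      linarith
    have hpred := apply_eq_add_kth hk (hlam R hR0) hδ hm (by rwa [hmz]) (by rwa [hmz])
      (by rwa [hmz])
    have hidx : Function.invFunOn (lam R) (Set.Icc 1 (K R)) z = m := by
      rw [← hmz]; exact (hlam R hR0).bijOn.injOn.leftInvOn_invFunOn hm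
    rw [hmz] at hpred
    obtain ⟨p, hp, -⟩ := exists_isKth hk (norm_dir hz0) hs (hδ.trans_le hd)
    have hkth := kth_eq (hδ.trans_le hd) hp
    have hpN := (mem_window.1 hp.1).1
    rw [nbhd, mem_ballPts] at hpN
    simp only [hF]
    rw [hidx, hpred, localFun, if_pos hs, hkth]
    refine (hΨ.lipschitz _ _ _ _ (abs_areaInDisc_le_one _ _) (abs_halfArea_le_one _ _)).trans ?_
    have hC : 2 * ((2 * (k : ℝ) + 5) + 1) ≤ ‖z‖ := by nlinarith
    have a1 := abs_areaInDisc_sub_halfArea_le R (h := 0) (C := 2 * (k : ℝ) + 5)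
      (by rw [norm_zero]; positivity) hz0 hC
    have a2 := abs_areaInDisc_sub_halfArea_le R hpN hz0 hC
    rw [add_zero, mul_zero, Complex.zero_re, add_zero] at a1
    have hb : 4 * ((2 * (k : ℝ) + 5 + 1) ^ 2 / ‖z‖) ≤ δ / 2 := by
      rw [mul_div_assoc', div_le_iff₀ hn]
      nlinarith
    unfold shortCoord
    simp only at a1 a2 ⊢
    linarith

/-! ### The random strip -/

/-- The short direction of the strip tilted by `θ`. -/
def stripNormal (θ : ℝ) : ℂ := Complex.I * Complex.exp (θ * Complex.I)

lemma norm_stripNormal (θ : ℝ) : ‖stripNormal θ‖ = 1 := by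
  rw [stripNormal, norm_mul, Complex.norm_I, one_mul, norm_exp_I]

lemma stripNormal_eq (θ : ℝ) :
    stripNormal θ = Complex.exp (((θ + Real.pi / 2 : ℝ) : ℂ) * Complex.I) := by
  rw [stripNormal]
  push_cast
  rw [add_mul, Complex.exp_add, Complex.exp_pi_div_two_mul_I, mul_comm]

lemma P_eq (r θ : ℝ) (w : ℂ) :
    P r θ w = Complex.exp (-(θ * Complex.I)) * w + r * Complex.I := by
  have h : Complex.exp (-(θ * Complex.I)) * Complex.exp (θ * Complex.I) = 1 := by
    rw [← Complex.exp_add, neg_add_cancel, Complex.exp_zero]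
  rw [P, T, ← stripNormal_eq, stripNormal]
  push_cast
  rw [neg_mul, mul_add]
  linear_combination (r * Complex.I) * h

lemma conj_stripNormal (θ : ℝ) :
    conj (stripNormal θ) = -Complex.I * Complex.exp (-(θ * Complex.I)) := by
  rw [stripNormal, map_mul, Complex.conj_I, ← Complex.exp_conj]
  simp

lemma P_re (r θ : ℝ) (p : ℤ × ℤ) : (P r θ (pt p)).re = longCoord (stripNormal θ) p := by
  rw [P_eq, longCoord, conj_stripNormal]
  simp
  ring

lemma P_im (r θ : ℝ) (p : ℤ × ℤ) : (P r θ (pt p)).im = shortCoord r (stripNormal θ) p := by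
  rw [P_eq, shortCoord, conj_stripNormal]
  simp
  ring

lemma Q_P (r θ : ℝ) (w : ℂ) : Q r θ (P r θ w) = w := by
  have h : Complex.exp (θ * Complex.I) * Complex.exp (-(θ * Complex.I)) = 1 := by
    rw [← Complex.exp_add, add_neg_cancel, Complex.exp_zero]
  rw [P_eq, Q, T, ← stripNormal_eq, stripNormal]
  linear_combination w * h

lemma P_Q (r θ : ℝ) (z : ℂ) : P r θ (Q r θ z) = z := by
  have h : Complex.exp (-(θ * Complex.I)) * Complex.exp (θ * Complex.I) = 1 := by
    rw [← Complex.exp_add, neg_add_cancel, Complex.exp_zero]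
  rw [P_eq, Q, T, ← stripNormal_eq, stripNormal]
  linear_combination (z - r * Complex.I) * h

lemma pt_mem_strip_iff (r θ : ℝ) (p : ℤ × ℤ) :
    pt p ∈ strip r θ ↔ 0 ≤ longCoord (stripNormal θ) p ∧
      |shortCoord r (stripNormal θ) p| ≤ 1 / √2 := by
  have : pt p ∈ strip r θ ↔ P r θ (pt p) ∈ straightStrip := by
    constructor
    · rintro ⟨z, hz, h⟩
      rwa [← h, P_Q]
    · exact fun h => ⟨_, h, Q_P r θ _⟩
  rw [this, straightStrip, Complex.mem_reProdIm, P_re, P_im, Set.mem_Ici, Set.mem_Icc, abs_le]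

/-- The strip is closed and `window` is open, but without degeneracy no relevant lattice point lies
on an edge, and none but the origin on the end. Hence the first k points of both lists agree. -/
lemma kap_eq_kth {k : ℕ} (hk : 1 ≤ k) {r θ : ℝ} {kap : ℕ → ℂ} (hkap : IsStripOrdering r θ kap)
    (hr : |r| < 1 / √2) (hd : 0 < degeneracy k (r, stripNormal θ)) :
    kap k = pt (kth k (r, stripNormal θ)) := by
  classical
  set u := stripNormal θ with hu
  obtain ⟨p₀, hp₀, hp₀le⟩ := exists_isKth hk (norm_stripNormal θ) hr hd
  rw [kth_eq hd hp₀]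
  have hsep := separated_degeneracy k (r, u) le_rfl
  obtain ⟨hp₀N, hp₀pos, hp₀s⟩ := mem_window.1 hp₀.1
  have hw := inv_sqrt_two_lt_one
  have hne0 : ∀ p, 0 < longCoord u p → p ≠ 0 := by
    rintro p h rfl
    rw [longCoord_zero] at h
    exact lt_irrefl _ h
  have hmem : ∀ p, 0 < longCoord u p → |shortCoord r u p| < 1 / √2 →
      pt p ∈ (strip r θ ∩ lattice) \ {0} := by
    intro p h1 h2
    refine ⟨⟨(pt_mem_strip_iff r θ p).2 ⟨h1.le, h2.le⟩, mem_lattice_iff.2 ⟨p, rfl⟩⟩, ?_⟩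
    intro h
    exact hne0 p h1 (pt_injective (by rw [pt_zero]; exact h))
  -- Points listed no later than p₀ have norm below 2k + 5, so the infinite list is compared with a
  -- finite set.
  have hpoint : ∀ l, 1 ≤ l → (P r θ (kap l)).re ≤ longCoord u p₀ →
      ∃ p, pt p = kap l ∧ p ∈ window (nbhd k) (shortCoord r u) (longCoord u) := by
    intro l hl hle
    obtain ⟨⟨h1, h2⟩, h3⟩ := hkap.bijOn.mapsTo hl
    obtain ⟨p, hp⟩ := mem_lattice_iff.1 h2
    rw [← hp] at h1 h3 hle
    rw [P_re] at hle
    rw [pt_mem_strip_iff] at h1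
    have hN : p ∈ nbhd k := by
      rw [nbhd, mem_ballPts]
      refine (norm_pt_le (norm_stripNormal θ) r p).trans ?_
      have h4 : |longCoord u p| ≤ 2 * k + 1 := by rw [abs_of_nonneg h1.1]; exact hle.trans hp₀le
      have := h1.2
      linarith
    refine ⟨p, hp, mem_window.2 ⟨hN, ?_, ?_⟩⟩
    · refine lt_of_le_of_ne h1.1 fun h => ?_
      have hpne : p ≠ 0 := by rintro rfl; exact h3 pt_zero
      have := hsep.long p hN 0 (zero_mem_nbhd k) hpne
      simp only at this
      rw [longCoord_zero, ← h, sub_zero, abs_zero] at this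
      linarith
    · refine lt_of_le_of_ne h1.2 fun h => ?_
      have := hsep.short p hN
      simp only at this
      rw [h, sub_self, abs_zero] at this
      linarith
  obtain ⟨l₀, hl₀, hl₀p⟩ := hkap.bijOn.surjOn (hmem p₀ hp₀pos hp₀s)
  have hl₀1 : 1 ≤ l₀ := hl₀
  have hval : (P r θ (kap l₀)).re = longCoord u p₀ := by rw [hl₀p, P_re]
  have huniq : ∀ i, 1 ≤ i → (P r θ (kap i)).re = (P r θ (kap l₀)).re → i = l₀ := by
    intro i hi h
    rw [hval] at h
    obtain ⟨p, hp, hpw⟩ := hpoint i hi h.le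
    rw [← hp, P_re] at h
    have : p = p₀ := hsep.injOn hd hpw hp₀.1 h
    refine hkap.bijOn.injOn hi hl₀ ?_
    rw [← hp, this, hl₀p]
  have hiff := le_iff_le_of_monotoneOn hkap.sorted hl₀1 huniq
  have hcard : l₀ = k := by
    have : (Finset.Icc 1 l₀).image kap =
        ((window (nbhd k) (shortCoord r u) (longCoord u)).filter
          (fun x => longCoord u x ≤ longCoord u p₀)).image pt := by
      ext y
      simp only [Finset.mem_image, Finset.mem_Icc, Finset.mem_filter]
      constructor
      · rintro ⟨i, ⟨hi, hil⟩, rfl⟩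
        have hle := (hiff i hi).2 hil
        rw [hval] at hle
        obtain ⟨p, hp, hpw⟩ := hpoint i hi hle
        rw [← hp, P_re] at hle
        exact ⟨p, ⟨hpw, hle⟩, hp⟩
      · rintro ⟨p, ⟨hpw, hle⟩, rfl⟩
        obtain ⟨-, h1, h2⟩ := mem_window.1 hpw
        obtain ⟨i, hi, hip⟩ := hkap.bijOn.surjOn (hmem p h1 h2)
        refine ⟨i, ⟨hi, (hiff i hi).1 ?_⟩, hip⟩
        rw [hval, hip, P_re]
        exact hle
    have hc := congrArg Finset.card this
    rw [Finset.card_image_of_injective _ pt_injective, hp₀.2, Finset.card_image_of_injOn,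
      Nat.card_Icc] at hc
    · omega
    · intro i hi j hj h
      exact hkap.bijOn.injOn (Finset.mem_Icc.1 hi).1 (Finset.mem_Icc.1 hj).1 h
  rw [← hcard, hl₀p]

/-! ### Integrals over the rectangle `G` -/

lemma measurableSet_G : MeasurableSet G := measurableSet_Icc.prod measurableSet_Ico

lemma volume_G : volume G = ENNReal.ofReal (2 * (1 / √2)) * ENNReal.ofReal (2 * Real.pi) := by
  rw [G, Measure.volume_eq_prod, Measure.prod_prod, Real.volume_Icc, Real.volume_Ico]
  congr 2 <;> ring

lemma volume_real_G : volume.real G = 2 * (1 / √2) * (2 * Real.pi) := by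
  have := Real.pi_pos
  rw [measureReal_def, volume_G, ENNReal.toReal_mul, ENNReal.toReal_ofReal (by positivity),
    ENNReal.toReal_ofReal (by positivity)]

lemma volume_real_G_pos : 0 < volume.real G := by
  have := Real.pi_pos
  rw [volume_real_G]; positivity

lemma volume_G_ne_zero : volume G ≠ 0 := fun h => by
  have := volume_real_G_pos
  rw [measureReal_def, h] at this
  simp at this

lemma volume_G_ne_top : volume G ≠ ⊤ := by
  rw [volume_G]; exact ENNReal.mul_ne_top ENNReal.ofReal_ne_top ENNReal.ofReal_ne_top

instance : IsProbabilityMeasure unifG := by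
  have : IsFiniteMeasure (volume.restrict G) := ⟨by
    rw [Measure.restrict_apply_univ]; exact volume_G_ne_top.lt_top⟩
  exact ⟨by
    rw [unifG, ProbabilityTheory.cond, Measure.smul_apply, Measure.restrict_apply_univ, smul_eq_mul,
      ENNReal.inv_mul_cancel volume_G_ne_zero volume_G_ne_top]⟩

lemma integral_unifG (f : ℝ × ℝ → ℝ) :
    ∫ p, f p ∂unifG = (volume.real G)⁻¹ * ∫ p in G, f p := by
  rw [unifG, ProbabilityTheory.cond, integral_smul_measure, ENNReal.toReal_inv, smul_eq_mul,
    measureReal_def]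

lemma ae_unifG_of_ae {p : ℝ × ℝ → Prop} (h : ∀ᵐ x, p x) : ∀ᵐ x ∂unifG, x ∈ G ∧ p x := by
  have h1 : ∀ᵐ x ∂(volume.restrict G), x ∈ G ∧ p x :=
    (ae_restrict_mem measurableSet_G).and (ae_restrict_of_ae h)
  exact Measure.ae_smul_measure h1 _

lemma measurePreserving_quarter :
    MeasurePreserving (fun x : ℝ × ℝ => (x.1, x.2 + Real.pi / 2)) := by
  have := measurePreserving_add_right (volume : Measure (ℝ × ℝ)) ((0, Real.pi / 2) : ℝ × ℝ)
  have e : (fun x : ℝ × ℝ => (x.1, x.2 + Real.pi / 2)) = fun x => x + (0, Real.pi / 2) := by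
    ext x <;> simp
  rw [e]
  exact this

lemma ae_degeneracy_strip_pos (k : ℕ) :
    ∀ᵐ x : ℝ × ℝ, 0 < degeneracy k (x.1, stripNormal x.2) := by
  have := measurePreserving_quarter.quasiMeasurePreserving.ae (ae_degeneracy_pos k)
  simpa only [stripNormal_eq] using this

lemma aestronglyMeasurable_localFun {Ψ : ℝ → ℝ → ℝ} (hΨ : Admissible Ψ) (k : ℕ) :
    AEStronglyMeasurable fun x : ℝ × ℝ => localFun Ψ k (x.1, Complex.exp (x.2 * Complex.I)) :=
  aestronglyMeasurable_of_continuousAt (continuous_degeneracy k) (ae_degeneracy_pos k)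
    fun _ hx hd => continuousAt_localFun hΨ hx hd

lemma aestronglyMeasurable_localFun_strip {Ψ : ℝ → ℝ → ℝ} (hΨ : Admissible Ψ) (k : ℕ) :
    AEStronglyMeasurable fun x : ℝ × ℝ => localFun Ψ k (x.1, stripNormal x.2) := by
  have := (aestronglyMeasurable_localFun hΨ k).comp_measurePreserving measurePreserving_quarter
  refine this.congr (.of_forall fun x => ?_)
  simp only [Function.comp, stripNormal_eq]

lemma integrableOn_localFun {Ψ : ℝ → ℝ → ℝ} (hΨ : Admissible Ψ) (k : ℕ) :
    IntegrableOn (fun x : ℝ × ℝ => localFun Ψ k (x.1, Complex.exp (x.2 * Complex.I)))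
      angleStrip := by
  refine integrableOn_cutoff_bound.mono' (aestronglyMeasurable_localFun hΨ k).restrict
    (.of_forall fun x => ?_)
  by_cases hs : 1 / √2 ≤ |x.1|
  · rw [localFun_eq_zero _ _ _ hs, norm_zero]; exact le_max_left _ _
  · exact (abs_localFun_le hΨ k _).trans (le_trans (by linarith [inv_sqrt_two_lt_one])
      (le_max_right _ _))

lemma integrableOn_G_of_bound {f : ℝ × ℝ → ℝ} (hf : AEStronglyMeasurable f)
    (hb : ∀ x, |f x| ≤ 1) : IntegrableOn f G := by
  refine Measure.integrableOn_of_bounded (M := 1) volume_G_ne_top hf ?_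
  exact .of_forall hb

/-- The short direction is exp(i(θ + π/2)), so the angular integrals agree by periodicity; both
integrands vanish for |s| ≥ 1/√2. -/
lemma setIntegral_G_localFun {Ψ : ℝ → ℝ → ℝ} (hΨ : Admissible Ψ) (k : ℕ) :
    ∫ x in G, localFun Ψ k (x.1, stripNormal x.2) =
      ∫ x in angleStrip, localFun Ψ k (x.1, Complex.exp (x.2 * Complex.I)) := by
  have i1 := integrableOn_localFun hΨ k
  have i2 := integrableOn_G_of_bound (aestronglyMeasurable_localFun_strip hΨ k)
    fun x => abs_localFun_le hΨ k _
  have hpi := Real.pi_pos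
  have inner : ∀ s : ℝ, ∫ θ in Set.Ico 0 (2 * Real.pi), localFun Ψ k (s, stripNormal θ) =
      ∫ φ in Set.Ioo (-Real.pi) Real.pi, localFun Ψ k (s, Complex.exp (φ * Complex.I)) := by
    intro s
    set f : ℝ → ℝ := fun φ => localFun Ψ k (s, Complex.exp (φ * Complex.I)) with hf
    have hper : Function.Periodic f (2 * Real.pi) := by
      intro φ
      simp only [hf]
      congr 2
      push_cast
      rw [add_mul, Complex.exp_add, Complex.exp_two_pi_mul_I, mul_one]
    rw [integral_Ico_eq_integral_Ioc, ← intervalIntegral.integral_of_le (by positivity),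
      ← integral_Ioc_eq_integral_Ioo, ← intervalIntegral.integral_of_le (by linarith)]
    simp only [stripNormal_eq]
    rw [intervalIntegral.integral_comp_add_right f]
    have := hper.intervalIntegral_add_eq (0 + Real.pi / 2) (-Real.pi)
    rw [show 0 + Real.pi / 2 + 2 * Real.pi = 2 * Real.pi + Real.pi / 2 by ring,
      show -Real.pi + 2 * Real.pi = Real.pi by ring] at this
    exact this
  rw [G, angleStrip, Measure.volume_eq_prod, setIntegral_prod _ i2, setIntegral_prod _ i1]
  simp only [inner]
  rw [setIntegral_univ]
  refine setIntegral_eq_integral_of_forall_compl_eq_zero fun s hs => ?_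
  have hs' : 1 / √2 ≤ |s| := by
    by_contra h
    exact hs (abs_le.1 (not_le.1 h).le)
  simp only [localFun_eq_zero _ _ _ hs', integral_zero]

lemma X_eq (x : ℝ × ℝ) : X x = halfArea x.1 (stripNormal x.2) := areaInf_eq x.1 x.2

lemma aestronglyMeasurable_X : AEStronglyMeasurable X := by
  refine Continuous.aestronglyMeasurable (continuous_iff_continuousAt.2 fun x => ?_)
  have hc : Continuous fun x : ℝ × ℝ => (x.1, stripNormal x.2) := by
    unfold stripNormal; fun_prop
  have := ContinuousAt.comp (f := fun x : ℝ × ℝ => (x.1, stripNormal x.2))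
    (g := fun y : ℝ × ℂ => halfArea y.1 y.2) (x := x) (continuousAt_halfArea (norm_stripNormal _))
    hc.continuousAt
  refine this.congr (.of_forall fun y => ?_)
  exact (X_eq y).symm

lemma abs_X_le (x : ℝ × ℝ) : |X x| ≤ 1 := by rw [X_eq]; exact abs_halfArea_le_one _ _

lemma Y_eq (kap : ℝ → ℝ → ℕ → ℂ) (k : ℕ) (x : ℝ × ℝ) :
    Y kap k x = halfArea (rho kap k x.1 x.2) (stripNormal x.2) := areaInf_eq _ _

lemma abs_Y_le (kap : ℝ → ℝ → ℕ → ℂ) (k : ℕ) (x : ℝ × ℝ) : |Y kap k x| ≤ 1 := by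
  rw [Y_eq]; exact abs_halfArea_le_one _ _

/-- Besides computing expectations, this supplies the measurability of `Y`: `kap` is arbitrary, but
`Y` agrees almost everywhere with a measurable function. -/
lemma ae_comp_X_Y {k : ℕ} (hk : 1 ≤ k) {kap : ℝ → ℝ → ℕ → ℂ}
    (hkap : ∀ r θ : ℝ, (r, θ) ∈ G → IsStripOrdering r θ (kap r θ)) (Ψ : ℝ → ℝ → ℝ) :
    (fun x => Ψ (X x) (Y kap k x)) =ᵐ[unifG] fun x => localFun Ψ k (x.1, stripNormal x.2) := by
  filter_upwards [ae_unifG_of_ae (ae_degeneracy_strip_pos k)] with x hx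
  obtain ⟨hG, hd⟩ := hx
  have hs : |x.1| < 1 / √2 := by
    refine lt_of_le_of_ne (abs_le.2 hG.1) fun h => ?_
    have := hd.trans_le (degeneracy_le_short _ (nbhd_subset k (zero_mem_nbhd k)))
    rw [shortCoord_zero] at this
    simp only [h, sub_self, abs_zero, lt_self_iff_false] at this
  rw [localFun, if_pos hs, X_eq, Y_eq, rho, kap_eq_kth hk (hkap _ _ hG) hs hd, P_im]

/-- The product rule ab - a'b' = a(b - b') + (a - a')b' explains the mixed bounds on a and b' in
`Admissible`. -/
lemma admissible_mul : Admissible (fun a b => a * b) where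
  bound a b ha hb := by
    rw [abs_mul]; exact mul_le_one₀ ha (abs_nonneg _) hb
  lipschitz a b a' b' ha hb := by
    have : a * b - a' * b' = a * (b - b') + (a - a') * b' := by ring
    rw [this, add_comm]
    refine (abs_add_le _ _).trans ?_
    rw [abs_mul, abs_mul]
    exact add_le_add (mul_le_of_le_one_right (abs_nonneg _) hb)
      (mul_le_of_le_one_left (abs_nonneg _) ha)

lemma admissible_fst : Admissible (fun a _ => a) where
  bound _ _ ha _ := ha
  lipschitz _ b _ b' _ _ := le_add_of_nonneg_right (abs_nonneg (b - b'))

lemma admissible_snd : Admissible (fun _ b => b) where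
  bound _ _ _ hb := hb
  lipschitz a _ a' _ _ _ := le_add_of_nonneg_left (abs_nonneg (a - a'))

lemma admissible_one : Admissible (fun _ _ => 1) where
  bound _ _ _ _ := by simp
  lipschitz _ _ _ _ _ _ := by rw [sub_self, abs_zero]; positivity

lemma integral_comp_X_Y {k : ℕ} (hk : 1 ≤ k) {kap : ℝ → ℝ → ℕ → ℂ}
    (hkap : ∀ r θ : ℝ, (r, θ) ∈ G → IsStripOrdering r θ (kap r θ)) {Ψ : ℝ → ℝ → ℝ}
    (hΨ : Admissible Ψ) :
    ∫ x, Ψ (X x) (Y kap k x) ∂unifG = (volume.real G)⁻¹ *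
      ∫ x in angleStrip, localFun Ψ k (x.1, Complex.exp (x.2 * Complex.I)) := by
  rw [integral_congr_ae (ae_comp_X_Y hk hkap Ψ), integral_unifG, setIntegral_G_localFun hΨ]

/-- This identifies the limit of K(R)/R as the area of G, which is the normalisation of the uniform
measure. -/
lemma integral_localFun_one (k : ℕ) :
    ∫ x in angleStrip, localFun (fun _ _ => 1) k (x.1, Complex.exp (x.2 * Complex.I)) =
      volume.real G := by
  rw [← setIntegral_G_localFun admissible_one]
  have : ∫ x in G, localFun (fun _ _ => 1) k (x.1, stripNormal x.2) = ∫ x in G, (1 : ℝ) := by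
    refine setIntegral_congr_ae measurableSet_G ?_
    filter_upwards [ae_degeneracy_strip_pos k] with x hd hG
    refine if_pos (lt_of_le_of_ne (abs_le.2 hG.1) fun h => ?_)
    have := hd.trans_le (degeneracy_le_short _ (nbhd_subset k (zero_mem_nbhd k)))
    rw [shortCoord_zero] at this
    simp only [h, sub_self, abs_zero, lt_self_iff_false] at this
  rw [this, setIntegral_const, smul_eq_mul, mul_one]

lemma integral_X : ∫ x, X x ∂unifG = 1 / 2 := by
  have hX : IntegrableOn X G := integrableOn_G_of_bound aestronglyMeasurable_X abs_X_le
  have h1 : IntegrableOn (fun _ : ℝ × ℝ => (1 : ℝ)) G :=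
    integrableOn_G_of_bound aestronglyMeasurable_const (by simp)
  have hmp : MeasurePreserving (Prod.map (Neg.neg : ℝ → ℝ) (id : ℝ → ℝ))
      (volume : Measure (ℝ × ℝ)) volume :=
    (Measure.measurePreserving_neg (volume : Measure ℝ)).prod (MeasurePreserving.id volume)
  have hemb : MeasurableEmbedding (Prod.map (Neg.neg : ℝ → ℝ) (id : ℝ → ℝ)) :=
    (MeasurableEquiv.neg ℝ).measurableEmbedding.prodMap MeasurableEmbedding.id
  have hpre : Prod.map (Neg.neg : ℝ → ℝ) (id : ℝ → ℝ) ⁻¹' G = G := by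
    ext x
    simp only [G, Set.mem_preimage, Set.mem_prod, Set.mem_Icc, Prod.map_fst, Prod.map_snd, id]
    constructor
    · rintro ⟨⟨a, b⟩, c⟩; exact ⟨⟨by linarith, by linarith⟩, c⟩
    · rintro ⟨⟨a, b⟩, c⟩; exact ⟨⟨by linarith, by linarith⟩, c⟩
  have h2 := hmp.setIntegral_preimage_emb hemb X G
  rw [hpre] at h2
  have h3 : ∀ x : ℝ × ℝ, X (Prod.map Neg.neg id x) = 1 - X x := fun x => by
    rw [X_eq, X_eq, Prod.map_fst, Prod.map_snd, id]
    exact halfArea_neg (norm_stripNormal _) _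
  simp only [h3] at h2
  rw [integral_sub h1 hX, setIntegral_const, smul_eq_mul, mul_one] at h2
  have hV := volume_real_G_pos
  rw [integral_unifG]
  have : ∫ x in G, X x = volume.real G / 2 := by linarith
  rw [this]
  field_simp

/-- Reindexing from successors to predecessors in the cyclic order. -/
lemma sum_successor_eq_sum_predecessor {R : ℝ} {lam : ℕ → ℂ} (h : IsArgOrdering R lam) (k : ℕ)
    (Φ : ℂ → ℂ → ℝ) :
    ∑ j ∈ Finset.Icc 1 (K R), Φ (lam j) (lam (j + k * (K R - 1))) =
      ∑ j ∈ Finset.Icc 1 (K R), Φ (lam (j + k)) (lam j) := by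
  rw [← sum_Icc_add_of_periodic (k := k)]
  · refine Finset.sum_congr rfl fun j hj => ?_
    have hK : 1 ≤ K R := (Finset.mem_Icc.1 hj).1.trans (Finset.mem_Icc.1 hj).2
    have e : j + k + k * (K R - 1) = j + k * K R := by
      obtain ⟨n, hn⟩ : ∃ n, K R = n + 1 := ⟨K R - 1, by omega⟩
      rw [hn]; simp; ring
    rw [e, h.periodic_mul]
  · intro j
    rw [h.periodic, show j + K R + k * (K R - 1) = j + k * (K R - 1) + K R by ring, h.periodic]

/-- Moving k steps along the cyclic order permutes Γ_R, so the two one-variable sums coincide for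
every R, hence so do their limits. No law of ρ_k has to be computed. -/
lemma integral_localFun_fst_eq_snd {k : ℕ} (hk : 1 ≤ k) :
    ∫ x in angleStrip, localFun (fun a _ => a) k (x.1, Complex.exp (x.2 * Complex.I)) =
      ∫ x in angleStrip, localFun (fun _ b => b) k (x.1, Complex.exp (x.2 * Complex.I)) := by
  choose lam hlam using exists_isArgOrdering
  have h1 := tendsto_ordered_sum hk admissible_fst fun R _ => hlam R
  have h2 := tendsto_ordered_sum hk admissible_snd fun R _ => hlam R
  refine tendsto_nhds_unique h1 (h2.congr fun R => ?_)
  rw [sum_successor_eq_sum_predecessor (hlam R) k fun _ w => areaInDisc R w]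

end CircleLattice

end

/-! ### The main theorem: normalisation by K(R) and identification as a covariance. -/

theorem mainTheorem3 (k : ℕ) (hk : 1 ≤ k) :
    ∃ C : ℝ,
      (∀ lam : ℝ → ℕ → ℂ, (∀ R : ℝ, 0 < R → CircleLattice.IsArgOrdering R (lam R)) →
        Tendsto
          (fun R : ℝ => (1 / (CircleLattice.K R : ℝ)) *
            ∑ j ∈ Finset.Icc 1 (CircleLattice.K R),
              (CircleLattice.areaInDisc R (lam R j) * CircleLattice.areaInDisc R (lam R (j + k))
                - 1 / 4))
          atTop (𝓝 C)) ∧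
      (∀ kap : ℝ → ℝ → ℕ → ℂ,
        (∀ r θ : ℝ, (r, θ) ∈ CircleLattice.G → CircleLattice.IsStripOrdering r θ (kap r θ)) →
        MemLp CircleLattice.X 2 CircleLattice.unifG ∧
        MemLp (CircleLattice.Y kap k) 2 CircleLattice.unifG ∧
        C = (∫ p, CircleLattice.X p * CircleLattice.Y kap k p ∂CircleLattice.unifG) - 1 / 4 ∧
        C = covariance CircleLattice.X (CircleLattice.Y kap k) CircleLattice.unifG) := by
  open CircleLattice in
  have hV := volume_real_G_pos
  set I := ∫ x in angleStrip, localFun (fun a b => a * b) k (x.1, Complex.exp (x.2 * Complex.I))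
    with hI
  refine ⟨(volume.real G)⁻¹ * I - 1 / 4, fun lam hlam => ?_, fun kap hkap => ?_⟩
  · have h1 := tendsto_ordered_sum hk admissible_mul hlam
    have h2 := tendsto_ordered_sum hk admissible_one hlam
    rw [integral_localFun_one] at h2
    -- The quotient of the two limits replaces the factor 1/R by 1/K(R); positivity of the limit of
    -- K(R)/R makes K(R) eventually nonzero.
    have h3 := ((h2.inv₀ hV.ne').mul h1).sub_const (1 / 4)
    refine h3.congr' ?_
    filter_upwards [eventually_gt_atTop 0, h2.eventually_const_lt hV] with R hR hpos
    simp only [Finset.sum_const, Nat.card_Icc, add_tsub_cancel_right, nsmul_eq_mul, mul_one]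
      at hpos ⊢
    have hK : (0 : ℝ) < K R := by
      have : 1 / R * (K R : ℝ) = K R / R := by ring
      rw [this] at hpos
      by_contra h
      have h0 : (K R : ℝ) = 0 := le_antisymm (not_lt.1 h) (Nat.cast_nonneg _)
      rw [h0, zero_div] at hpos
      exact lt_irrefl _ hpos
    rw [sum_successor_eq_sum_predecessor (hlam R hR) k
      fun z w => areaInDisc R z * areaInDisc R w, Finset.sum_sub_distrib, Finset.sum_const,
      Nat.card_Icc, add_tsub_cancel_right, nsmul_eq_mul]
    have e : ∑ j ∈ Finset.Icc 1 (K R), areaInDisc R (lam R (j + k)) * areaInDisc R (lam R j) =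
        ∑ j ∈ Finset.Icc 1 (K R), areaInDisc R (lam R j) * areaInDisc R (lam R (j + k)) :=
      Finset.sum_congr rfl fun _ _ => mul_comm _ _
    rw [e]
    field_simp
  · have hX : MemLp X 2 unifG := by
      refine MemLp.of_bound ?_ 1 (.of_forall abs_X_le)
      exact aestronglyMeasurable_X.restrict.smul_measure _
    have hY : MemLp (Y kap k) 2 unifG := by
      refine MemLp.of_bound ?_ 1 (.of_forall (abs_Y_le kap k))
      exact ((aestronglyMeasurable_localFun_strip admissible_snd k).restrict.smul_measure _).congr
        (ae_comp_X_Y hk hkap fun _ b => b).symm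
    have hXY : ∫ p, X p * Y kap k p ∂unifG = (volume.real G)⁻¹ * I :=
      integral_comp_X_Y hk hkap admissible_mul
    have hEX := integral_X
    have hEY : ∫ p, Y kap k p ∂unifG = 1 / 2 := by
      have e1 := integral_comp_X_Y hk hkap admissible_fst
      have e2 := integral_comp_X_Y hk hkap admissible_snd
      rw [← integral_localFun_fst_eq_snd hk, ← e1] at e2
      exact e2.trans hEX
    refine ⟨hX, hY, by rw [hXY], ?_⟩
    rw [covariance_eq_sub hX hY, hEX, hEY]
    have : ∫ p, (X * Y kap k) p ∂unifG = (volume.real G)⁻¹ * I := hXY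
    rw [this]
    norm_num
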